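/- Let $k$ be a field and let $\mathrm{Cat}_{dg}(k)$ be the category of small dg categories over $k$ (cohomological grading, differentials of degree $+1$) and dg functors. **Twisted tensor product.** For small dg categories $C,D$ let $C\tilde\otimes D$ be the dg category with object set $\mathrm{Ob}\,C\times\mathrm{Ob}\,D$ generated by copies $C\otimes \mathrm{id}_d$ of $C$ $(d\in D)$ and $\mathrm{id}_c\otimes D$ of $D$ $(c\in C)$, sharing the identities $\mathrm{id}_c\otimes\mathrm{id}_d=\mathrm{id}_{(c,d)}$, and by morphisms $$\varepsilon(f;g_1,\dots,g_n)\colon (c_0,d_0)\to(c_1,d_n),\qquad \deg \varepsilon(f;g_1,\dots,g_n)=|f|+\sum_{j}(|g_j|-1),\qquad n\ge 1,$$ one for each homogeneous $f\colon c_0\to c_1$ in $C$ and each chain $d_0\xrightarrow{g_1}d_1\to\cdots\xrightarrow{g_n}d_n$ of homogeneous morphisms in $D$, subject to the following relations, where $\varepsilon(f;\,)$ means $f\otimes\mathrm{id}$. The symbol $\varepsilon(f;g_1,\dots,g_n)$ is linear in each argument. For $n\ge1$ it vanishes if $f$ or some $g_i$ is an identity. One has $$\varepsilon(f_2f_1;g_1,\dots,g_N)=\sum_{m=0}^N(-1)^{|f_1|\sum_{j>m}(|g_j|-1)}\,\varepsilon(f_2;g_{m+1},\dots,g_N)\circ\varepsilon(f_1;g_1,\dots,g_m).$$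 The differential is given by the differentials of $C$ and $D$ on the two families of copies and, for $n\ge1$, by $$\begin{aligned}\varepsilon(df;g_1,\dots,g_n)={}&d\,\varepsilon(f;g_1,\dots,g_n)+\sum_{j=1}^n(-1)^{|f|+\sum_{i>j}(|g_i|+1)}\varepsilon(f;g_1,\dots,dg_j,\dots,g_n)\\&+(-1)^{|f||g_n|+|f|}(\mathrm{id}_{c_1}\otimes g_n)\circ\varepsilon(f;g_1,\dots,g_{n-1})\\&+(-1)^{|f|+1+\sum_{i\ge2}(|g_i|+1)}\varepsilon(f;g_2,\dots,g_n)\circ(\mathrm{id}_{c_0}\otimes g_1)\\&+\sum_{i=1}^{n-1}(-1)^{|f|+\sum_{j>i}(|g_j|+1)}\varepsilon(f;g_1,\dots,g_{i+1}g_i,\dots,g_n).\end{aligned}$$ This construction is functorial: $(F\tilde\otimes G)(\mathrm{id}_c\otimes g)=\mathrm{id}_{Fc}\otimes Gg$ and $(F\tilde\otimes G)(\varepsilon(f;g_1,\dots,g_n))=\varepsilon(Ff;Gg_1,\dots,Gg_n)$, also for $n=0$. Let $\underline k$ be the dg category with one object $*$ and endomorphism complex $k$ in degree $0$. **Skew monoidal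 categories.** A skew monoidal category is a category $\mathscr C$ with a functor $\tilde\otimes\colon\mathscr C\times\mathscr C\to\mathscr C$, an object $I$ and natural transformations $\alpha_{X,Y,Z}\colon(X\tilde\otimes Y)\tilde\otimes Z\to X\tilde\otimes(Y\tilde\otimes Z)$, $\lambda_X\colon I\tilde\otimes X\to X$, $\rho_X\colon X\to X\tilde\otimes I$, not assumed invertible, such that $$\alpha_{W,X,Y\tilde\otimes Z}\,\alpha_{W\tilde\otimes X,Y,Z}=(\mathrm{id}_W\tilde\otimes\alpha_{X,Y,Z})\,\alpha_{W,X\tilde\otimes Y,Z}\,(\alpha_{W,X,Y}\tilde\otimes\mathrm{id}_Z),$$ $$\lambda_{X\tilde\otimes Y}\,\alpha_{I,X,Y}=\lambda_X\tilde\otimes\mathrm{id}_Y,\qquad(\mathrm{id}_X\tilde\otimes\lambda_Y)\,\alpha_{X,I,Y}\,(\rho_X\tilde\otimes\mathrm{id}_Y)=\mathrm{id}_{X\tilde\otimes Y},$$ $$\alpha_{X,Y,I}\,\rho_{X\tilde\otimes Y}=\mathrm{id}_X\tilde\otimes\rho_Y,\qquad\lambda_I\,\rho_I=\mathrm{id}_I.$$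 It is called perfect if $\alpha_{X,I,Y}$, $\lambda_X$ and $\rho_X$ are isomorphisms for all $X,Y$. **Theorem.** There are dg functors $\alpha_{C,D,E}\colon(C\tilde\otimes D)\tilde\otimes E\to C\tilde\otimes(D\tilde\otimes E)$, $\lambda_C\colon\underline k\tilde\otimes C\to C$ and $\rho_C\colon C\to C\tilde\otimes\underline k$, given on objects by $((c,d),e)\mapsto(c,(d,e))$, $(*,c)\mapsto c$ and $c\mapsto(c,*)$, with $\lambda_C(\mathrm{id}_*\otimes g)=g$, $\rho_C(f)=f\otimes\mathrm{id}_*$, and, for all $K,N\ge 0$, $$\alpha(\mathrm{id}_{(c,d)}\otimes h)=\mathrm{id}_c\otimes(\mathrm{id}_d\otimes h),\qquad\alpha(\varepsilon(\mathrm{id}_c\otimes g;h_1,\dots,h_N))=\mathrm{id}_c\otimes\varepsilon(g;h_1,\dots,h_N),$$ $$\begin{aligned}&\alpha\big(\varepsilon(\varepsilon(f;g_1,\dots,g_K);h_1,\dots,h_N)\big)=\sum_{0\le i_1\le j_1\le i_2\le\dots\le i_K\le j_K\le N}(-1)^{\sum_{\ell=1}^K(|g_\ell|-1)\sum_{s>j_\ell}(|h_s|-1)}\\&\qquad\varepsilon\big(f;h_1,\dots,h_{i_1},\varepsilon(g_1;h_{i_1+1},\dots,h_{j_1}),h_{j_1+1},\dots,h_{i_K},\varepsilon(g_K;h_{i_K+1},\dots,h_{j_K}),h_{j_K+1},\dots,h_N\big)\end{aligned}$$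 (inside the outer $\varepsilon(f;\dots)$, $h_s$ stands for $\mathrm{id}\otimes h_s$, with the appropriate identity morphism of $D$). With these $\alpha,\lambda,\rho$, the category $\mathrm{Cat}_{dg}(k)$ with the twisted tensor product $\tilde\otimes$ and the unit $\underline k$ is a perfect skew monoidal category. -/

import Mathlib

open CategoryTheory

universe u

/-! ## Small dg categories over `k` and dg functors -/

/-- The sign `(-1)^n`, as an element of `k`. -/
def sgn (k : Type u) [CommRing k] (n : ℤ) : k := ((n.negOnePow : ℤ) : k)

/-- A small dg category over `k`. `Hom x y n` is the module of morphisms of degree `n`, the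
differential has degree `+1`, and `comp g f h` is the composition `g ∘ f` (first `f`, then `g`),
regarded, along `h : q + p = n`, as a morphism of degree `n`. -/
structure DGCat (k : Type u) [CommRing k] where
  Obj : Type u
  Hom : Obj → Obj → ℤ → Type u
  [addCommGroup : ∀ x y n, AddCommGroup (Hom x y n)]
  [module : ∀ x y n, Module k (Hom x y n)]
  id : ∀ x, Hom x x 0
  comp : ∀ {x y z : Obj} {p q n : ℤ}, Hom y z q → Hom x y p → q + p = n → Hom x z n
  d : ∀ {x y : Obj} {n : ℤ}, Hom x y n → Hom x y (n + 1)
  add_comp : ∀ {x y z : Obj} {p q n : ℤ} (g g' : Hom y z q) (f : Hom x y p) (h : q + p = n),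
    comp (g + g') f h = comp g f h + comp g' f h
  comp_add : ∀ {x y z : Obj} {p q n : ℤ} (g : Hom y z q) (f f' : Hom x y p) (h : q + p = n),
    comp g (f + f') h = comp g f h + comp g f' h
  smul_comp : ∀ {x y z : Obj} {p q n : ℤ} (a : k) (g : Hom y z q) (f : Hom x y p)
    (h : q + p = n), comp (a • g) f h = a • comp g f h
  comp_smul : ∀ {x y z : Obj} {p q n : ℤ} (a : k) (g : Hom y z q) (f : Hom x y p)
    (h : q + p = n), comp g (a • f) h = a • comp g f h
  id_comp : ∀ {x y : Obj} {n : ℤ} (f : Hom x y n) (h : 0 + n = n), comp (id y) f h = f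
  comp_id : ∀ {x y : Obj} {n : ℤ} (f : Hom x y n) (h : n + 0 = n), comp f (id x) h = f
  assoc : ∀ {w x y z : Obj} {p q r s t n : ℤ} (c : Hom y z r) (b : Hom x y q) (a : Hom w x p)
    (h₁ : r + q = s) (h₂ : s + p = n) (h₃ : q + p = t) (h₄ : r + t = n),
    comp (comp c b h₁) a h₂ = comp c (comp b a h₃) h₄
  d_add : ∀ {x y : Obj} {n : ℤ} (f f' : Hom x y n), d (f + f') = d f + d f'
  d_smul : ∀ {x y : Obj} {n : ℤ} (a : k) (f : Hom x y n), d (a • f) = a • d f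
  d_d : ∀ {x y : Obj} {n : ℤ} (f : Hom x y n), d (d f) = 0
  leibniz : ∀ {x y z : Obj} {p q n : ℤ} (g : Hom y z q) (f : Hom x y p) (h : q + p = n),
    d (comp g f h) = comp (d g) f (by omega) + sgn k q • comp g (d f) (by omega)

attribute [instance] DGCat.addCommGroup DGCat.module

/-- A dg functor `A → B` with prescribed map `φ` on objects. -/
structure DGFunctorOver {k : Type u} [CommRing k] (A B : DGCat k) (φ : A.Obj → B.Obj) where
  map : ∀ {x y : A.Obj} {n : ℤ}, A.Hom x y n → B.Hom (φ x) (φ y) n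
  map_add : ∀ {x y : A.Obj} {n : ℤ} (f f' : A.Hom x y n), map (f + f') = map f + map f'
  map_smul : ∀ {x y : A.Obj} {n : ℤ} (a : k) (f : A.Hom x y n), map (a • f) = a • map f
  map_id : ∀ x : A.Obj, map (A.id x) = B.id (φ x)
  map_comp : ∀ {x y z : A.Obj} {p q n : ℤ} (g : A.Hom y z q) (f : A.Hom x y p) (h : q + p = n),
    map (A.comp g f h) = B.comp (map g) (map f) h
  map_d : ∀ {x y : A.Obj} {n : ℤ} (f : A.Hom x y n), map (A.d f) = B.d (map f)

theorem DGFunctorOver.ext {k : Type u} [CommRing k] {A B : DGCat k} {φ : A.Obj → B.Obj}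
    {F G : DGFunctorOver A B φ}
    (H : ∀ {x y : A.Obj} {n : ℤ} (f : A.Hom x y n), F.map f = G.map f) : F = G := by
  cases F
  cases G
  congr
  funext x y n f
  exact H f

/-- A dg functor `A → B`. -/
structure DGFunctor {k : Type u} [CommRing k] (A B : DGCat k) where
  obj : A.Obj → B.Obj
  toOver : DGFunctorOver A B obj

/-- The category of small dg categories over `k` and dg functors. -/
instance DGCat.category (k : Type u) [CommRing k] : Category (DGCat k) where
  Hom A B := DGFunctor A B
  id A := ⟨fun x => x, ⟨fun f => f, fun _ _ => rfl, fun _ _ => rfl, fun _ => rfl,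
    fun _ _ _ => rfl, fun _ => rfl⟩⟩
  comp F G := ⟨fun x => G.obj (F.obj x),
    { map := fun f => G.toOver.map (F.toOver.map f)
      map_add := fun f f' => by rw [F.toOver.map_add, G.toOver.map_add]
      map_smul := fun a f => by rw [F.toOver.map_smul, G.toOver.map_smul]
      map_id := fun x => by rw [F.toOver.map_id, G.toOver.map_id]
      map_comp := fun g f h => by rw [F.toOver.map_comp, G.toOver.map_comp]
      map_d := fun f => by rw [F.toOver.map_d, G.toOver.map_d] }⟩

/-- A dg functor with prescribed map on objects, as a morphism of the category `DGCat k`. -/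
def DGFunctorOver.toHom {k : Type u} [CommRing k] {A B : DGCat k} {φ : A.Obj → B.Obj}
    (F : DGFunctorOver A B φ) : A ⟶ B :=
  DGFunctor.mk φ F

/-- The morphisms of degree `n` of the dg category `k`: all of `k` for `n = 0`, zero otherwise. -/
def DGCat.unitHom (k : Type u) [CommRing k] (n : ℤ) : Submodule k k where
  carrier := {a | n ≠ 0 → a = 0}
  add_mem' ha hb h := by rw [ha h, hb h, add_zero]
  zero_mem' _ := rfl
  smul_mem' c a ha h := by rw [ha h, smul_zero]

/-- The dg category with a single object, whose complex of endomorphisms is `k` in degree `0`. -/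
def DGCat.unit (k : Type u) [CommRing k] : DGCat k where
  Obj := PUnit
  Hom _ _ n := DGCat.unitHom k n
  id _ := ⟨1, fun h => absurd rfl h⟩
  comp {_ _ _ p q n} g f h := ⟨g.1 * f.1, fun hn => by
    by_cases hq : q = 0
    · rw [f.2 (by omega), mul_zero]
    · rw [g.2 hq, zero_mul]⟩
  d _ := 0
  add_comp g g' f h := Subtype.ext (add_mul g.1 g'.1 f.1)
  comp_add g f f' h := Subtype.ext (mul_add g.1 f.1 f'.1)
  smul_comp a g f h := Subtype.ext (mul_assoc a g.1 f.1)
  comp_smul a g f h := Subtype.ext (mul_left_comm g.1 a f.1)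
  id_comp f h := Subtype.ext (one_mul f.1)
  comp_id f h := Subtype.ext (mul_one f.1)
  assoc c b a _ _ _ _ := Subtype.ext (mul_assoc c.1 b.1 a.1)
  d_add _ _ := (add_zero _).symm
  d_smul a _ := (smul_zero a).symm
  d_d _ := rfl
  leibniz g f h := Subtype.ext (by simp)

/-! ## Chains of composable homogeneous morphisms -/

/-- `Chain D x y n`: chains `x = d₀ → d₁ → ⋯ → d_N = y` of homogeneous morphisms `g₁, …, g_N`
of `D`, `N ≥ 0`, with `n = (|g₁| - 1) + ⋯ + (|g_N| - 1)`. The morphism `g₁`, applied first, is the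
head of the chain. -/
inductive Chain {k : Type u} [CommRing k] (D : DGCat k) : D.Obj → D.Obj → ℤ → Type u
  | nil (x : D.Obj) : Chain D x x 0
  | cons {x y z : D.Obj} {p q n : ℤ} (g : D.Hom x y p) (c : Chain D y z q)
      (h : p - 1 + q = n) : Chain D x z n

namespace Chain

variable {k : Type u} [CommRing k]

/-- The chain consisting of a single morphism. -/
def single {D : DGCat k} {x y : D.Obj} {p : ℤ} (g : D.Hom x y p) : Chain D x y (p - 1) :=
  cons g (nil y) (by omega)

/-- `snoc c g` is the chain `c` followed by the morphism `g`. -/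
def snoc {D : DGCat k} {x y z : D.Obj} {m q n : ℤ} (c : Chain D x y m) (g : D.Hom y z q)
    (h : m + (q - 1) = n) : Chain D x z n :=
  match c with
  | nil _ => cons g (nil z) (by omega)
  | cons g₁ c' h₁ => cons g₁ (snoc c' g rfl) (by omega)

/-- `IsAdd c c₁ c₂`: the three chains agree except in one entry, in which the entry of `c` is the
sum of those of `c₁` and `c₂`. -/
inductive IsAdd {D : DGCat k} : ∀ {x y : D.Obj} {n : ℤ},
    Chain D x y n → Chain D x y n → Chain D x y n → Prop
  | head {x y z : D.Obj} {p q n : ℤ} (g g' : D.Hom x y p) (c : Chain D y z q)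
      (h : p - 1 + q = n) : IsAdd (cons (g + g') c h) (cons g c h) (cons g' c h)
  | tail {x y z : D.Obj} {p q n : ℤ} (g : D.Hom x y p) {c c₁ c₂ : Chain D y z q}
      (h : p - 1 + q = n) (H : IsAdd c c₁ c₂) : IsAdd (cons g c h) (cons g c₁ h) (cons g c₂ h)

/-- `IsSMul a c c₁`: the two chains agree except in one entry, in which the entry of `c` is `a`
times that of `c₁`. -/
inductive IsSMul {D : DGCat k} (a : k) : ∀ {x y : D.Obj} {n : ℤ},
    Chain D x y n → Chain D x y n → Prop
  | head {x y z : D.Obj} {p q n : ℤ} (g : D.Hom x y p) (c : Chain D y z q)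
      (h : p - 1 + q = n) : IsSMul a (cons (a • g) c h) (cons g c h)
  | tail {x y z : D.Obj} {p q n : ℤ} (g : D.Hom x y p) {c c₁ : Chain D y z q}
      (h : p - 1 + q = n) (H : IsSMul a c c₁) : IsSMul a (cons g c h) (cons g c₁ h)

/-- Some entry of the chain is an identity morphism. -/
inductive HasId {D : DGCat k} : ∀ {x y : D.Obj} {n : ℤ}, Chain D x y n → Prop
  | head {x z : D.Obj} {q n : ℤ} (c : Chain D x z q) (h : 0 - 1 + q = n) :
      HasId (cons (D.id x) c h)
  | tail {x y z : D.Obj} {p q n : ℤ} (g : D.Hom x y p) {c : Chain D y z q}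
      (h : p - 1 + q = n) (H : HasId c) : HasId (cons g c h)

/-- A way to cut a chain from `x` to `y` into an initial piece `fst` and a final piece `snd`. -/
structure Split (D : DGCat k) (x y : D.Obj) (n : ℤ) where
  mid : D.Obj
  p : ℤ
  q : ℤ
  fst : Chain D x mid p
  snd : Chain D mid y q
  h : p + q = n

/-- All the cuts of the chain `g₁, …, g_N` into `g₁, …, g_m` and `g_{m+1}, …, g_N`, for
`0 ≤ m ≤ N`. -/
def splits {D : DGCat k} {x y : D.Obj} {n : ℤ} : Chain D x y n → List (Split D x y n)
  | nil x => [⟨x, 0, 0, nil x, nil x, rfl⟩]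
  | cons (x := x) g c h => ⟨x, 0, n, nil x, cons g c h, by omega⟩ ::
      (splits c).map fun s =>
        ⟨s.mid, _, s.q, cons g s.fst rfl, s.snd, by have := s.h; omega⟩

/-- The chains `g₁, …, d g_j, …, g_N`, `1 ≤ j ≤ N`, each preceded by an integer congruent modulo
`2` to `∑_{i > j} (|g_i| + 1)`. -/
def dTerms {D : DGCat k} {x y : D.Obj} {n : ℤ} :
    Chain D x y n → List (ℤ × Chain D x y (n + 1))
  | nil _ => []
  | cons (q := q) g c h => (q, cons (D.d g) c (by omega)) ::
      (dTerms c).map fun t => (t.1, cons g t.2 (by omega))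

/-- The chains `g₁, …, g_{i+1} ∘ g_i, …, g_N`, `1 ≤ i ≤ N - 1`, each preceded by an integer
congruent modulo `2` to `∑_{j > i} (|g_j| + 1)`. -/
def compTerms {D : DGCat k} {x y : D.Obj} {n : ℤ} :
    Chain D x y n → List (ℤ × Chain D x y (n + 1))
  | nil _ => []
  | cons _ (nil _) _ => []
  | cons (q := q) g₁ (cons g₂ c h₂) h₁ => (q, cons (D.comp g₂ g₁ rfl) c (by omega)) ::
      (compTerms (cons g₂ c h₂)).map fun t => (t.1, cons g₁ t.2 (by omega))

/-- The image of a chain under a dg functor. -/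
def map {D D' : DGCat k} {φ : D.Obj → D'.Obj} (F : DGFunctorOver D D' φ) {x y : D.Obj} {n : ℤ} :
    Chain D x y n → Chain D' (φ x) (φ y) n
  | nil x => nil (φ x)
  | cons g c h => cons (F.map g) (map F c) h

variable {D D' : DGCat k} {ψ : D.Obj → D'.Obj} (G : DGFunctorOver D D' ψ)

/-- The image of a cut chain under a dg functor. -/
def Split.map {x y : D.Obj} {n : ℤ} (s : Split D x y n) :
    Split D' (ψ x) (ψ y) n :=
  ⟨ψ s.mid, s.p, s.q, s.fst.map G, s.snd.map G, s.h⟩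

theorem splits_map {x y : D.Obj} {n : ℤ} (c : Chain D x y n) :
    (c.map G).splits = c.splits.map (Chain.Split.map G) := by
  induction c with
  | nil x => rfl
  | cons g c h ih =>
    simp only [Chain.map, Chain.splits, List.map_cons, ih, List.map_map]
    rfl

theorem dTerms_map {x y : D.Obj} {n : ℤ} (c : Chain D x y n) :
    (c.map G).dTerms = c.dTerms.map fun t => (t.1, t.2.map G) := by
  induction c with
  | nil x => rfl
  | cons g c h ih =>
    simp only [Chain.map, Chain.dTerms, List.map_cons, ih, List.map_map, G.map_d]
    rfl

theorem compTerms_map {x y : D.Obj} {n : ℤ} (c : Chain D x y n) :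
    (c.map G).compTerms = c.compTerms.map fun t => (t.1, t.2.map G) := by
  induction c with
  | nil x => rfl
  | cons g c h ih =>
    cases c with
    | nil _ => rfl
    | cons g' c h' =>
      simp only [Chain.map] at ih
      simp only [Chain.map, Chain.compTerms, List.map_cons, ih, List.map_map, G.map_comp]
      rfl

theorem snoc_map {x y z : D.Obj} {m q n : ℤ} (c : Chain D x y m) (g : D.Hom y z q)
    (h : m + (q - 1) = n) : (c.snoc g h).map G = (c.map G).snoc (G.map g) h := by
  induction c generalizing n with
  | nil x => rfl
  | cons g' c h' ih => simp only [Chain.map, Chain.snoc, ih]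

theorem IsAdd.map {x y : D.Obj} {n : ℤ} {c c₁ c₂ : Chain D x y n}
    (H : c.IsAdd c₁ c₂) : (c.map G).IsAdd (c₁.map G) (c₂.map G) := by
  induction H with
  | head g g' c h =>
    simp only [Chain.map, G.map_add]
    exact Chain.IsAdd.head _ _ _ h
  | tail g h H ih => exact Chain.IsAdd.tail _ h ih

theorem IsSMul.map {a : k} {x y : D.Obj} {n : ℤ} {c c₁ : Chain D x y n}
    (H : c.IsSMul a c₁) : (c.map G).IsSMul a (c₁.map G) := by
  induction H with
  | head g c h =>
    simp only [Chain.map, G.map_smul]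
    exact Chain.IsSMul.head _ _ h
  | tail g h H ih => exact Chain.IsSMul.tail _ h ih

theorem HasId.map {x y : D.Obj} {n : ℤ} {c : Chain D x y n}
    (H : c.HasId) : (c.map G).HasId := by
  induction H with
  | head c h =>
    simp only [Chain.map, G.map_id]
    exact Chain.HasId.head _ h
  | tail g h H ih => exact Chain.HasId.tail _ h ih

theorem map_id {x y : D.Obj} {n : ℤ} (c : Chain D x y n) :
    c.map (𝟙 D : DGFunctor D D).toOver = c := by
  induction c with
  | nil x => rfl
  | cons g c h ih => exact congrArg (fun c => cons g c h) ih

theorem map_comp {D D' D'' : DGCat k} (G : D ⟶ D') (G' : D' ⟶ D'') {x y : D.Obj} {n : ℤ}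
    (c : Chain D x y n) :
    c.map (G ≫ G' : DGFunctor D D'').toOver = (c.map G.toOver).map G'.toOver := by
  induction c with
  | nil x => rfl
  | cons g c h ih => exact congrArg (fun c => cons (G'.toOver.map (G.toOver.map g)) c h) ih

end Chain

/-! ## The twisted tensor product -/

namespace Twisted

variable {k : Type u} [CommRing k]

/-- Formal expressions for the morphisms of degree `n` of the twisted tensor product of `C` and
`D`. The generators are `right c g`, that is `id_c ⊗ g`, and `eps f (g₁, …, g_N)`, that is
`ε(f; g₁, …, g_N)` for `N ≥ 1` and `f ⊗ id_d` for the empty chain at `d`. -/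
inductive Expr (C D : DGCat k) : C.Obj × D.Obj → C.Obj × D.Obj → ℤ → Type u
  | right (c : C.Obj) {x y : D.Obj} {n : ℤ} (g : D.Hom x y n) : Expr C D (c, x) (c, y) n
  | eps {a b : C.Obj} {x y : D.Obj} {p q n : ℤ} (f : C.Hom a b p) (c : Chain D x y q)
      (h : p + q = n) : Expr C D (a, x) (b, y) n
  | id (x : C.Obj × D.Obj) : Expr C D x x 0
  | comp {x y z : C.Obj × D.Obj} {p q n : ℤ} (t : Expr C D y z q) (s : Expr C D x y p)
      (h : q + p = n) : Expr C D x z n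
  | d {x y : C.Obj × D.Obj} {n : ℤ} (s : Expr C D x y n) : Expr C D x y (n + 1)
  | zero {x y : C.Obj × D.Obj} {n : ℤ} : Expr C D x y n
  | add {x y : C.Obj × D.Obj} {n : ℤ} (s t : Expr C D x y n) : Expr C D x y n
  | neg {x y : C.Obj × D.Obj} {n : ℤ} (s : Expr C D x y n) : Expr C D x y n
  | smul {x y : C.Obj × D.Obj} {n : ℤ} (a : k) (s : Expr C D x y n) : Expr C D x y n

/-- The sum of a list of expressions. -/
def Expr.sum {C D : DGCat k} {x y : C.Obj × D.Obj} {n : ℤ} (l : List (Expr C D x y n)) :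
    Expr C D x y n :=
  l.foldr Expr.add Expr.zero

open Twisted.Expr in
/-- The relations between formal expressions: the smallest congruence that contains the axioms of
a dg category and the defining relations of the twisted tensor product. -/
inductive Rel (C D : DGCat k) : ∀ {x y : C.Obj × D.Obj} {n : ℤ},
    Expr C D x y n → Expr C D x y n → Prop
  -- equivalence relation and congruence
  | refl {x y n} (s : Expr C D x y n) : Rel C D s s
  | symm {x y n} {s t : Expr C D x y n} : Rel C D s t → Rel C D t s
  | trans {x y n} {s t r : Expr C D x y n} : Rel C D s t → Rel C D t r → Rel C D s r
  | comp_congr {x y z} {p q n : ℤ} {t t' : Expr C D y z q} {s s' : Expr C D x y p}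
      (h : q + p = n) : Rel C D t t' → Rel C D s s' → Rel C D (comp t s h) (comp t' s' h)
  | d_congr {x y n} {s s' : Expr C D x y n} : Rel C D s s' → Rel C D (d s) (d s')
  | add_congr {x y n} {s s' t t' : Expr C D x y n} :
      Rel C D s s' → Rel C D t t' → Rel C D (add s t) (add s' t')
  | neg_congr {x y n} {s s' : Expr C D x y n} : Rel C D s s' → Rel C D (neg s) (neg s')
  | smul_congr {x y n} (a : k) {s s' : Expr C D x y n} :
      Rel C D s s' → Rel C D (smul a s) (smul a s')
  -- axioms of a module
  | add_assoc {x y n} (r s t : Expr C D x y n) : Rel C D (add (add r s) t) (add r (add s t))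
  | add_comm {x y n} (s t : Expr C D x y n) : Rel C D (add s t) (add t s)
  | zero_add {x y n} (s : Expr C D x y n) : Rel C D (add zero s) s
  | neg_add {x y n} (s : Expr C D x y n) : Rel C D (add (neg s) s) zero
  | smul_add {x y n} (a : k) (s t : Expr C D x y n) :
      Rel C D (smul a (add s t)) (add (smul a s) (smul a t))
  | add_smul {x y n} (a b : k) (s : Expr C D x y n) :
      Rel C D (smul (a + b) s) (add (smul a s) (smul b s))
  | mul_smul {x y n} (a b : k) (s : Expr C D x y n) :
      Rel C D (smul (a * b) s) (smul a (smul b s))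
  | one_smul {x y n} (s : Expr C D x y n) : Rel C D (smul 1 s) s
  -- axioms of a dg category
  | add_comp {x y z} {p q n : ℤ} (t t' : Expr C D y z q) (s : Expr C D x y p) (h : q + p = n) :
      Rel C D (comp (add t t') s h) (add (comp t s h) (comp t' s h))
  | comp_add {x y z} {p q n : ℤ} (t : Expr C D y z q) (s s' : Expr C D x y p) (h : q + p = n) :
      Rel C D (comp t (add s s') h) (add (comp t s h) (comp t s' h))
  | smul_comp {x y z} {p q n : ℤ} (a : k) (t : Expr C D y z q) (s : Expr C D x y p)
      (h : q + p = n) : Rel C D (comp (smul a t) s h) (smul a (comp t s h))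
  | comp_smul {x y z} {p q n : ℤ} (a : k) (t : Expr C D y z q) (s : Expr C D x y p)
      (h : q + p = n) : Rel C D (comp t (smul a s) h) (smul a (comp t s h))
  | id_comp {x y n} (s : Expr C D x y n) (h : 0 + n = n) : Rel C D (comp (id y) s h) s
  | comp_id {x y n} (s : Expr C D x y n) (h : n + 0 = n) : Rel C D (comp s (id x) h) s
  | assoc {w x y z} {p q r i j n : ℤ} (t : Expr C D y z r) (s : Expr C D x y q)
      (v : Expr C D w x p) (h₁ : r + q = i) (h₂ : i + p = n) (h₃ : q + p = j) (h₄ : r + j = n) :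
      Rel C D (comp (comp t s h₁) v h₂) (comp t (comp s v h₃) h₄)
  | d_add {x y n} (s t : Expr C D x y n) : Rel C D (d (add s t)) (add (d s) (d t))
  | d_smul {x y n} (a : k) (s : Expr C D x y n) : Rel C D (d (smul a s)) (smul a (d s))
  | d_d {x y n} (s : Expr C D x y n) : Rel C D (d (d s)) zero
  | leibniz {x y z} {p q n : ℤ} (t : Expr C D y z q) (s : Expr C D x y p) (h : q + p = n) :
      Rel C D (d (comp t s h))
        (add (comp (d t) s (by omega)) (smul (sgn k q) (comp t (d s) (by omega))))
  -- `id_c ⊗ D` is a copy of the dg category `D`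
  | right_add (c : C.Obj) {x y : D.Obj} {n : ℤ} (g g' : D.Hom x y n) :
      Rel C D (right c (g + g')) (add (right c g) (right c g'))
  | right_smul (c : C.Obj) {x y : D.Obj} {n : ℤ} (a : k) (g : D.Hom x y n) :
      Rel C D (right c (a • g)) (smul a (right c g))
  | right_id (c : C.Obj) (x : D.Obj) : Rel C D (right c (D.id x)) (id (c, x))
  | right_comp (c : C.Obj) {x y z : D.Obj} {p q n : ℤ} (g₂ : D.Hom y z q) (g₁ : D.Hom x y p)
      (h : q + p = n) : Rel C D (right c (D.comp g₂ g₁ h)) (comp (right c g₂) (right c g₁) h)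
  | right_d (c : C.Obj) {x y : D.Obj} {n : ℤ} (g : D.Hom x y n) :
      Rel C D (right c (D.d g)) (d (right c g))
  -- `ε(f; g₁, …, g_N)` is linear in each argument
  | eps_add {a b : C.Obj} {x y : D.Obj} {p q n : ℤ} (f f' : C.Hom a b p) (c : Chain D x y q)
      (h : p + q = n) : Rel C D (eps (f + f') c h) (add (eps f c h) (eps f' c h))
  | eps_smul {a b : C.Obj} {x y : D.Obj} {p q n : ℤ} (r : k) (f : C.Hom a b p)
      (c : Chain D x y q) (h : p + q = n) : Rel C D (eps (r • f) c h) (smul r (eps f c h))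
  | eps_chain_add {a b : C.Obj} {x y : D.Obj} {p q n : ℤ} (f : C.Hom a b p)
      {c c₁ c₂ : Chain D x y q} (h : p + q = n) (H : c.IsAdd c₁ c₂) :
      Rel C D (eps f c h) (add (eps f c₁ h) (eps f c₂ h))
  | eps_chain_smul {a b : C.Obj} {x y : D.Obj} {p q n : ℤ} (r : k) (f : C.Hom a b p)
      {c c₁ : Chain D x y q} (h : p + q = n) (H : c.IsSMul r c₁) :
      Rel C D (eps f c h) (smul r (eps f c₁ h))
  -- identities
  | eps_id_nil (a : C.Obj) (x : D.Obj) :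
      Rel C D (eps (C.id a) (Chain.nil x) (Int.add_zero 0)) (id (a, x))
  | eps_id_cons (a : C.Obj) {x y z : D.Obj} {p q m n : ℤ} (g : D.Hom x y p) (c : Chain D y z q)
      (hc : p - 1 + q = m) (h : 0 + m = n) :
      Rel C D (eps (C.id a) (Chain.cons g c hc) h) zero
  | eps_hasId {a b : C.Obj} {x y : D.Obj} {p q n : ℤ} (f : C.Hom a b p) {c : Chain D x y q}
      (h : p + q = n) (H : c.HasId) : Rel C D (eps f c h) zero
  -- `ε(f₂ f₁; g₁, …, g_N)` is the sum over `0 ≤ m ≤ N` of the composites of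
  -- `ε(f₂; g_{m+1}, …, g_N)` and `ε(f₁; g₁, …, g_m)`; for `N = 0` this says that `C ⊗ id_d`
  -- respects compositions
  | eps_comp {a b e : C.Obj} {x y : D.Obj} {p₁ p₂ p q n : ℤ} (f₂ : C.Hom b e p₂)
      (f₁ : C.Hom a b p₁) (hp : p₂ + p₁ = p) (c : Chain D x y q) (h : p + q = n) :
      Rel C D (eps (C.comp f₂ f₁ hp) c h)
        (Expr.sum (c.splits.map fun s => smul (sgn k (p₁ * s.q))
          (comp (eps f₂ s.snd rfl) (eps f₁ s.fst rfl) (by have := s.h; omega))))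
  -- the differential of `f ⊗ id_d`
  | d_eps_nil {a b : C.Obj} (x : D.Obj) {p n : ℤ} (f : C.Hom a b p) (h : p + 0 = n) :
      Rel C D (eps (C.d f) (Chain.nil x) (by omega)) (d (eps f (Chain.nil x) h))
  -- the differential of `ε(f; g)`
  | d_eps_single {a b : C.Obj} {x y : D.Obj} {p q n : ℤ} (f : C.Hom a b p) (g : D.Hom x y q)
      (h : p + (q - 1) = n) :
      Rel C D (eps (C.d f) (Chain.single g) (by omega))
        (add (d (eps f (Chain.single g) h))
        (add (smul (sgn k p) (eps f (Chain.single (D.d g)) (by omega)))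
        (add (smul (sgn k (p * q + p))
          (comp (right b g) (eps f (Chain.nil x) (Int.add_zero p)) (by omega)))
        (smul (sgn k (p + 1))
          (comp (eps f (Chain.nil y) (Int.add_zero p)) (right a g) (by omega))))))
  -- the differential of `ε(f; g₁, …, g_N)`, `N ≥ 2`, where `c` stands for `g₂, …, g_{N-1}`
  | d_eps {a b : C.Obj} {x x₁ y₁ y : D.Obj} {p q₁ q q' i j m n : ℤ} (f : C.Hom a b p)
      (g₁ : D.Hom x x₁ q₁) (c : Chain D x₁ y₁ q) (g' : D.Hom y₁ y q')
      (hi : q₁ - 1 + q = i) (hj : q + (q' - 1) = j) (hm : q₁ - 1 + j = m) (h : p + m = n) :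
      Rel C D (eps (C.d f) (Chain.cons g₁ (c.snoc g' hj) hm) (by omega))
        (add (d (eps f (Chain.cons g₁ (c.snoc g' hj) hm) h))
        (add (Expr.sum ((Chain.cons g₁ (c.snoc g' hj) hm).dTerms.map fun t =>
          smul (sgn k (p + t.1)) (eps f t.2 (by omega))))
        (add (smul (sgn k (p * q' + p))
          (comp (right b g') (eps f (Chain.cons g₁ c hi) rfl) (by omega)))
        (add (smul (sgn k (p + j + 1))
          (comp (eps f (c.snoc g' hj) rfl) (right a g₁) (by omega)))
        (Expr.sum ((Chain.cons g₁ (c.snoc g' hj) hm).compTerms.map fun t =>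
          smul (sgn k (p + t.1)) (eps f t.2 (by omega))))))))

/-- Formal expressions up to the relations `Rel`. -/
instance setoid (C D : DGCat k) (x y : C.Obj × D.Obj) (n : ℤ) : Setoid (Expr C D x y n) where
  r := Rel C D
  iseqv := ⟨Rel.refl, Rel.symm, Rel.trans⟩

/-- The morphisms of degree `n` of the twisted tensor product. -/
def Mor (C D : DGCat k) (x y : C.Obj × D.Obj) (n : ℤ) : Type u := Quotient (setoid C D x y n)

/-- The morphism represented by an expression. -/
def Mor.mk {C D : DGCat k} {x y : C.Obj × D.Obj} {n : ℤ} (s : Expr C D x y n) : Mor C D x y n :=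
  Quotient.mk _ s

theorem Mor.ind {C D : DGCat k} {x y : C.Obj × D.Obj} {n : ℤ} {P : Mor C D x y n → Prop}
    (h : ∀ s, P (Mor.mk s)) (s : Mor C D x y n) : P s :=
  Quotient.ind h s

theorem Mor.sound {C D : DGCat k} {x y : C.Obj × D.Obj} {n : ℤ} {s t : Expr C D x y n}
    (h : Rel C D s t) : Mor.mk s = Mor.mk t :=
  Quotient.sound h

instance (C D : DGCat k) (x y : C.Obj × D.Obj) (n : ℤ) : Zero (Mor C D x y n) where
  zero := Mor.mk Expr.zero

instance (C D : DGCat k) (x y : C.Obj × D.Obj) (n : ℤ) : Add (Mor C D x y n) where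
  add := Quotient.map₂ Expr.add fun _ _ h _ _ h' => Rel.add_congr h h'

instance (C D : DGCat k) (x y : C.Obj × D.Obj) (n : ℤ) : Neg (Mor C D x y n) where
  neg := Quotient.map Expr.neg fun _ _ h => Rel.neg_congr h

instance (C D : DGCat k) (x y : C.Obj × D.Obj) (n : ℤ) : AddCommGroup (Mor C D x y n) where
  add_assoc := Mor.ind fun r => Mor.ind fun s => Mor.ind fun t =>
    Mor.sound (Rel.add_assoc r s t)
  add_comm := Mor.ind fun s => Mor.ind fun t => Mor.sound (Rel.add_comm s t)
  zero_add := Mor.ind fun s => Mor.sound (Rel.zero_add s)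
  add_zero := Mor.ind fun s => Mor.sound ((Rel.add_comm _ _).trans (Rel.zero_add s))
  neg_add_cancel := Mor.ind fun s => Mor.sound (Rel.neg_add s)
  nsmul := nsmulRec
  zsmul := zsmulRec

instance (C D : DGCat k) (x y : C.Obj × D.Obj) (n : ℤ) : SMul k (Mor C D x y n) where
  smul a := Quotient.map (Expr.smul a) fun _ _ h => Rel.smul_congr a h

instance (C D : DGCat k) (x y : C.Obj × D.Obj) (n : ℤ) : Module k (Mor C D x y n) :=
  Module.ofMinimalAxioms (fun a => Mor.ind fun s => Mor.ind fun t => Mor.sound (Rel.smul_add a s t))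
    (fun a b => Mor.ind fun s => Mor.sound (Rel.add_smul a b s))
    (fun a b => Mor.ind fun s => Mor.sound (Rel.mul_smul a b s))
    (Mor.ind fun s => Mor.sound (Rel.one_smul s))

end Twisted

/-- The twisted tensor product of two small dg categories: the dg category with objects
`Ob C × Ob D` generated by `id_c ⊗ D`, `C ⊗ id_d` and the morphisms `ε(f; g₁, …, g_N)`,
subject to the relations `Twisted.Rel`. The relations express the differential of every generator
through the generators, so the underlying graded category is generated by the generators alone,
and the differential is the one extended from them by the Leibniz rule. -/
def DGCat.twisted {k : Type u} [CommRing k] (C D : DGCat k) : DGCat k where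
  Obj := C.Obj × D.Obj
  Hom := Twisted.Mor C D
  id x := Twisted.Mor.mk (Twisted.Expr.id x)
  comp t s h := Quotient.map₂ (fun t s => Twisted.Expr.comp t s h)
    (fun _ _ h₁ _ _ h₂ => Twisted.Rel.comp_congr h h₁ h₂) t s
  d s := Quotient.map Twisted.Expr.d (fun _ _ h => Twisted.Rel.d_congr h) s
  add_comp t t' s h := by
    induction t using Twisted.Mor.ind; induction t' using Twisted.Mor.ind
    induction s using Twisted.Mor.ind
    exact Twisted.Mor.sound (Twisted.Rel.add_comp _ _ _ h)
  comp_add t s s' h := by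
    induction t using Twisted.Mor.ind; induction s' using Twisted.Mor.ind
    induction s using Twisted.Mor.ind
    exact Twisted.Mor.sound (Twisted.Rel.comp_add _ _ _ h)
  smul_comp a t s h := by
    induction t using Twisted.Mor.ind; induction s using Twisted.Mor.ind
    exact Twisted.Mor.sound (Twisted.Rel.smul_comp a _ _ h)
  comp_smul a t s h := by
    induction t using Twisted.Mor.ind; induction s using Twisted.Mor.ind
    exact Twisted.Mor.sound (Twisted.Rel.comp_smul a _ _ h)
  id_comp s h := by
    induction s using Twisted.Mor.ind
    exact Twisted.Mor.sound (Twisted.Rel.id_comp _ h)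
  comp_id s h := by
    induction s using Twisted.Mor.ind
    exact Twisted.Mor.sound (Twisted.Rel.comp_id _ h)
  assoc t s r h₁ h₂ h₃ h₄ := by
    induction t using Twisted.Mor.ind; induction s using Twisted.Mor.ind
    induction r using Twisted.Mor.ind
    exact Twisted.Mor.sound (Twisted.Rel.assoc _ _ _ h₁ h₂ h₃ h₄)
  d_add s t := by
    induction t using Twisted.Mor.ind; induction s using Twisted.Mor.ind
    exact Twisted.Mor.sound (Twisted.Rel.d_add _ _)
  d_smul a s := by
    induction s using Twisted.Mor.ind
    exact Twisted.Mor.sound (Twisted.Rel.d_smul a _)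
  d_d s := by
    induction s using Twisted.Mor.ind
    exact Twisted.Mor.sound (Twisted.Rel.d_d _)
  leibniz t s h := by
    induction t using Twisted.Mor.ind; induction s using Twisted.Mor.ind
    exact Twisted.Mor.sound (Twisted.Rel.leibniz _ _ h)

namespace Twisted

variable {k : Type u} [CommRing k]

/-- The object `(c, d)` of the twisted tensor product. -/
abbrev pt {C D : DGCat k} (c : C.Obj) (d : D.Obj) : (C.twisted D).Obj := (c, d)

/-- The morphism `id_c ⊗ g` of the twisted tensor product. -/
def right {C D : DGCat k} (c : C.Obj) {x y : D.Obj} {n : ℤ} (g : D.Hom x y n) :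
    (C.twisted D).Hom (pt c x) (pt c y) n :=
  Mor.mk (Expr.right c g)

/-- The morphism `ε(f; g₁, …, g_N)` of the twisted tensor product; for the empty chain at an object
`d` this is `f ⊗ id_d`. -/
def eps {C D : DGCat k} {a b : C.Obj} {x y : D.Obj} {p q n : ℤ} (f : C.Hom a b p)
    (c : Chain D x y q) (h : p + q = n) : (C.twisted D).Hom (pt a x) (pt b y) n :=
  Mor.mk (Expr.eps f c h)

/-! ### Functoriality -/

section Functoriality

variable {C D C' D' : DGCat k} {φ : C.Obj → C'.Obj} {ψ : D.Obj → D'.Obj}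
  (F : DGFunctorOver C C' φ) (G : DGFunctorOver D D' ψ)

/-- The expression obtained by applying `F` and `G` to the generators: `id_c ⊗ g` goes to
`id_{F c} ⊗ G g` and `ε(f; g₁, …, g_N)` goes to `ε(F f; G g₁, …, G g_N)`. -/
def Expr.map {x y : C.Obj × D.Obj} {n : ℤ} :
    Expr C D x y n → Expr C' D' (φ x.1, ψ x.2) (φ y.1, ψ y.2) n
  | .right c g => .right (φ c) (G.map g)
  | .eps f c h => .eps (F.map f) (c.map G) h
  | .id x => .id (φ x.1, ψ x.2)
  | .comp t s h => .comp (t.map) (s.map) h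
  | .d s => .d s.map
  | .zero => .zero
  | .add s t => .add s.map t.map
  | .neg s => .neg s.map
  | .smul a s => .smul a s.map

theorem Expr.map_sum {x y : C.Obj × D.Obj} {n : ℤ} (l : List (Expr C D x y n)) :
    (Expr.sum l).map F G = Expr.sum (l.map (Expr.map F G)) := by
  induction l with
  | nil => rfl
  | cons s l ih =>
    simp only [Expr.sum, List.foldr_cons, List.map_cons, Expr.map] at ih ⊢
    rw [ih]

theorem Rel.map {x y : C.Obj × D.Obj} {n : ℤ} {s t : Expr C D x y n} (H : Rel C D s t) :
    Rel C' D' (s.map F G) (t.map F G) := by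
  induction H with
  | refl s => exact .refl _
  | symm _ ih => exact .symm ih
  | trans _ _ ih₁ ih₂ => exact .trans ih₁ ih₂
  | comp_congr h _ _ ih₁ ih₂ => exact .comp_congr h ih₁ ih₂
  | d_congr _ ih => exact .d_congr ih
  | add_congr _ _ ih₁ ih₂ => exact .add_congr ih₁ ih₂
  | neg_congr _ ih => exact .neg_congr ih
  | smul_congr a _ ih => exact .smul_congr a ih
  | add_assoc r s t => exact .add_assoc _ _ _
  | add_comm s t => exact .add_comm _ _
  | zero_add s => exact .zero_add _
  | neg_add s => exact .neg_add _
  | smul_add a s t => exact .smul_add _ _ _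
  | add_smul a b s => exact .add_smul _ _ _
  | mul_smul a b s => exact .mul_smul _ _ _
  | one_smul s => exact .one_smul _
  | add_comp t t' s h => exact .add_comp _ _ _ h
  | comp_add t s s' h => exact .comp_add _ _ _ h
  | smul_comp a t s h => exact .smul_comp _ _ _ h
  | comp_smul a t s h => exact .comp_smul _ _ _ h
  | id_comp s h => exact .id_comp _ h
  | comp_id s h => exact .comp_id _ h
  | assoc t s v h₁ h₂ h₃ h₄ => exact .assoc _ _ _ h₁ h₂ h₃ h₄
  | d_add s t => exact .d_add _ _
  | d_smul a s => exact .d_smul _ _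
  | d_d s => exact .d_d _
  | leibniz t s h => exact .leibniz _ _ h
  | right_add c g g' => simp only [Expr.map, G.map_add]; exact .right_add _ _ _
  | right_smul c a g => simp only [Expr.map, G.map_smul]; exact .right_smul _ _ _
  | right_id c x => simp only [Expr.map, G.map_id]; exact .right_id _ _
  | right_comp c g₂ g₁ h => simp only [Expr.map, G.map_comp]; exact .right_comp _ _ _ h
  | right_d c g => simp only [Expr.map, G.map_d]; exact .right_d _ _
  | eps_add f f' c h => simp only [Expr.map, F.map_add]; exact .eps_add _ _ _ h
  | eps_smul r f c h => simp only [Expr.map, F.map_smul]; exact .eps_smul _ _ _ h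
  | eps_chain_add f h H => exact .eps_chain_add _ h (H.map G)
  | eps_chain_smul r f h H => exact .eps_chain_smul r _ h (H.map G)
  | eps_id_nil a x =>
    simp only [Expr.map, F.map_id, Chain.map]; exact .eps_id_nil _ _
  | eps_id_cons a g c hc h =>
    simp only [Expr.map, F.map_id, Chain.map]; exact .eps_id_cons _ _ _ hc h
  | eps_hasId f h H => exact .eps_hasId _ h (H.map G)
  | eps_comp f₂ f₁ hp c h =>
    have key := Rel.eps_comp (C := C') (D := D') (F.map f₂) (F.map f₁) hp (c.map G) h
    rw [Chain.splits_map, List.map_map] at key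
    simp only [Expr.map, F.map_comp, Expr.map_sum, List.map_map]
    exact key
  | d_eps_nil x f h => simp only [Expr.map, F.map_d, Chain.map]; exact .d_eps_nil _ _ h
  | d_eps_single f g h =>
    have key := Rel.d_eps_single (C := C') (D := D') (F.map f) (G.map g) h
    simp only [Expr.map, F.map_d, Chain.map, Chain.single, G.map_d] at key ⊢
    exact key
  | d_eps f g₁ c g' hi hj hm h =>
    have key := Rel.d_eps (C := C') (D := D') (F.map f) (G.map g₁) (c.map G) (G.map g')
      hi hj hm h
    have e : Chain.cons (G.map g₁) ((c.map G).snoc (G.map g') hj) hm =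
        (Chain.cons g₁ (c.snoc g' hj) hm).map G := by
      simp only [Chain.map, Chain.snoc_map]
    simp only [e, Chain.dTerms_map, Chain.compTerms_map, List.map_map] at key
    simp only [Expr.map, F.map_d, Expr.map_sum, List.map_map, Chain.snoc_map]
    simp only [Chain.map, Chain.snoc_map] at key ⊢
    exact key

/-- The dg functor `F ⊗ G` between twisted tensor products. -/
def mapOver : DGFunctorOver (C.twisted D) (C'.twisted D') (fun x => (φ x.1, ψ x.2)) where
  map s := Quotient.map (Expr.map F G) (fun _ _ h => Rel.map F G h) s
  map_add s t := by
    induction t using Mor.ind; induction s using Mor.ind; rfl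
  map_smul a s := by
    induction s using Mor.ind; rfl
  map_id _ := rfl
  map_comp t s h := by
    induction t using Mor.ind; induction s using Mor.ind; rfl
  map_d s := by
    induction s using Mor.ind; rfl

end Functoriality

theorem Expr.map_id {C D : DGCat k} {x y : C.Obj × D.Obj} {n : ℤ} (s : Expr C D x y n) :
    s.map (𝟙 C : DGFunctor C C).toOver (𝟙 D : DGFunctor D D).toOver = s := by
  induction s with
  | right c g => rfl
  | eps f c h => exact congrArg (fun c => Expr.eps f c h) c.map_id
  | id x => rfl
  | comp t s h iht ihs => exact congrArg₂ (fun t s => Expr.comp t s h) iht ihs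
  | d s ih => exact congrArg Expr.d ih
  | zero => rfl
  | add s t ihs iht => exact congrArg₂ Expr.add ihs iht
  | neg s ih => exact congrArg Expr.neg ih
  | smul a s ih => exact congrArg (Expr.smul a) ih

theorem Expr.map_comp {C D C' D' C'' D'' : DGCat k} (F : C ⟶ C') (F' : C' ⟶ C'') (G : D ⟶ D')
    (G' : D' ⟶ D'') {x y : C.Obj × D.Obj} {n : ℤ} (s : Expr C D x y n) :
    s.map (F ≫ F' : DGFunctor C C'').toOver (G ≫ G' : DGFunctor D D'').toOver =
      (s.map F.toOver G.toOver).map F'.toOver G'.toOver := by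
  induction s with
  | right c g => rfl
  | eps f c h =>
    exact congrArg (fun c => Expr.eps (F'.toOver.map (F.toOver.map f)) c h) (c.map_comp G G')
  | id x => rfl
  | comp t s h iht ihs => exact congrArg₂ (fun t s => Expr.comp t s h) iht ihs
  | d s ih => exact congrArg Expr.d ih
  | zero => rfl
  | add s t ihs iht => exact congrArg₂ Expr.add ihs iht
  | neg s ih => exact congrArg Expr.neg ih
  | smul a s ih => exact congrArg (Expr.smul a) ih

end Twisted

open Twisted in
/-- The twisted tensor product as a functor of two variables. -/
def DGCat.twistedFunctor (k : Type u) [CommRing k] : DGCat k × DGCat k ⥤ DGCat k where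
  obj X := X.1.twisted X.2
  map T := (mapOver T.1.toOver T.2.toOver).toHom
  map_id X := congrArg (DGFunctor.mk _) <| DGFunctorOver.ext fun s => by
    induction s using Mor.ind with
    | h s => exact congrArg Mor.mk s.map_id
  map_comp T T' := congrArg (DGFunctor.mk _) <| DGFunctorOver.ext fun s => by
    induction s using Mor.ind with
    | h s => exact congrArg Mor.mk (s.map_comp T.1 T'.1 T.2 T'.2)

/-! ## The associativity map on generators -/

namespace Twisted

variable {k : Type u} [CommRing k]

/-- The chain `id_d ⊗ h₁, …, id_d ⊗ h_N` in the twisted tensor product of `D` and `E`, followed by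
the chain `w`. -/
def prependRight {D E : DGCat k} (d : D.Obj) {e e' : E.Obj} {z : (D.twisted E).Obj} {m n N : ℤ} :
    Chain E e e' m → Chain (D.twisted E) (pt d e') z n → m + n = N →
      Chain (D.twisted E) (pt d e) z N
  | .nil _, w, h => (show n = N by omega) ▸ w
  | .cons g c hc, w, h => .cons (right d g) (prependRight d c w rfl) (by omega)

/-- The list of all chains
`h₁, …, h_{i₁}, ε(g₁; h_{i₁+1}, …, h_{j₁}), h_{j₁+1}, …, h_{i₂}, ε(g₂; h_{i₂+1}, …, h_{j₂}), …, h_N`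
in the twisted tensor product of `D` and `E`, for `0 ≤ i₁ ≤ j₁ ≤ i₂ ≤ j₂ ≤ ⋯ ≤ j_K ≤ N`, each
preceded by its sign `(-1) ^ ∑_ℓ (|g_ℓ| - 1) ∑_{s > j_ℓ} (|h_s| - 1)`. Here `h_s` stands for
`id ⊗ h_s`, and `ε(g_ℓ; )` for `g_ℓ ⊗ id`. -/
def insertions {D E : DGCat k} {x y : D.Obj} {e e' : E.Obj} {m n N : ℤ} :
    Chain D x y m → Chain E e e' n → m + n = N → List (k × Chain (D.twisted E) (pt x e) (pt y e') N)
  | .nil x, hs, h => [(1, prependRight x hs (.nil (pt x e')) (show n + 0 = N by omega))]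
  | .cons (x := x) (p := p) g gs hg, hs, h =>
      hs.splits.flatMap fun s => s.snd.splits.flatMap fun t =>
        (insertions gs t.snd rfl).map fun w =>
          (sgn k ((p - 1) * t.q) * w.1,
            prependRight x s.fst (.cons (eps g t.fst rfl) w.2 rfl)
              (by have := s.h; have := t.h; omega))

/-- The formulas that determine the associativity dg functor on the generators of the iterated
twisted tensor product. Empty chains are allowed: `ε(f; )` is `f ⊗ id`. -/
structure IsAssociator {C D E : DGCat k}
    (α : DGFunctorOver ((C.twisted D).twisted E) (C.twisted (D.twisted E))
      (fun x => pt x.1.1 (pt x.1.2 x.2))) : Prop where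
  map_right : ∀ (c : C.Obj) (d : D.Obj) {e e' : E.Obj} {n : ℤ} (h : E.Hom e e' n),
    α.map (right (pt c d) h) = right c (right d h)
  map_eps_right : ∀ (c : C.Obj) {x y : D.Obj} {e e' : E.Obj} {p q n : ℤ} (g : D.Hom x y p)
    (hs : Chain E e e' q) (h : p + q = n),
    α.map (eps (right c g) hs h) = right c (eps g hs h)
  map_eps_eps : ∀ {a b : C.Obj} {x y : D.Obj} {e e' : E.Obj} {p q r i n : ℤ} (f : C.Hom a b p)
    (gs : Chain D x y q) (hs : Chain E e e' r) (hi : p + q = i) (h : i + r = n),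
    α.map (eps (eps f gs hi) hs h) =
      ((insertions gs hs rfl).map fun w =>
        w.1 • eps f w.2 (show p + (q + r) = n by omega)).sum

end Twisted

/-! ## Skew monoidal categories -/

/-- A skew monoidal structure on a category, with skew tensor product `T` and skew unit `I`. -/
structure SkewMonoidal {𝒞 : Type*} [Category 𝒞] (T : 𝒞 × 𝒞 ⥤ 𝒞) (I : 𝒞) where
  α : ∀ X Y Z : 𝒞, T.obj (T.obj (X, Y), Z) ⟶ T.obj (X, T.obj (Y, Z))
  lam : ∀ X : 𝒞, T.obj (I, X) ⟶ X
  rho : ∀ X : 𝒞, X ⟶ T.obj (X, I)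
  α_naturality : ∀ {X X' Y Y' Z Z' : 𝒞} (f : X ⟶ X') (g : Y ⟶ Y') (h : Z ⟶ Z'),
    T.map (Prod.mkHom (T.map (Prod.mkHom f g)) h) ≫ α X' Y' Z' =
      α X Y Z ≫ T.map (Prod.mkHom f (T.map (Prod.mkHom g h)))
  lam_naturality : ∀ {X X' : 𝒞} (f : X ⟶ X'), T.map (Prod.mkHom (𝟙 I) f) ≫ lam X' = lam X ≫ f
  rho_naturality : ∀ {X X' : 𝒞} (f : X ⟶ X'), f ≫ rho X' = rho X ≫ T.map (Prod.mkHom f (𝟙 I))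
  pentagon : ∀ W X Y Z : 𝒞,
    α (T.obj (W, X)) Y Z ≫ α W X (T.obj (Y, Z)) =
      T.map (Prod.mkHom (α W X Y) (𝟙 Z)) ≫ α W (T.obj (X, Y)) Z ≫
        T.map (Prod.mkHom (𝟙 W) (α X Y Z))
  unit_left : ∀ X Y : 𝒞,
    α I X Y ≫ lam (T.obj (X, Y)) = T.map (Prod.mkHom (lam X) (𝟙 Y))
  unit_middle : ∀ X Y : 𝒞,
    T.map (Prod.mkHom (rho X) (𝟙 Y)) ≫ α X I Y ≫ T.map (Prod.mkHom (𝟙 X) (lam Y)) =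
      𝟙 (T.obj (X, Y))
  unit_right : ∀ X Y : 𝒞,
    rho (T.obj (X, Y)) ≫ α X Y I = T.map (Prod.mkHom (𝟙 X) (rho Y))
  unit_unit : rho I ≫ lam I = 𝟙 I

/-- A skew monoidal category is perfect if all `α_{X,I,Y}`, `λ_X` and `ρ_X` are isomorphisms. -/
structure SkewMonoidal.IsPerfect {𝒞 : Type*} [Category 𝒞] {T : 𝒞 × 𝒞 ⥤ 𝒞} {I : 𝒞}
    (S : SkewMonoidal T I) : Prop where
  isIso_α : ∀ X Y : 𝒞, IsIso (S.α X I Y)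
  isIso_lam : ∀ X : 𝒞, IsIso (S.lam X)
  isIso_rho : ∀ X : 𝒞, IsIso (S.rho X)

/-! The proof is organized around the dg category Coh(D, A) (`DGCat.coh`): its objects are the dg
functors D → A, its morphisms are the normalized Hochschild cochains, and its composition is the cup
product. The relations of the twisted tensor product say exactly that f ↦ ε(f; -) is a dg functor C
→ Coh(D, C ⊗ D) over c ↦ id_c ⊗ - (`etaOver`): vanishing on identities is normalization, the formula
for ε(f₂f₁; …) is the cup product, and the formula for ε(df; …) is the Hochschild differential.
Conversely, a dg functor C → Coh(D, A) gives values to all generators and respects all relations, so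
it defines a dg functor C ⊗ D → A (`uncurry`). The complexes of morphisms of C ⊗ D never have to be
computed: maps out of C ⊗ D come from `uncurry`, and equalities of such maps are checked on
generators.

Coh(D, A) is built in two steps. The chains of D form a bar coalgebra: cutting is coassociative
(`wsum_cuts_assoc`), and the bar differential is a coderivation of square zero (`wsum_bar_cuts`,
`wsum_bar_bar`). Multilinear cochains therefore form a convolution dg category (`DGCat.raw`). A dg
functor, seen as a cochain supported on chains of length one, is a Maurer–Cartan element
(`RawCochain.maurerCartan`), and twisting by these elements gives the Hochschild differential. It
preserves normalized cochains because an identity in a chain can be absorbed by either neighbour,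
with opposite signs.

The associator is the double transpose of a comparison dg functor θ from Coh(D ⊗ E, A) to Coh(D,
Coh(E, A)) (`theta`): the value of θ(φ) on a chain of D and a chain of E is the sum of the values of
φ on all insertions of the first chain into the second. That θ is a dg functor rests on three facts:
insertions are compatible with cuts (`ins_cuts`) and with the bar differentials (`ins_bar`), and the
Maurer–Cartan element of a dg functor on D ⊗ E restricts along insertions to the sum of its two
partial Maurer–Cartan elements (`ins_ofFunctor`). In `ins_bar`, products of an entry ε(g; …) with
adjacent entries id ⊗ h cancel against the outer terms of dε(g; …), and products of adjacent entries
ε(g₁; …), ε(g₂; …) add up to the entries ε(g₂g₁; …).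

For the coherence axioms, two dg functors out of an iterated product agree if they agree on iterated
generators (`hom_ext₃`, `hom_ext₄`). On ε(ε(ε(f; …); …); …) the pentagon becomes the associativity
of insertions (`ins_ins`). The unit axioms hold because there is only one way to insert an empty
chain into a chain, or a chain into an empty one.

For perfectness, morphisms of k are multiples of identities, so normalized cochains on k live on
empty chains. Hence C maps to Coh(k, C), and the transpose of this map is inverse to ρ; the inverse
of λ is id ⊗ -. The invertibility of α_{X,I,Y} is then formal, by the middle unit axiom. -/

/-! ## Signs and weighted sums -/

section Sgn

variable {k : Type u} [CommRing k]

theorem sgn_add (m n : ℤ) : sgn k (m + n) = sgn k m * sgn k n := by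
  simp [sgn, Int.negOnePow_add]

@[simp] theorem sgn_zero : sgn k 0 = 1 := by simp [sgn]

@[simp] theorem sgn_one : sgn k 1 = -1 := by simp [sgn]

theorem sgn_of_even {n : ℤ} (h : Even n) : sgn k n = 1 := by
  simp [sgn, Int.negOnePow_even n h]

theorem sgn_congr {m n : ℤ} (h : Even (m - n)) : sgn k m = sgn k n := by
  rw [← sub_add_cancel m n, sgn_add, sgn_of_even h, one_mul]

theorem sgn_mul_self (n : ℤ) : sgn k n * sgn k n = 1 := by
  rw [← sgn_add, sgn_of_even ⟨n, rfl⟩]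

theorem sgn_add_one (n : ℤ) : sgn k (n + 1) = -sgn k n := by
  rw [sgn_add, sgn_one, mul_neg_one]

theorem sgn_sub_one (n : ℤ) : sgn k (n - 1) = -sgn k n := by
  rw [← sgn_add_one]; exact sgn_congr ⟨-1, by ring⟩

end Sgn

section WSum

variable {k : Type u} [CommRing k] {ι κ : Type*} {M N : Type*} [AddCommGroup M] [Module k M]
  [AddCommGroup N] [Module k N]

/-- The sum of the values of `F`, with weights, over a list of weighted indices. -/
def wsum (l : List (k × ι)) (F : ι → M) : M := (l.map fun w => w.1 • F w.2).sum

@[simp] theorem wsum_nil (F : ι → M) : wsum ([] : List (k × ι)) F = 0 := rfl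

@[simp] theorem wsum_cons (w : k × ι) (l : List (k × ι)) (F : ι → M) :
    wsum (w :: l) F = w.1 • F w.2 + wsum l F := by simp [wsum]

theorem wsum_append (l l' : List (k × ι)) (F : ι → M) :
    wsum (l ++ l') F = wsum l F + wsum l' F := by simp [wsum]

theorem wsum_map (f : κ → ι) (l : List (k × κ)) (F : ι → M) :
    wsum (l.map fun w => (w.1, f w.2)) F = wsum l fun i => F (f i) := by
  simp only [wsum, List.map_map]; rfl

theorem wsum_add (l : List (k × ι)) (F G : ι → M) :
    wsum l (fun i => F i + G i) = wsum l F + wsum l G := by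
  induction l with
  | nil => simp
  | cons w l ih => simp only [wsum_cons, ih, smul_add]; abel

@[simp] theorem wsum_zero (l : List (k × ι)) : wsum l (fun _ => (0 : M)) = 0 := by
  induction l with
  | nil => simp
  | cons w l ih => simp [ih]

theorem wsum_smul (l : List (k × ι)) (a : k) (F : ι → M) :
    wsum l (fun i => a • F i) = a • wsum l F := by
  induction l with
  | nil => simp
  | cons w l ih => simp only [wsum_cons, ih, smul_add, smul_comm a]

theorem wsum_neg (l : List (k × ι)) (F : ι → M) : wsum l (fun i => -F i) = -wsum l F := by
  simpa using wsum_smul l (-1 : k) F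

theorem wsum_sub (l : List (k × ι)) (F G : ι → M) :
    wsum l (fun i => F i - G i) = wsum l F - wsum l G := by
  simp only [sub_eq_add_neg, wsum_add, wsum_neg]

theorem map_wsum (L : M →ₗ[k] N) (l : List (k × ι)) (F : ι → M) :
    L (wsum l F) = wsum l fun i => L (F i) := by
  induction l with
  | nil => simp
  | cons w l ih => simp [ih]

theorem wsum_comm (l : List (k × ι)) (l' : List (k × κ)) (F : ι → κ → M) :
    wsum l (fun i => wsum l' fun j => F i j) = wsum l' fun j => wsum l fun i => F i j := by
  induction l with
  | nil => simp
  | cons w l ih => simp only [wsum_cons, ih, wsum_add, wsum_smul]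

theorem wsum_congr (l : List (k × ι)) {F G : ι → M} (h : ∀ i, F i = G i) : wsum l F = wsum l G :=
  congrArg _ (funext h)

theorem wsum_eq_zero (l : List (k × ι)) {F : ι → M} (h : ∀ i, F i = 0) : wsum l F = 0 := by
  rw [wsum_congr l h, wsum_zero]

theorem wsum_unweighted (l : List ι) (F : ι → M) :
    wsum (l.map fun i => ((1 : k), i)) F = (l.map F).sum := by
  induction l with
  | nil => rfl
  | cons i l ih => simp [ih]

end WSum

/-! ## Elementary consequences of the axioms of a dg category -/

namespace DGCat

variable {k : Type u} [CommRing k] (A : DGCat k)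

/-- The composition with a fixed morphism on the left. -/
def compLeft {x y z : A.Obj} {p q n : ℤ} (g : A.Hom y z q) (h : q + p = n) :
    A.Hom x y p →ₗ[k] A.Hom x z n where
  toFun f := A.comp g f h
  map_add' f f' := A.comp_add g f f' h
  map_smul' a f := A.comp_smul a g f h

/-- The composition with a fixed morphism on the right. -/
def compRight {x y z : A.Obj} {p q n : ℤ} (f : A.Hom x y p) (h : q + p = n) :
    A.Hom y z q →ₗ[k] A.Hom x z n where
  toFun g := A.comp g f h
  map_add' g g' := A.add_comp g g' f h
  map_smul' a g := A.smul_comp a g f h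

/-- The differential, as a linear map. -/
def dLin (x y : A.Obj) (n : ℤ) : A.Hom x y n →ₗ[k] A.Hom x y (n + 1) where
  toFun := A.d
  map_add' := A.d_add
  map_smul' := A.d_smul

variable {A}

@[simp] theorem comp_zero {x y z : A.Obj} {p q n : ℤ} (g : A.Hom y z q) (h : q + p = n) :
    A.comp g (0 : A.Hom x y p) h = 0 := map_zero (A.compLeft g h)

@[simp] theorem zero_comp {x y z : A.Obj} {p q n : ℤ} (f : A.Hom x y p) (h : q + p = n) :
    A.comp (0 : A.Hom y z q) f h = 0 := map_zero (A.compRight f h)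

theorem comp_neg {x y z : A.Obj} {p q n : ℤ} (g : A.Hom y z q) (f : A.Hom x y p) (h : q + p = n) :
    A.comp g (-f) h = -A.comp g f h := map_neg (A.compLeft g h) f

theorem neg_comp {x y z : A.Obj} {p q n : ℤ} (g : A.Hom y z q) (f : A.Hom x y p) (h : q + p = n) :
    A.comp (-g) f h = -A.comp g f h := map_neg (A.compRight f h) g

theorem comp_sub {x y z : A.Obj} {p q n : ℤ} (g : A.Hom y z q) (f f' : A.Hom x y p)
    (h : q + p = n) : A.comp g (f - f') h = A.comp g f h - A.comp g f' h :=
  map_sub (A.compLeft g h) f f'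

theorem sub_comp {x y z : A.Obj} {p q n : ℤ} (g g' : A.Hom y z q) (f : A.Hom x y p)
    (h : q + p = n) : A.comp (g - g') f h = A.comp g f h - A.comp g' f h :=
  map_sub (A.compRight f h) g g'

theorem comp_wsum {ι : Type*} {x y z : A.Obj} {p q n : ℤ} (g : A.Hom y z q) (l : List (k × ι))
    (F : ι → A.Hom x y p) (h : q + p = n) :
    A.comp g (wsum l F) h = wsum l fun i => A.comp g (F i) h := map_wsum (A.compLeft g h) l F

theorem wsum_comp {ι : Type*} {x y z : A.Obj} {p q n : ℤ} (l : List (k × ι))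
    (F : ι → A.Hom y z q) (f : A.Hom x y p) (h : q + p = n) :
    A.comp (wsum l F) f h = wsum l fun i => A.comp (F i) f h := map_wsum (A.compRight f h) l F

@[simp] theorem d_zero {x y : A.Obj} {n : ℤ} : A.d (0 : A.Hom x y n) = 0 :=
  map_zero (A.dLin x y n)

theorem d_sub {x y : A.Obj} {n : ℤ} (f f' : A.Hom x y n) : A.d (f - f') = A.d f - A.d f' :=
  map_sub (A.dLin x y n) f f'

theorem d_wsum {ι : Type*} {x y : A.Obj} {n : ℤ} (l : List (k × ι)) (F : ι → A.Hom x y n) :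
    A.d (wsum l F) = wsum l fun i => A.d (F i) := map_wsum (A.dLin x y n) l F

-- The Leibniz rule for id ∘ id reads d id = d id + d id.
@[simp] theorem d_id (x : A.Obj) : A.d (A.id x) = 0 := by
  have h := A.leibniz (A.id x) (A.id x) (Int.add_zero 0)
  rw [A.id_comp, A.id_comp, A.comp_id, sgn_zero, one_smul] at h
  simpa using h

/-- A morphism of degree `m` as a morphism of degree `n = m`. -/
def reindex {x y : A.Obj} {m n : ℤ} (h : m = n) (f : A.Hom x y m) : A.Hom x y n := h ▸ f

end DGCat

namespace DGFunctorOver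

variable {k : Type u} [CommRing k] {A B : DGCat k} {φ : A.Obj → B.Obj} (F : DGFunctorOver A B φ)

/-- The action of a dg functor on morphisms, as a linear map. -/
def mapLin (x y : A.Obj) (n : ℤ) : A.Hom x y n →ₗ[k] B.Hom (φ x) (φ y) n where
  toFun := F.map
  map_add' := F.map_add
  map_smul' := F.map_smul

theorem mapLin_apply {x y : A.Obj} {n : ℤ} (f : A.Hom x y n) : F.mapLin x y n f = F.map f := rfl

@[simp] theorem map_zero {x y : A.Obj} {n : ℤ} : F.map (0 : A.Hom x y n) = 0 :=
  _root_.map_zero (F.mapLin x y n)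

theorem map_wsum {ι : Type*} {x y : A.Obj} {n : ℤ} (l : List (k × ι)) (f : ι → A.Hom x y n) :
    F.map (wsum l f) = wsum l fun i => F.map (f i) := _root_.map_wsum (F.mapLin x y n) l f

end DGFunctorOver

/-! ## Cutting chains, and the bar differential -/

namespace Chain

variable {k : Type u} [CommRing k] {D : DGCat k} {M : Type*} [AddCommGroup M] [Module k M]

/-- The cuts of a chain, as a weighted list with all weights equal to `1`. -/
def cuts {x y : D.Obj} {n : ℤ} (c : Chain D x y n) : List (k × Split D x y n) :=
  c.splits.map fun s => (1, s)

@[simp] theorem wsum_cuts_nil (x : D.Obj) (F : Split D x x 0 → M) :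
    wsum (nil x).cuts F = F ⟨x, 0, 0, nil x, nil x, rfl⟩ := by
  simp [cuts, splits]

@[simp] theorem wsum_cuts_cons {x y z : D.Obj} {p q n : ℤ} (g : D.Hom x y p) (c : Chain D y z q)
    (h : p - 1 + q = n) (F : Split D x z n → M) :
    wsum (cons g c h).cuts F = F ⟨x, 0, n, nil x, cons g c h, by omega⟩ +
      wsum c.cuts fun s => F ⟨s.mid, _, s.q, cons g s.fst rfl, s.snd, by have := s.h; omega⟩ := by
  simp [cuts, splits, wsum, List.map_map, Function.comp_def]

/-- Coassociativity of deconcatenation: both sides run over the ways to cut the chain into three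
pieces. `F` takes the degrees and the equation between them as arguments, so that the two sides can
be compared without transport. -/
theorem wsum_cuts_assoc {x y : D.Obj} {n : ℤ} (c : Chain D x y n)
    (F : ∀ {z w : D.Obj} {p q r : ℤ}, Chain D x z p → Chain D z w q → Chain D w y r →
      p + q + r = n → M) :
    wsum c.cuts (fun s => wsum s.fst.cuts fun t =>
        F t.fst t.snd s.snd (by have := s.h; have := t.h; omega)) =
      wsum c.cuts fun s => wsum s.snd.cuts fun t =>
        F s.fst t.fst t.snd (by have := s.h; have := t.h; omega) := by
  induction c with
  | nil x => simp
  | cons g c h ih =>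
    simp only [wsum_cuts_cons, wsum_cuts_nil, wsum_add, add_assoc]
    congr 2
    exact ih fun a b c' h' => F (cons g a rfl) b c' (by omega)

/-- This and its mirror image `wsum_cuts_of_snd` give the counit laws, and they evaluate the sums in
which one factor is supported on very short chains. -/
theorem wsum_cuts_of_fst {x y : D.Obj} {n : ℤ} (c : Chain D x y n) (F : Split D x y n → M)
    (hF : ∀ {w z : D.Obj} {p q r m : ℤ} (g : D.Hom x w p) (a : Chain D w z q) (b : Chain D z y r)
      (h : p - 1 + q = m) (h' : m + r = n), F ⟨z, m, r, cons g a h, b, h'⟩ = 0) :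
    wsum c.cuts F = F ⟨x, 0, n, nil x, c, by omega⟩ := by
  cases c with
  | nil x => simp
  | cons g c h =>
    rw [wsum_cuts_cons, wsum_eq_zero, add_zero]
    exact fun s => hF g s.fst s.snd rfl _

theorem wsum_cuts_of_snd {x y : D.Obj} {n : ℤ} (c : Chain D x y n) (F : Split D x y n → M)
    (hF : ∀ {w z : D.Obj} {p q r m : ℤ} (g : D.Hom z w p) (a : Chain D x z r) (b : Chain D w y q)
      (h : p - 1 + q = m) (h' : r + m = n), F ⟨z, r, m, a, cons g b h, h'⟩ = 0) :
    wsum c.cuts F = F ⟨y, n, 0, c, nil y, by omega⟩ := by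
  induction c with
  | nil x => simp
  | cons g c h ih =>
    subst h
    rw [wsum_cuts_cons, hF, zero_add, ih]
    exact fun g' a b h h' => hF g' (cons g a rfl) b h (by omega)

theorem Split.sgn_eq {x y : D.Obj} {n : ℤ} (s : Split D x y n) :
    sgn k n = sgn k s.q * sgn k s.p := by
  rw [← sgn_add, add_comm, s.h]

theorem cons_heq {x y z : D.Obj} {p q n n' : ℤ} (g : D.Hom x y p) (c : Chain D y z q)
    (h : p - 1 + q = n) (h' : p - 1 + q = n') : cons g c h ≍ cons g c h' := by
  subst h h'; rfl

/-- Degrees such as `p - 1 + (q + 1)` and `p - 1 + q + 1` index different types of chains. Together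
with `cons_heq`, this absorbs the discrepancy. -/
theorem Split.mk_congr {x y z : D.Obj} {n p q p' q' : ℤ} {a : Chain D x z p} {b : Chain D z y q}
    {a' : Chain D x z p'} {b' : Chain D z y q'} (h : p + q = n) (h' : p' + q' = n) (hp : p = p')
    (ha : a ≍ a') (hb : b ≍ b') :
    (⟨z, p, q, a, b, h⟩ : Split D x y n) = ⟨z, p', q', a', b', h'⟩ := by
  obtain rfl := hp
  obtain rfl : q = q' := by omega
  cases ha; cases hb; rfl

/-- `splits` recurses from the first entry. The outer term of the Hochschild differential that
involves the last entry needs the recursion from the other end. -/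
theorem wsum_cuts_snoc {x y z : D.Obj} {m q n : ℤ} (c : Chain D x y m) (g : D.Hom y z q)
    (h : m + (q - 1) = n) (F : Split D x z n → M) :
    wsum (c.snoc g h).cuts F =
      wsum c.cuts (fun s => F ⟨s.mid, s.p, _, s.fst, s.snd.snoc g rfl, by have := s.h; omega⟩) +
        F ⟨z, n, 0, c.snoc g h, nil z, by omega⟩ := by
  induction c generalizing n with
  | nil x =>
    simp only [snoc, wsum_cuts_cons, wsum_cuts_nil]
    exact congrArg₂ _ (congrArg F (Split.mk_congr _ _ rfl .rfl (cons_heq ..)))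
      (congrArg F (Split.mk_congr _ _ (by omega) (cons_heq ..) .rfl))
  | cons g' c h' ih =>
    simp only [snoc, wsum_cuts_cons]
    rw [ih g rfl]
    simp only [add_assoc]
    exact congrArg₂ _ (congrArg F (Split.mk_congr _ _ rfl .rfl (cons_heq ..))) (congrArg₂ _ rfl
      (congrArg F (Split.mk_congr _ _ (by omega) (cons_heq ..) .rfl)))

/-- The value of `F` on the chain obtained from `g, c` by composing `g` with the first morphism
of `c`. -/
def mulHead {x y z : D.Obj} {p q n : ℤ} (g : D.Hom x y p) (c : Chain D y z q) (h : p - 1 + q = n)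
    (F : Chain D x z (n + 1) → M) : M :=
  match c with
  | nil _ => 0
  | cons g' c _ => F (cons (D.comp g' g rfl) c (by omega))

/-- The weighted list of the terms of the bar differential of a chain. -/
def bar {x y : D.Obj} {n : ℤ} : Chain D x y n → List (k × Chain D x y (n + 1))
  | nil _ => []
  | cons (q := q) g c h => (sgn k q, cons (D.d g) c (by omega)) ::
      ((match c with
        | nil _ => []
        | cons g' c' _ => [(sgn k q, cons (D.comp g' g rfl) c' (by omega))]) ++
      (bar c).map fun w => (w.1, cons g w.2 (by omega)))

@[simp] theorem wsum_bar_nil (x : D.Obj) (F : Chain D x x (0 + 1) → M) :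
    wsum (nil x).bar F = 0 := rfl

theorem wsum_bar_cons {x y z : D.Obj} {p q n : ℤ} (g : D.Hom x y p) (c : Chain D y z q)
    (h : p - 1 + q = n) (F : Chain D x z (n + 1) → M) :
    wsum (cons g c h).bar F = sgn k q • (F (cons (D.d g) c (by omega)) + mulHead g c h F) +
      wsum c.bar fun c' => F (cons g c' (by omega)) := by
  cases c with
  | nil x => simp [bar, mulHead]
  | cons g' c h' =>
    rw [bar, wsum_cons, wsum_append, wsum_map (fun c' => cons g c' _)]
    simp [mulHead, add_assoc]

omit [Module k M] in
@[simp] theorem mulHead_nil {x y : D.Obj} {p n : ℤ} (g : D.Hom x y p) (h : p - 1 + 0 = n)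
    (F : Chain D x y (n + 1) → M) : mulHead g (nil y) h F = 0 := rfl

omit [Module k M] in
theorem mulHead_cons {x y z w : D.Obj} {p q r n : ℤ} (g : D.Hom x y p) (g' : D.Hom y w r)
    (c : Chain D w z q) {m : ℤ} (h' : r - 1 + q = m) (h : p - 1 + m = n)
    (F : Chain D x z (n + 1) → M) :
    mulHead g (cons g' c h') h F = F (cons (D.comp g' g rfl) c (by omega)) := rfl

theorem cons_comp_congr {x y z w : D.Obj} {p q r m m' n : ℤ} (g' : D.Hom y z q) (g : D.Hom x y p)
    (h : q + p = m) (h' : q + p = m') (c : Chain D z w r) (h₁ : m - 1 + r = n) :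
    cons (D.comp g' g h) c h₁ = cons (D.comp g' g h') c (by omega) := by
  subst h h'; rfl

-- Associativity of composition in D, in the form in which the double products cancel in the square
-- of the bar differential.
omit [Module k M] in
theorem mulHead_mulHead {x y z w : D.Obj} {p q r n m : ℤ} (g : D.Hom x y p) (g' : D.Hom y w r)
    (c : Chain D w z q) (h' : r - 1 + q = m) (h₁ : p - 1 + (m + 1) = n + 1)
    (F : Chain D x z (n + 1 + 1) → M) :
    mulHead g' c h' (fun w => mulHead g w h₁ F) =
      mulHead (D.comp g' g rfl) c (by omega) F := by
  cases c with
  | nil => rfl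
  | cons g'' c h'' =>
    simp only [mulHead_cons]
    congr 1
    rw [cons_comp_congr g'' (D.comp g' g rfl) rfl (add_assoc _ r p).symm,
      DGCat.assoc D g'' g' g rfl rfl rfl]

/-- No cut separates the two factors of the product at the head: either the initial piece is empty,
or it contains the product. -/
theorem mulHead_cuts {x y z : D.Obj} {p q n : ℤ} (g : D.Hom x y p) (c : Chain D y z q)
    (h : p - 1 + q = n) (F : Split D x z (n + 1) → M) :
    mulHead g c h (fun w => wsum w.cuts F) =
      mulHead g c h (fun w => F ⟨x, 0, n + 1, nil x, w, by omega⟩) +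
      wsum c.cuts fun s => mulHead g s.fst rfl fun w =>
        F ⟨s.mid, _, s.q, w, s.snd, by have := s.h; omega⟩ := by
  cases c with
  | nil x => simp [mulHead]
  | cons g' c h' =>
    subst h' h
    simp only [mulHead, wsum_cuts_cons, zero_add]
    congr 1
    refine wsum_congr _ fun s => ?_
    exact congrArg F (Split.mk_congr _ _ (by omega) (cons_heq ..) .rfl)

/-- The bar differential is a coderivation: each term alters entries on one side of the cut. Its
sign counts what lies to the right, so a change in the initial piece also picks up the sign of the
final piece. -/
theorem wsum_bar_cuts {x y : D.Obj} {n : ℤ} (c : Chain D x y n) (F : Split D x y (n + 1) → M) :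
    wsum c.bar (fun c' => wsum c'.cuts F) = wsum c.cuts fun s =>
      sgn k s.q • wsum s.fst.bar (fun a => F ⟨s.mid, _, s.q, a, s.snd, by have := s.h; omega⟩) +
        wsum s.snd.bar fun b => F ⟨s.mid, s.p, _, s.fst, b, by have := s.h; omega⟩ := by
  induction c with
  | nil x => simp only [wsum_cuts_nil, wsum_bar_nil, smul_zero, add_zero]
  | cons g c h ih =>
    rename_i p q n
    -- The sign of a change at the head involves all of `c`. For each cut of `c` it is the product
    -- of the signs of the two pieces.
    have key : ∀ G : Split D _ _ q → M, sgn k q • wsum c.cuts G =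
        wsum c.cuts fun s => sgn k s.q • sgn k s.p • G s := fun G => by
      rw [← wsum_smul]
      exact wsum_congr _ fun s => by rw [smul_smul, ← s.sgn_eq]
    simp only [wsum_bar_cons, wsum_cuts_cons, wsum_bar_nil, smul_zero, zero_add, mulHead_cuts,
      wsum_add, smul_add, key, ih]
    have h₁ : ∀ (s : Split D _ _ q), F ⟨s.mid, _, s.q, cons (D.d g) s.fst rfl, s.snd,
        by have := s.h; omega⟩ = F
          ⟨s.mid, p - 1 + s.p + 1, s.q, cons (D.d g) s.fst (by omega), s.snd,
        by have := s.h; omega⟩ := fun s =>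
      congrArg F (Split.mk_congr _ _ (by omega) (cons_heq ..) .rfl)
    have h₂ : ∀ (s : Split D _ _ q), (wsum s.fst.bar fun c' => F ⟨s.mid, p - 1 + (s.p + 1), s.q,
        cons g c' rfl, s.snd, by have := s.h; omega⟩) = wsum s.fst.bar fun c' =>
        F ⟨s.mid, p - 1 + s.p + 1, s.q, cons g c' (by omega), s.snd, by have := s.h; omega⟩ :=
      fun s => wsum_congr _ fun c' =>
        congrArg F (Split.mk_congr _ _ (by omega) (cons_heq ..) .rfl)
    simp only [h₁, h₂]
    abel

/-! ### Multilinear and normalized functions on chains -/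

/-- `IsComb c l`: the chain `c` has a linear combination in one of its entries, and `l` is the
resulting formal linear combination of chains. -/
inductive IsComb : ∀ {x y : D.Obj} {n : ℤ}, Chain D x y n → List (k × Chain D x y n) → Prop
  | head {x y z : D.Obj} {p q n : ℤ} (l : List (k × D.Hom x y p)) (c : Chain D y z q)
      (h : p - 1 + q = n) :
      IsComb (cons (wsum l fun g => g) c h) (l.map fun w => (w.1, cons w.2 c h))
  | tail {x y z : D.Obj} {p q n : ℤ} (g : D.Hom x y p) {c : Chain D y z q}
      {l : List (k × Chain D y z q)} (h : p - 1 + q = n) (H : IsComb c l) :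
      IsComb (cons g c h) (l.map fun w => (w.1, cons g w.2 h))

/-- A function on chains is multilinear if it is linear in each entry. -/
def Multilin {x y : D.Obj} {n : ℤ} (F : Chain D x y n → M) : Prop :=
  ∀ ⦃c : Chain D x y n⦄ ⦃l : List (k × Chain D x y n)⦄, IsComb c l → F c = wsum l F

namespace Multilin

variable {x y z : D.Obj} {p q n : ℤ}

theorem cons {F : Chain D x z n → M} (hF : Multilin F) (g : D.Hom x y p) (h : p - 1 + q = n) :
    Multilin fun c : Chain D y z q => F (.cons g c h) := fun c l H => by
  beta_reduce; rw [hF (.tail g h H), wsum_map fun c => Chain.cons g c h]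

theorem cons_wsum {F : Chain D x z n → M} (hF : Multilin F) {ι : Type*} (l : List (k × ι))
    (f : ι → D.Hom x y p) (c : Chain D y z q) (h : p - 1 + q = n) :
    F (.cons (wsum l f) c h) = wsum l fun i => F (.cons (f i) c h) := by
  have := hF (.head (l.map fun w => (w.1, f w.2)) c h)
  rwa [wsum_map f, wsum_map fun g => Chain.cons g c h, wsum_map f] at this

theorem cons_add {F : Chain D x z n → M} (hF : Multilin F) (g g' : D.Hom x y p)
    (c : Chain D y z q) (h : p - 1 + q = n) :
    F (.cons (g + g') c h) = F (.cons g c h) + F (.cons g' c h) := by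
  have := hF.cons_wsum [((1 : k), g), (1, g')] (fun g => g) c h
  simpa using this

theorem cons_smul {F : Chain D x z n → M} (hF : Multilin F) (a : k) (g : D.Hom x y p)
    (c : Chain D y z q) (h : p - 1 + q = n) :
    F (.cons (a • g) c h) = a • F (.cons g c h) := by
  have := hF.cons_wsum [(a, g)] (fun g => g) c h
  simpa using this

/-- The dependence of a multilinear function on the first entry, as a linear map. -/
def headLin {F : Chain D x z n → M} (hF : Multilin F) (c : Chain D y z q) (h : p - 1 + q = n) :
    D.Hom x y p →ₗ[k] M where
  toFun g := F (.cons g c h)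
  map_add' g g' := hF.cons_add g g' c h
  map_smul' a g := hF.cons_smul a g c h

theorem cons_zero {F : Chain D x z n → M} (hF : Multilin F) (c : Chain D y z q)
    (h : p - 1 + q = n) : F (.cons (0 : D.Hom x y p) c h) = 0 := map_zero (hF.headLin c h)

theorem zero : Multilin fun _ : Chain D x y n => (0 : M) := fun _ _ _ => by simp

theorem add {F G : Chain D x y n → M} (hF : Multilin F) (hG : Multilin G) :
    Multilin fun c => F c + G c := fun c l H => by beta_reduce; rw [hF H, hG H, wsum_add]

theorem map {N : Type*} [AddCommGroup N] [Module k N] {F : Chain D x y n → M} (hF : Multilin F)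
    (L : M →ₗ[k] N) : Multilin fun c => L (F c) := fun c l H => by beta_reduce; rw [hF H, map_wsum]

theorem smul {F : Chain D x y n → M} (hF : Multilin F) (a : k) : Multilin fun c => a • F c :=
  hF.map (LinearMap.lsmul k M a)

theorem wsum {ι : Type*} (L : List (k × ι)) {F : ι → Chain D x y n → M}
    (hF : ∀ i, Multilin (F i)) : Multilin fun c => _root_.wsum L fun i => F i c := fun c l H => by
  rw [wsum_comm]; exact wsum_congr _ fun i => hF i H

theorem of_isAdd_of_isSMul {F : Chain D x y n → M}
    (h₁ : ∀ {c c₁ c₂ : Chain D x y n}, c.IsAdd c₁ c₂ → F c = F c₁ + F c₂)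
    (h₂ : ∀ {a : k} {c c₁ : Chain D x y n}, c.IsSMul a c₁ → F c = a • F c₁) : Multilin F := by
  intro c l H
  induction H with
  | head l c h =>
    rw [wsum_map fun g => Chain.cons g c h]
    let L : D.Hom _ _ _ →ₗ[k] M :=
      { toFun := fun g => F (.cons g c h)
        map_add' := fun g g' => h₁ (.head g g' c h)
        map_smul' := fun a g => h₂ (.head g c h) }
    exact map_wsum L l _
  | tail g h H ih =>
    rw [wsum_map fun c => Chain.cons g c h]
    exact ih (F := fun c => F (.cons g c h)) (fun H => h₁ (.tail g h H)) fun H => h₂ (.tail g h H)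

theorem isAdd {F : Chain D x y n → M} (hF : Multilin F) {c c₁ c₂ : Chain D x y n}
    (H : c.IsAdd c₁ c₂) : F c = F c₁ + F c₂ := by
  induction H with
  | head g g' c h => exact hF.cons_add g g' c h
  | tail g h H ih => exact ih (hF.cons g h)

theorem isSMul {F : Chain D x y n → M} (hF : Multilin F) {a : k} {c c₁ : Chain D x y n}
    (H : c.IsSMul a c₁) : F c = a • F c₁ := by
  induction H with
  | head g c h => exact hF.cons_smul a g c h
  | tail g h H ih => exact ih (hF.cons g h)

theorem cuts {F : Split D x y n → M}
    (h₁ : ∀ {z : D.Obj} {p q : ℤ} (b : Chain D z y q) (h : p + q = n),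
      Multilin fun a => F ⟨z, p, q, a, b, h⟩)
    (h₂ : ∀ {z : D.Obj} {p q : ℤ} (a : Chain D x z p) (h : p + q = n),
      Multilin fun b => F ⟨z, p, q, a, b, h⟩) : Multilin fun c => _root_.wsum c.cuts F := by
  intro c l H
  induction H with
  | head l c h =>
    rw [wsum_map fun g => Chain.cons g c h]
    simp only [wsum_cuts_cons, wsum_add]
    rw [wsum_comm l]
    refine congrArg₂ _ ((h₂ _ _).cons_wsum _ _ _ _) (wsum_congr _ fun s => ?_)
    exact (h₁ s.snd _).cons_wsum _ _ _ _
  | @tail x' y' z' p' q' n' g c l h H ih =>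
    rw [wsum_map fun c => Chain.cons g c h]
    simp only [wsum_cuts_cons, wsum_add]
    refine congrArg₂ _ ((h₂ _ _).cons g h H) ?_
    exact ih (F := fun s => F ⟨s.mid, _, s.q, .cons g s.fst rfl, s.snd, by have := s.h; omega⟩)
      (fun {_ p _} b h => (h₁ (p := p' - 1 + p) b (by omega)).cons g rfl)
        fun {_ _ q} a h => h₂ (q := q) (.cons g a rfl) (by omega)

theorem bar {F : Chain D x y (n + 1) → M} (hF : Multilin F) :
    Multilin fun c : Chain D x y n => _root_.wsum c.bar F := by
  intro c l H
  induction H with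
  | head l c h =>
    rw [wsum_map fun g => Chain.cons g c h]
    simp only [wsum_bar_cons, wsum_add, DGCat.d_wsum, hF.cons_wsum, wsum_smul]
    rw [wsum_comm l]
    congr 3
    · cases c with
      | nil => simp [mulHead]
      | cons g' c h' => simp only [mulHead, DGCat.comp_wsum, hF.cons_wsum]
  | tail g h H ih =>
    rw [wsum_map fun c => Chain.cons g c h]
    simp only [wsum_bar_cons, wsum_add, wsum_smul]
    refine congrArg₂ _ (congrArg _ (congrArg₂ _ (hF.cons _ _ H) ?_)) (ih (hF.cons g _))
    -- The product of `g` with the head of the remaining chain is affected by the linear combination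
    -- only if this sits in that head.
    cases H with
    | head l c h' =>
      rw [wsum_map fun g => Chain.cons g c h']
      simp only [mulHead, DGCat.wsum_comp, hF.cons_wsum]
    | tail g' h' H' =>
      rw [wsum_map fun c => Chain.cons g' c h']
      simp only [mulHead]
      exact hF.cons _ _ H'

end Multilin

/-- By recursion only the terms that touch the first two entries matter, and they cancel by d² = 0,
the Leibniz rule and associativity. Multilinearity is what allows the Leibniz rule to be applied
inside an entry. -/
theorem wsum_bar_bar {x y : D.Obj} {n : ℤ} (c : Chain D x y n) {F : Chain D x y (n + 1 + 1) → M}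
    (hF : Multilin F) : (wsum c.bar fun c' => wsum c'.bar F) = 0 := by
  induction c with
  | nil x => simp only [wsum_bar_nil]
  | @cons _ _ _ p _ _ g c h ih =>
    simp only [wsum_bar_cons, wsum_add, ih (hF.cons g _), DGCat.d_d, hF.cons_zero, sgn_add_one,
      zero_add, smul_add, smul_smul, neg_smul, sgn_mul_self, one_smul, wsum_neg, wsum_smul]
    cases c with
    | nil z => simp [mulHead, bar]
    | @cons _ y' _ p' q' _ g' c h' =>
      subst h'
      -- The sign of g' ∘ dg when the product is formed first and then differentiated. In the
      -- opposite order the two signs multiply to 1, so the terms cancel.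
      have e₁ : sgn k (p' - 1 + q') * (sgn k q' * sgn k p') = -1 := by
        rw [sgn_add, sgn_sub_one]
        linear_combination (-sgn k p' * sgn k p') * sgn_mul_self (k := k) q' -
          sgn_mul_self (k := k) p'
      simp only [mulHead_cons, wsum_bar_cons, DGCat.leibniz, hF.cons_add, hF.cons_smul, smul_add,
        smul_smul, mulHead_mulHead, e₁, neg_smul, one_smul]
      rw [cons_comp_congr g' (D.d g) _ (add_assoc p' _ 1).symm c,
        cons_comp_congr (D.d g') g rfl (add_right_comm p' 1 p) c]
      abel

/-! ### Cancellation of the terms that absorb an identity. -/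

theorem cons_comp_id {x y z : D.Obj} {p q m n : ℤ} (g : D.Hom x y p) (h : p + 0 = m)
    (c : Chain D y z q) (h' : m - 1 + q = n) :
    cons (D.comp g (D.id x) h) c h' = cons g c (by omega) := by
  obtain rfl : p = m := by omega
  rw [D.comp_id]

theorem cons_id_comp {x y z : D.Obj} {p q m n : ℤ} (g : D.Hom x y p) (h : 0 + p = m)
    (c : Chain D y z q) (h' : m - 1 + q = n) :
    cons (D.comp (D.id y) g h) c h' = cons g c (by omega) := by
  obtain rfl : p = m := by omega
  rw [D.id_comp]

/-- A function on cut chains that removes an identity at the end of a chain: it is compatible with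
the function `F` on chains of one entry less, and it vanishes if the final piece is not a single
morphism, or if the initial piece has an identity among its entries. -/
structure RemovesLast {x z : D.Obj} {n : ℤ} (F : Chain D x z (n + 1) → M)
    (l : Split D x z n → M) : Prop where
  hasId : ∀ s, s.fst.HasId → l s = 0
  nil : ∀ {p q : ℤ} (c : Chain D x z p) (hq : 0 = q) (h : p + q = n),
    l ⟨z, p, q, c, hq ▸ nil z, h⟩ = 0
  single : ∀ (c : Chain D x z (n + 1)) {q : ℤ} (h : 0 - 1 + 0 = q) (h' : n + 1 + q = n),
    l ⟨z, n + 1, q, c, cons (D.id z) (.nil z) h, h'⟩ = F c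
  cons_cons : ∀ {w y y' : D.Obj} {p q r m s t : ℤ} (a : Chain D x w p) (g : D.Hom w y q)
    (g' : D.Hom y y' r) (c : Chain D y' z m) (h : r - 1 + m = s) (h' : q - 1 + s = t)
    (h'' : p + t = n), l ⟨w, p, t, a, cons g (cons g' c h) h', h''⟩ = 0

omit [Module k M] in
theorem RemovesLast.cons {x y z : D.Obj} {p q n : ℤ} {F : Chain D x z (n + 1) → M}
    {l : Split D x z n → M} (H : RemovesLast F l) (g : D.Hom x y p) (h : p - 1 + q = n) :
    RemovesLast (fun c : Chain D y z (q + 1) => F (cons g c (by omega)))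
      (fun s => l ⟨s.mid, _, s.q, cons g s.fst rfl, s.snd, by have := s.h; omega⟩) where
  hasId s hs := H.hasId _ (.tail g _ hs)
  nil c hq _ := H.nil _ hq _
  single c _ h h' := (congrArg l
    (Split.mk_congr _ _ (by dsimp only; omega) (cons_heq ..) .rfl)).trans
    (H.single (Chain.cons g c (by omega)) h (by omega))
  cons_cons a g' g'' c h h' _ := H.cons_cons (Chain.cons g a rfl) g' g'' c h h' _

/-- The differential of the identity is zero, and all later terms keep the identity as an entry.
Only its product with the next entry survives; in a chain of length one there is no next entry, and
the end term `l` takes its place. -/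
theorem RemovesLast.wsum_cons_id {x z : D.Obj} {q n : ℤ} {F : Chain D x z (n + 1) → M}
    {l : Split D x z n → M} (H : RemovesLast F l) (hF : Multilin F)
    (hF' : ∀ c : Chain D x z (n + 1), c.HasId → F c = 0) (c : Chain D x z q) (hq : q = n + 1)
    (h : 0 - 1 + q = n) :
    wsum (Chain.cons (D.id x) c h).bar F + wsum (Chain.cons (D.id x) c h).cuts l =
      sgn k q • F (hq ▸ c) := by
  rw [wsum_bar_cons, wsum_cuts_cons, wsum_eq_zero (c.bar), wsum_eq_zero (c.cuts), DGCat.d_id,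
    hF.cons_zero]
  · cases c with
    | nil x =>
      obtain rfl : n = -1 := by omega
      simp only [mulHead_nil, smul_zero, add_zero, zero_add, sgn_zero, one_smul]
      exact (congrArg l (Split.mk_congr _ _ (by omega) .rfl .rfl)).trans
        (H.single (.nil x) rfl (by omega))
    | cons g c h' =>
      subst hq
      rw [H.cons_cons, mulHead_cons]
      simp only [add_zero, zero_add]
      rw [cons_comp_id]
  · exact fun s => H.hasId _ (.head _ _)
  · exact fun s => hF' _ (.head _ _)

/-- The terms of the bar differential that remove an identity cancel each other, up to those at the
ends of the chain. -/
theorem RemovesLast.wsum_cons_of_hasId {x y z : D.Obj} {p q n : ℤ} {F : Chain D x z (n + 1) → M}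
    {l : Split D x z n → M} (H : RemovesLast F l) (hF : Multilin F)
    (hF' : ∀ c : Chain D x z (n + 1), c.HasId → F c = 0) (g : D.Hom x y p) {c : Chain D y z q}
    (hc : c.HasId) (h : p - 1 + q = n) :
    wsum (Chain.cons g c h).bar F + wsum (Chain.cons g c h).cuts l = 0 := by
  induction hc generalizing x p n with
  | head c h' =>
    have := (H.cons g h).wsum_cons_id (hF.cons g _) (fun c hc => hF' _ (.tail g _ hc)) c
      (by omega) h'
    rw [wsum_bar_cons, wsum_cuts_cons, H.cons_cons, hF' _ (.tail _ _ (.head _ _)), zero_add,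
      zero_add, add_assoc, this, mulHead_cons, cons_id_comp]
    rename_i q₁ q
    -- The identity is absorbed by the entry before it and by the entry after it, with the same
    -- result. The two signs refer to the tails with and without the identity, which has degree -1
    -- in a chain, so they are opposite.
    obtain rfl : q₁ = q + 1 := by omega
    rw [sgn_add_one, neg_smul, add_neg_cancel]
  | tail g' h' hc ih =>
    rw [wsum_bar_cons, wsum_cuts_cons, H.cons_cons, hF' _ (.tail _ _ (.tail _ _ hc)), zero_add,
      zero_add, add_assoc, ih (H.cons g h) (hF.cons g _) (fun c hc => hF' _ (.tail g _ hc)),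
      mulHead_cons, hF' _ (.tail _ _ hc)]
    simp
theorem wsum_cuts_of_hasId {x y : D.Obj} {n : ℤ} {c : Chain D x y n} (H : c.HasId)
    (F : Split D x y n → M) (h₁ : ∀ s, s.fst.HasId → F s = 0) (h₂ : ∀ s, s.snd.HasId → F s = 0) :
    wsum c.cuts F = 0 := by
  induction H with
  | head c h =>
    rw [wsum_cuts_cons, h₂ _ (.head _ _), wsum_eq_zero _ fun s => h₁ _ (.head _ _), add_zero]
  | tail g h H ih =>
    rw [wsum_cuts_cons, h₂ _ (.tail _ _ H), zero_add]
    exact ih _ (fun s hs => h₁ _ (.tail _ _ hs)) fun s hs => h₂ _ hs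

end Chain

/-! ## The dg category of multilinear cochains -/

namespace DGCat

variable {k : Type u} [CommRing k]

theorem comp_comp_congr {A : DGCat k} {w x y z : A.Obj} {p q r t n : ℤ} (c : A.Hom y z r)
    (b : A.Hom x y q) (a : A.Hom w x p) (h₃ : q + p = t) (h₄ : r + t = n) :
    A.comp c (A.comp b a h₃) h₄ = A.comp c (A.comp b a rfl) (by omega) := by
  subst h₃; rfl

theorem assoc_left {A : DGCat k} {w x y z : A.Obj} {p q r s n : ℤ} (c : A.Hom y z r)
    (b : A.Hom x y q) (a : A.Hom w x p) (h₁ : r + q = s) (h₂ : s + p = n) :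
    A.comp (A.comp c b h₁) a h₂ = A.comp c (A.comp b a rfl) (by omega) :=
  A.assoc c b a h₁ h₂ rfl _

end DGCat

namespace Chain.Multilin

variable {k : Type u} [CommRing k] {D A : DGCat k} {x y : D.Obj} {n : ℤ}

theorem comp_left {X Y Z : A.Obj} {p q m : ℤ} {F : Chain D x y n → A.Hom X Y p} (hF : Multilin F)
    (g : A.Hom Y Z q) (h : q + p = m) : Multilin fun c => A.comp g (F c) h :=
  hF.map (A.compLeft g h)

theorem comp_right {X Y Z : A.Obj} {p q m : ℤ} {F : Chain D x y n → A.Hom Y Z q} (hF : Multilin F)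
    (f : A.Hom X Y p) (h : q + p = m) : Multilin fun c => A.comp (F c) f h :=
  hF.map (A.compRight f h)

end Chain.Multilin

/-- Multilinear cochains of degree `p` on the chains of `D`, with values in the morphisms of `A`
between the objects that `X` and `Y` attach to the two ends of a chain. -/
def rawCochain {k : Type u} [CommRing k] {D A : DGCat k} (X Y : D.Obj → A.Obj) (p : ℤ) :
    Submodule k (∀ (x y : D.Obj) (q : ℤ), Chain D x y q → A.Hom (X x) (Y y) (p + q)) where
  carrier := {φ | ∀ x y q, Chain.Multilin (φ x y q)}
  add_mem' hφ hψ x y q := (hφ x y q).add (hψ x y q)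
  zero_mem' _ _ _ := Chain.Multilin.zero
  smul_mem' a _ hφ x y q := (hφ x y q).smul a

/-- The type of multilinear cochains. -/
def RawCochain {k : Type u} [CommRing k] {D A : DGCat k} (X Y : D.Obj → A.Obj) (p : ℤ) : Type u :=
  rawCochain X Y p

instance {k : Type u} [CommRing k] {D A : DGCat k} (X Y : D.Obj → A.Obj) (p : ℤ) :
    AddCommGroup (RawCochain X Y p) := inferInstanceAs (AddCommGroup (rawCochain X Y p))

instance {k : Type u} [CommRing k] {D A : DGCat k} (X Y : D.Obj → A.Obj) (p : ℤ) :
    Module k (RawCochain X Y p) := inferInstanceAs (Module k (rawCochain X Y p))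

namespace RawCochain

variable {k : Type u} [CommRing k] {D A : DGCat k} {W X Y Z : D.Obj → A.Obj} {p q r n m : ℤ}

/-- The value of a cochain on a chain. -/
def app (φ : RawCochain X Y p) {x y : D.Obj} (c : Chain D x y q) (h : p + q = n) :
    A.Hom (X x) (Y y) n := DGCat.reindex h (φ.1 x y q c)

theorem multilin (φ : RawCochain X Y p) (x y : D.Obj) (h : p + q = n) :
    Chain.Multilin fun c : Chain D x y q => φ.app c h := by
  subst h; exact φ.2 x y q

@[ext] theorem ext {φ ψ : RawCochain X Y p} (H : ∀ {x y : D.Obj} {q n : ℤ} (c : Chain D x y q)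
    (h : p + q = n), φ.app c h = ψ.app c h) : φ = ψ :=
  Subtype.ext <| by funext x y q c; exact H c rfl

/-- A cochain from its values. -/
def mk (f : ∀ (x y : D.Obj) (q n : ℤ), Chain D x y q → p + q = n → A.Hom (X x) (Y y) n)
    (hf : ∀ x y q n h, Chain.Multilin fun c => f x y q n c h) : RawCochain X Y p :=
  ⟨fun x y q c => f x y q _ c rfl, fun x y q => hf x y q _ rfl⟩

theorem app_mk (f : ∀ (x y : D.Obj) (q n : ℤ), Chain D x y q → p + q = n → A.Hom (X x) (Y y) n)
    (hf : ∀ x y q n h, Chain.Multilin fun c => f x y q n c h) {x y : D.Obj} (c : Chain D x y q)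
    (h : p + q = n) : (mk f hf).app c h = f x y q n c h := by
  subst h; rfl

@[simp] theorem app_add (φ ψ : RawCochain X Y p) {x y : D.Obj} (c : Chain D x y q)
    (h : p + q = n) : (φ + ψ).app c h = φ.app c h + ψ.app c h := by subst h; rfl

@[simp] theorem app_sub (φ ψ : RawCochain X Y p) {x y : D.Obj} (c : Chain D x y q)
    (h : p + q = n) : (φ - ψ).app c h = φ.app c h - ψ.app c h := by subst h; rfl

@[simp] theorem app_smul (a : k) (φ : RawCochain X Y p) {x y : D.Obj} (c : Chain D x y q)
    (h : p + q = n) : (a • φ).app c h = a • φ.app c h := by subst h; rfl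

@[simp] theorem app_zero {x y : D.Obj} (c : Chain D x y q) (h : p + q = n) :
    (0 : RawCochain X Y p).app c h = 0 := by subst h; rfl

/-- The unit cochain. -/
def one (X : D.Obj → A.Obj) : RawCochain X X 0 :=
  mk (fun x y q n c h => match c, h with
      | .nil x, h => DGCat.reindex (by omega) (A.id (X x))
      | .cons _ _ _, _ => 0)
    (fun x y q n h c l H => by
      cases H with
      | head l c h => rw [wsum_map fun g => Chain.cons g c h]; simp
      | tail g h H => rw [wsum_map fun c => Chain.cons g c h]; simp)

@[simp] theorem one_nil (x : D.Obj) (h : (0 : ℤ) + 0 = 0) :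
    (one X).app (.nil x) h = A.id (X x) := rfl

@[simp] theorem one_cons {x y z : D.Obj} (g : D.Hom x y p) (c : Chain D y z q)
    (h : p - 1 + q = m) (h' : 0 + m = n) : (one X).app (.cons g c h) h' = 0 := by
  subst h'; rfl

/-- The cup product of cochains. -/
def cup (ψ : RawCochain Y Z q) (φ : RawCochain X Y p) (h : q + p = n) : RawCochain X Z n :=
  -- The Koszul sign of moving `φ`, of degree `p`, past the final piece of the chain.
  mk (fun x y r m c hc => wsum c.cuts fun s => sgn k (p * s.q) •
      A.comp (ψ.app s.snd rfl) (φ.app s.fst rfl) (by have := s.h; omega))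
    (fun x y r m h' => by
      refine .cuts (fun {z p' q'} b h => ?_) (fun {z p' q'} a h => ?_) <;> dsimp only
      · exact ((φ.multilin x z (rfl : p + p' = _)).comp_left (ψ.app b rfl) (by omega)).smul _
      · exact ((ψ.multilin z y (rfl : q + q' = _)).comp_right (φ.app a rfl) (by omega)).smul _)

theorem app_cup (ψ : RawCochain Y Z q) (φ : RawCochain X Y p) (h : q + p = n) {x y : D.Obj}
    (c : Chain D x y r) (h' : n + r = m) :
    (cup ψ φ h).app c h' = wsum c.cuts fun s => sgn k (p * s.q) •
      A.comp (ψ.app s.snd rfl) (φ.app s.fst rfl) (by have := s.h; omega) := by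
  subst h'; rfl

/-- The differential of cochains that is induced by those of `D` and `A`. -/
def delta (φ : RawCochain X Y p) : RawCochain X Y (p + 1) :=
  mk (fun x y q n c h => (A.reindex (by omega) (A.d (φ.app c rfl))) +
      sgn k p • wsum c.bar fun c' => φ.app c' (by omega))
    (fun x y q n h => by
      obtain rfl : n = p + q + 1 := by omega
      exact ((φ.multilin _ _ rfl).map (A.dLin _ _ _)).add ((φ.multilin _ _ _).bar.smul _))

theorem app_delta (φ : RawCochain X Y p) {x y : D.Obj} (c : Chain D x y q) (h : p + q = n)
    (h' : p + 1 + q = n + 1) : (delta φ).app c h' =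
      A.d (φ.app c h) + sgn k p • wsum c.bar fun c' => φ.app c' (by omega) := by
  subst h; rw [delta, app_mk]; rfl

theorem comp_app_left (ψ : RawCochain Y Z q) {x y : D.Obj} {w : A.Obj} (c : Chain D x y r)
    {n m l : ℤ} (h : q + r = n) (f : A.Hom w (Y x) m) (h' : n + m = l) :
    A.comp (ψ.app c h) f h' = A.comp (ψ.app c rfl) f (by omega) := by subst h; rfl

theorem comp_app_right (ψ : RawCochain Y Z q) {x y : D.Obj} {w : A.Obj} (c : Chain D x y r)
    {n m l : ℤ} (h : q + r = n) (f : A.Hom (Z y) w m) (h' : m + n = l) :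
    A.comp f (ψ.app c h) h' = A.comp f (ψ.app c rfl) (by omega) := by subst h; rfl

/-- The differential of A and the bar differential both have square zero. The mixed term occurs
twice, with the signs of `p` and `p + 1`. -/
theorem delta_delta (φ : RawCochain X Y p) : delta (delta φ) = 0 := by
  ext x y q n c h
  obtain rfl : n = p + q + 1 + 1 := by omega
  rw [app_delta _ _ (by omega), app_delta _ _ rfl, app_zero, A.d_add, A.d_d, A.d_smul, DGCat.d_wsum]
  have : ∀ c' : Chain D x y (q + 1), (delta φ).app c' (by omega) =
      A.d (φ.app c' (show p + (q + 1) = p + q + 1 by omega)) +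
      sgn k p • wsum c'.bar fun c'' => φ.app c'' (show p + (q + 1 + 1) = p + q + 1 + 1 by omega) :=
    fun c' => app_delta _ _ _ _
  rw [wsum_congr _ this, wsum_add, wsum_smul, Chain.wsum_bar_bar _ (φ.multilin _ _ _),
    sgn_add_one]
  simp

/-- Both sides are the same sum over the cuts into three pieces. If the last two pieces have degrees
q' and r', the common sign is that of p(q' + r') + qr'. -/
theorem cup_assoc {χ : RawCochain Y Z r} {ψ : RawCochain X Y q} {φ : RawCochain W X p} {s t : ℤ}
    (h₁ : r + q = s) (h₂ : s + p = n) (h₃ : q + p = t) (h₄ : r + t = n) :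
    cup (cup χ ψ h₁) φ h₂ = cup χ (cup ψ φ h₃) h₄ := by
  ext x y l m c h
  have key := Chain.wsum_cuts_assoc c (M := A.Hom (W x) (Z y) m) fun {_ _ p' q' r'} a b c h' =>
    sgn k (p * (q' + r') + q * r') • A.comp (χ.app c rfl)
      (A.comp (ψ.app b rfl) (φ.app a rfl) rfl) (by omega)
  simp only [app_cup, DGCat.wsum_comp, DGCat.comp_wsum, A.smul_comp, A.comp_smul, ← wsum_smul,
    smul_smul, ← sgn_add]
  refine Eq.trans (wsum_congr _ fun s => wsum_congr _ fun t => ?_)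
    (key.symm.trans (wsum_congr _ fun s => wsum_congr _ fun t => ?_))
  · rw [A.assoc_left, sgn_congr ⟨0, _⟩]
    linear_combination -p * t.h
  · subst h₃
    exact congrArg₂ _ (congrArg _ (by ring)) (A.comp_comp_congr ..).symm

theorem one_cup (φ : RawCochain X Y p) (h : 0 + p = p) : cup (one Y) φ h = φ := by
  ext x y q n c h'
  subst h'
  rw [app_cup, Chain.wsum_cuts_of_snd]
  · dsimp only
    rw [← comp_app_left (one Y) (.nil y) (zero_add 0) (h' := by omega), one_nil, A.id_comp]
    simp
  · intro w z p' q' r m g a b h h'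
    simp

theorem cup_one (φ : RawCochain X Y p) (h : p + 0 = p) : cup φ (one X) h = φ := by
  ext x y q n c h'
  subst h'
  rw [app_cup, Chain.wsum_cuts_of_fst]
  · dsimp only
    rw [← comp_app_right (one X) (.nil x) (zero_add 0) (h' := by omega), one_nil, zero_mul,
      sgn_zero, one_smul]
    exact A.comp_id _ _
  · intro w z p' q' r m g a b h h'
    simp

/-- The Leibniz rule of A treats the part that comes from the differential of A, and the
coderivation property `Chain.wsum_bar_cuts` the part that comes from the bar differential. -/
theorem delta_cup (ψ : RawCochain Y Z q) (φ : RawCochain X Y p) (h : q + p = n) :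
    delta (cup ψ φ h) = cup (delta ψ) φ (by omega) + sgn k q • cup ψ (delta φ) (by omega) := by
  ext x y l m c h'
  obtain rfl : m = n + l + 1 := by omega
  have e : ∀ c' : Chain D x y (l + 1), (cup ψ φ h).app c' (by omega) = wsum c'.cuts fun s =>
      sgn k (p * s.q) • A.comp (ψ.app s.snd rfl) (φ.app s.fst rfl)
        (show _ = n + l + 1 by have := s.h; omega) := fun c' => app_cup _ _ _ _ _
  rw [app_delta _ _ rfl, wsum_congr _ e, Chain.wsum_bar_cuts, app_add, app_smul, app_cup, app_cup,
    app_cup, A.d_wsum, ← wsum_smul, ← wsum_smul, ← wsum_add, ← wsum_add]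
  refine wsum_congr _ fun s => ?_
  rw [A.d_smul, A.leibniz]
  rw [← comp_app_left (delta ψ) s.snd (show q + 1 + s.q = q + s.q + 1 by omega)
      (h' := by have := s.h; omega), app_delta _ _ rfl,
    ← comp_app_right (delta φ) s.fst (show p + 1 + s.p = p + s.p + 1 by omega)
      (h' := by have := s.h; omega), app_delta _ _ rfl, A.add_comp, A.smul_comp, A.comp_add,
    A.comp_smul, A.wsum_comp, A.comp_wsum]
  have e₁ : ∀ a : Chain D x s.mid (s.p + 1), A.comp (ψ.app s.snd rfl)
      (φ.app a (show p + (s.p + 1) = p + s.p + 1 by omega))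
        (show _ = n + l + 1 by have := s.h; omega) =
      A.comp (ψ.app s.snd rfl) (φ.app a rfl) (by have := s.h; omega) :=
    fun a => comp_app_right _ _ _ _ _
  have e₂ : ∀ b : Chain D s.mid y (s.q + 1), A.comp
      (ψ.app b (show q + (s.q + 1) = q + s.q + 1 by omega)) (φ.app s.fst rfl)
        (show _ = n + l + 1 by have := s.h; omega) =
      A.comp (ψ.app b rfl) (φ.app s.fst rfl) (by have := s.h; omega) :=
    fun b => comp_app_left _ _ _ _ _
  rw [wsum_congr _ e₁, wsum_congr _ e₂]
  dsimp only
  simp only [wsum_smul, smul_add, smul_smul, ← sgn_add]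
  rw [sgn_congr (k := k) (m := n + (s.q + p * s.q)) (n := q + ((p + 1) * s.q + p)) ⟨0, by
      linear_combination -h⟩,
    sgn_congr (k := k) (m := n + p * (s.q + 1)) (n := p * s.q + q) ⟨p, by linear_combination -h⟩,
    sgn_congr (k := k) (m := q + (p + 1) * s.q) (n := p * s.q + (q + s.q)) ⟨0, by ring⟩]
  abel

end RawCochain

/-- The dg category of multilinear cochains. -/
def DGCat.raw {k : Type u} [CommRing k] (D A : DGCat k) : DGCat k where
  Obj := D.Obj → A.Obj
  Hom X Y p := RawCochain X Y p
  id X := RawCochain.one X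
  comp ψ φ h := RawCochain.cup ψ φ h
  d φ := RawCochain.delta φ
  add_comp ψ ψ' φ h := by
    ext x y q n c h'
    simp only [RawCochain.app_cup, RawCochain.app_add, A.add_comp, smul_add, wsum_add]
  comp_add ψ φ φ' h := by
    ext x y q n c h'
    simp only [RawCochain.app_cup, RawCochain.app_add, A.comp_add, smul_add, wsum_add]
  smul_comp a ψ φ h := by
    ext x y q n c h'
    simp only [RawCochain.app_cup, RawCochain.app_smul, A.smul_comp, smul_comm _ a, wsum_smul]
  comp_smul a ψ φ h := by
    ext x y q n c h'
    simp only [RawCochain.app_cup, RawCochain.app_smul, A.comp_smul, smul_comm _ a, wsum_smul]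
  id_comp φ h := RawCochain.one_cup φ h
  comp_id φ h := RawCochain.cup_one φ h
  assoc _ _ _ h₁ h₂ h₃ h₄ := RawCochain.cup_assoc h₁ h₂ h₃ h₄
  d_add {_ _ p} φ ψ := by
    ext x y q n c h'
    obtain rfl : n = p + q + 1 := by omega
    simp only [RawCochain.app_delta _ _ rfl, RawCochain.app_add, A.d_add, smul_add, wsum_add]
    abel
  d_smul {_ _ p} a φ := by
    ext x y q n c h'
    obtain rfl : n = p + q + 1 := by omega
    simp only [RawCochain.app_delta _ _ rfl, RawCochain.app_smul, A.d_smul, smul_add, wsum_smul,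
      smul_comm _ a]
  d_d φ := RawCochain.delta_delta φ
  leibniz ψ φ h := RawCochain.delta_cup ψ φ h

/-! ## Twisting a dg category by Maurer–Cartan elements -/

namespace DGCat

variable {k : Type u} [CommRing k] {R : DGCat k}

/-- The differential twisted by `τ` and `τ'`. -/
def twistD {x y : R.Obj} {n : ℤ} (τ' : R.Hom y y 1) (τ : R.Hom x x 1) (f : R.Hom x y n) :
    R.Hom x y (n + 1) :=
  R.d f + R.comp τ' f (add_comm 1 n) - sgn k n • R.comp f τ rfl

/-- The square of the twisted differential is the commutator with the curvatures dτ + ττ at the two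
ends, and these vanish. -/
theorem twistD_twistD {x y : R.Obj} {n : ℤ} {τ' : R.Hom y y 1} {τ : R.Hom x x 1}
    (hτ' : R.d τ' + R.comp τ' τ' rfl = 0) (hτ : R.d τ + R.comp τ τ rfl = 0) (f : R.Hom x y n) :
    twistD τ' τ (twistD τ' τ f) = 0 := by
  have h₁ : R.d τ' = -R.comp τ' τ' rfl := eq_neg_of_add_eq_zero_left hτ'
  have h₂ : R.d τ = -R.comp τ τ rfl := eq_neg_of_add_eq_zero_left hτ
  simp only [twistD, R.d_add, R.d_sub, R.d_d, R.d_smul, R.leibniz, h₁, h₂, R.comp_add, R.comp_sub,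
    R.add_comp, R.sub_comp, R.comp_smul, R.smul_comp, R.comp_neg, R.neg_comp, sgn_one, sgn_add_one]
  rw [R.assoc τ' τ' f rfl _ (add_comm 1 n) (by omega), R.assoc τ' f τ _ _ rfl (by omega),
    R.assoc f τ τ _ _ rfl (by omega)]
  simp only [smul_sub, smul_add, smul_smul, neg_smul, neg_mul, sgn_mul_self, one_smul,
    smul_neg]
  abel

/-- The terms g τ₂ f in the middle occur once from each factor, with opposite signs. -/
theorem twistD_comp {x y z : R.Obj} {p q n : ℤ} (τ₃ : R.Hom z z 1) (τ₂ : R.Hom y y 1)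
    (τ₁ : R.Hom x x 1) (g : R.Hom y z q) (f : R.Hom x y p) (h : q + p = n) :
    twistD τ₃ τ₁ (R.comp g f h) = R.comp (twistD τ₃ τ₂ g) f (by omega) +
      sgn k q • R.comp g (twistD τ₂ τ₁ f) (by omega) := by
  subst h
  simp only [twistD, R.leibniz, R.comp_add, R.comp_sub, R.add_comp, R.sub_comp, R.comp_smul,
    R.smul_comp, sgn_add]
  rw [R.assoc τ₃ g f _ _ rfl (by omega), R.assoc g τ₂ f rfl _ (add_comm 1 p) (by omega),
    R.assoc g f τ₁ _ _ rfl (by omega)]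
  simp only [smul_sub, smul_add, smul_smul]
  abel

/-- The dg category with given objects `O` and with morphisms in given submodules of those of `R`,
with the differential twisted by given Maurer–Cartan elements. -/
def twist (R : DGCat k) {O : Type u} (X : O → R.Obj) (τ : ∀ a, R.Hom (X a) (X a) 1)
    (hτ : ∀ a, R.d (τ a) + R.comp (τ a) (τ a) rfl = 0)
    (S : ∀ a b n, Submodule k (R.Hom (X a) (X b) n)) (hid : ∀ a, R.id (X a) ∈ S a a 0)
    (hcomp : ∀ {a b c : O} {p q n : ℤ} {g : R.Hom (X b) (X c) q} {f : R.Hom (X a) (X b) p}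
      (h : q + p = n), g ∈ S b c q → f ∈ S a b p → R.comp g f h ∈ S a c n)
    (hd : ∀ {a b : O} {n : ℤ} {f : R.Hom (X a) (X b) n}, f ∈ S a b n →
      twistD (τ b) (τ a) f ∈ S a b (n + 1)) : DGCat k where
  Obj := O
  Hom a b n := S a b n
  id a := ⟨R.id (X a), hid a⟩
  comp g f h := ⟨R.comp g.1 f.1 h, hcomp h g.2 f.2⟩
  d {a b _} f := ⟨twistD (τ b) (τ a) f.1, hd f.2⟩
  add_comp _ _ _ _ := Subtype.ext (R.add_comp ..)
  comp_add _ _ _ _ := Subtype.ext (R.comp_add ..)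
  smul_comp _ _ _ _ := Subtype.ext (R.smul_comp ..)
  comp_smul _ _ _ _ := Subtype.ext (R.comp_smul ..)
  id_comp _ _ := Subtype.ext (R.id_comp ..)
  comp_id _ _ := Subtype.ext (R.comp_id ..)
  assoc _ _ _ _ _ _ _ := Subtype.ext (R.assoc ..)
  d_add f f' := Subtype.ext <| by
    simp only [twistD, Submodule.coe_add, R.d_add, R.comp_add, R.add_comp, smul_add]; abel
  d_smul a f := Subtype.ext <| by
    simp only [twistD, Submodule.coe_smul, R.d_smul, R.comp_smul, R.smul_comp, smul_add, smul_sub,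
      smul_comm a]
  d_d f := Subtype.ext (twistD_twistD (hτ _) (hτ _) f.1)
  leibniz g f h := Subtype.ext (twistD_comp _ _ _ g.1 f.1 h)

end DGCat

/-! ## The dg category of dg functors and normalized Hochschild cochains -/

namespace RawCochain

variable {k : Type u} [CommRing k] {D A : DGCat k} {X Y : D.Obj → A.Obj} {p q n m : ℤ}

/-- The value on a chain of the cochain `RawCochain.ofFunctor`. -/
def ofFunctorApp (G : DGFunctorOver D A X) {x y : D.Obj} :
    Chain D x y q → 1 + q = n → A.Hom (X x) (X y) n
  | .nil _, _ => 0
  | .cons (p := p) g (.nil _) h, h' => A.reindex (show p = n by omega) (G.map g)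
  | .cons _ (.cons _ _ _) _, _ => 0

theorem ofFunctorApp_multilin (G : DGFunctorOver D A X) {x y : D.Obj} (h : 1 + q = n) :
    Chain.Multilin fun c : Chain D x y q => ofFunctorApp G c h := by
  intro c l H
  cases H with
  | head l c h' =>
    rename_i p _
    rw [wsum_map fun g => Chain.cons g c h']
    cases c with
    | nil _ =>
      obtain rfl : p = n := by omega
      exact G.map_wsum l fun g => g
    | cons g' c h'' => simp [ofFunctorApp]
  | @tail _ _ _ _ _ _ g c' _ h' H =>
    rw [wsum_map fun c => Chain.cons g c h']
    cases H with
    | head l c h => rw [wsum_map fun g => Chain.cons g c h]; simp [ofFunctorApp]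
    | tail g h H => rw [wsum_map fun c => Chain.cons g c h]; simp [ofFunctorApp]

/-- The cochain that is the given dg functor on chains of length one, and zero otherwise. -/
def ofFunctor (G : DGFunctorOver D A X) : RawCochain X X 1 :=
  mk (fun _ _ _ _ c h => ofFunctorApp G c h) (fun _ _ _ _ h => ofFunctorApp_multilin G h)

variable (G : DGFunctorOver D A X)

@[simp] theorem ofFunctor_nil (x : D.Obj) (h : 1 + 0 = n) :
    (ofFunctor G).app (.nil x) h = 0 := by subst h; rfl

@[simp] theorem ofFunctor_single {x y : D.Obj} (g : D.Hom x y p) (h : p - 1 + 0 = q)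
    (h' : 1 + q = p) : (ofFunctor G).app (.cons g (.nil y) h) h' = G.map g := by
  rw [ofFunctor, app_mk]; rfl

@[simp] theorem ofFunctor_cons_cons {x y z w : D.Obj} {r : ℤ} (g : D.Hom x y p) (g' : D.Hom y z q)
    (c : Chain D z w r) (h : q - 1 + r = m) {l : ℤ} (h' : p - 1 + m = l) (h'' : 1 + l = n) :
    (ofFunctor G).app (.cons g (.cons g' c h) h') h'' = 0 := by
  rw [ofFunctor, app_mk, ofFunctorApp]

theorem ofFunctor_comp {x y z : D.Obj} {r : ℤ} (g' : D.Hom y z q) (g : D.Hom x y p)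
    (h : q + p = r) (h' : r - 1 + 0 = m) (h'' : 1 + m = n) :
    (ofFunctor G).app (.cons (D.comp g' g h) (.nil z) h') h'' =
      A.comp (G.map g') (G.map g) (by omega) := by
  obtain rfl : r = n := by omega
  rw [ofFunctor_single, G.map_comp]

theorem comp_ofFunctor_single {x y : D.Obj} {w : A.Obj} (g : D.Hom x y p) (h : p - 1 + 0 = q)
    (h₁ : 1 + q = n) (f : A.Hom (X y) w r) (h' : r + n = m) :
    A.comp f ((ofFunctor G).app (.cons g (.nil y) h) h₁) h' = A.comp f (G.map g) (by omega) := by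
  obtain rfl : n = p := by omega
  rw [ofFunctor_single]

theorem ofFunctor_single_comp {x y : D.Obj} {w : A.Obj} (g : D.Hom x y p) (h : p - 1 + 0 = q)
    (h₁ : 1 + q = n) (f : A.Hom w (X x) r) (h' : n + r = m) :
    A.comp ((ofFunctor G).app (.cons g (.nil y) h) h₁) f h' = A.comp (G.map g) f (by omega) := by
  obtain rfl : n = p := by omega
  rw [ofFunctor_single]

/-- On chains of length one the equation is the compatibility of the dg functor with differentials,
on chains of length two that with compositions; on all other chains both summands vanish. The
compatibility with identities is used only for normalization. -/
theorem maurerCartan : delta (ofFunctor G) + cup (ofFunctor G) (ofFunctor G) rfl = 0 := by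
  ext x y q n c h
  obtain rfl : n = 1 + q + 1 := by omega
  rw [app_add, app_delta _ _ rfl, app_cup, app_zero]
  cases c with
  | nil x => simp [Chain.bar]
  | cons g c h' =>
    rename_i p r
    cases c with
    | nil _ =>
      obtain rfl : 1 + q = p := by omega
      simp [Chain.bar, G.map_d]
    | cons g' c h'' =>
      cases c with
      | nil _ =>
        simp only [Chain.wsum_bar_cons, Chain.mulHead_cons, Chain.mulHead_nil, Chain.wsum_bar_nil,
          Chain.wsum_cuts_cons, Chain.wsum_cuts_nil, ofFunctor_cons_cons, ofFunctor_nil,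
          DGCat.comp_zero, smul_zero, zero_add, add_zero, A.d_zero, sgn_one]
        rw [ofFunctor_single_comp, comp_ofFunctor_single, ofFunctor_comp]
        simp
      | cons g'' c h₃ => simp [Chain.wsum_bar_cons, Chain.mulHead_cons]

theorem id_comp_app (φ : RawCochain X Y p) {x y : D.Obj} (c : Chain D x y q) (h : p + q = m)
    (h' : 0 + m = n) : A.comp (A.id (Y y)) (φ.app c h) h' = φ.app c (by omega) := by
  obtain rfl : m = n := by omega
  exact A.id_comp _ _

theorem comp_id_app (φ : RawCochain X Y p) {x y : D.Obj} (c : Chain D x y q) (h : p + q = m)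
    (h' : m + 0 = n) : A.comp (φ.app c h) (A.id (X x)) h' = φ.app c (by omega) := by
  obtain rfl : m = n := by omega
  exact A.comp_id _ _

/-- Since `ofFunctor` is supported on chains of length one, only the cut after the first entry
contributes. In the mirror image `wsum_cuts_ofFunctor_comp` it is the cut before the last entry. -/
theorem wsum_cuts_comp_ofFunctor (G : DGFunctorOver D A X) (φ : RawCochain X Y p) {x y z : D.Obj}
    {r : ℤ} (g : D.Hom x y r) (c : Chain D y z q) (h : r - 1 + q = n) (h' : p + 1 + n = m) :
    (wsum (Chain.cons g c h).cuts fun s => sgn k (1 * s.q) •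
      A.comp (φ.app s.snd rfl) ((ofFunctor G).app s.fst rfl) (by have := s.h; omega)) =
    sgn k q • A.comp (φ.app c rfl) (G.map g) (by omega : p + q + r = m) := by
  rw [Chain.wsum_cuts_cons, Chain.wsum_cuts_of_fst]
  · rw [comp_ofFunctor_single]
    simp
  · intro w v p' q' r' m g a b h h'
    simp

theorem wsum_cuts_ofFunctor_comp (G : DGFunctorOver D A Y) (φ : RawCochain X Y p) {x y z : D.Obj}
    {r : ℤ} (c : Chain D x y q) (g : D.Hom y z r) (h : q + (r - 1) = n) (h' : 1 + p + n = m) :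
    (wsum (c.snoc g h).cuts fun s => sgn k (p * s.q) •
      A.comp ((ofFunctor G).app s.snd rfl) (φ.app s.fst rfl) (by have := s.h; omega)) =
    sgn k (p * (r - 1)) • A.comp (G.map g) (φ.app c rfl) (by omega : r + (p + q) = m) := by
  rw [Chain.wsum_cuts_snoc, Chain.wsum_cuts_of_snd]
  · simp only [Chain.snoc]
    rw [ofFunctor_single_comp]
    simp
  · intro w v p' q' r' m g a b h h'
    cases b <;> simp [Chain.snoc]

theorem app_twistD (φ : RawCochain X Y p) (G' : DGFunctorOver D A Y) (G : DGFunctorOver D A X)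
    {x y : D.Obj} (c : Chain D x y q) (h : p + q = n) (h' : p + 1 + q = n + 1) :
    app (DGCat.twistD (R := DGCat.raw D A) (ofFunctor G') (ofFunctor G) φ) c h' =
      A.d (φ.app c h) + sgn k p • (wsum c.bar fun c' => φ.app c' (by omega)) +
      (wsum c.cuts fun s => sgn k (p * s.q) •
        A.comp ((ofFunctor G').app s.snd rfl) (φ.app s.fst rfl) (by have := s.h; omega)) -
      sgn k p • wsum c.cuts fun s => sgn k (1 * s.q) •
        A.comp (φ.app s.snd rfl) ((ofFunctor G).app s.fst rfl) (by have := s.h; omega) := by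
  change (delta φ + cup (ofFunctor G') φ (add_comm 1 p) -
    sgn k p • cup φ (ofFunctor G) rfl).app c h' = _
  rw [app_sub, app_add, app_smul, app_cup, app_cup, app_delta _ _ h]

/-- A cochain is normalized if it vanishes on the chains that have an identity among their
entries. -/
def normalized (X Y : D.Obj → A.Obj) (p : ℤ) : Submodule k (RawCochain X Y p) where
  carrier := {φ | ∀ ⦃x y : D.Obj⦄ ⦃q n : ℤ⦄ ⦃c : Chain D x y q⦄ (h : p + q = n), c.HasId →
    φ.app c h = 0}
  add_mem' hφ hψ x y q n c h H := by rw [app_add, hφ h H, hψ h H, add_zero]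
  zero_mem' x y q n c h H := app_zero c h
  smul_mem' a φ hφ x y q n c h H := by rw [app_smul, hφ h H, smul_zero]

theorem one_mem_normalized (X : D.Obj → A.Obj) : one X ∈ normalized X X 0 := by
  intro x y q n c h H
  cases H <;> simp

theorem cup_mem_normalized {Z : D.Obj → A.Obj} {ψ : RawCochain Y Z q} {φ : RawCochain X Y p}
    (h : q + p = n) (hψ : ψ ∈ normalized Y Z q) (hφ : φ ∈ normalized X Y p) :
    cup ψ φ h ∈ normalized X Z n := by
  intro x y r m c h' H
  rw [app_cup]
  exact Chain.wsum_cuts_of_hasId H _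
    (fun s hs => by rw [hφ _ hs, DGCat.comp_zero, smul_zero])
    (fun s hs => by rw [hψ _ hs, DGCat.zero_comp, smul_zero])

/-- An identity inside a chain is absorbed by its two neighbours with opposite signs. At an end of
the chain the missing neighbour is replaced by an outer term G'(id) ∘ φ or φ ∘ G(id), which has the
required value because dg functors preserve identities. -/
theorem twistD_mem_normalized {X Y : D.Obj → A.Obj} (G' : DGFunctorOver D A Y)
    (G : DGFunctorOver D A X) {φ : RawCochain X Y p} (hφ : φ ∈ normalized X Y p) :
    DGCat.twistD (R := DGCat.raw D A) (ofFunctor G') (ofFunctor G) φ ∈ normalized X Y (p + 1) := by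
  intro x y q n c h H
  obtain rfl : n = p + q + 1 := by omega
  rw [app_twistD _ _ _ _ rfl, hφ rfl H, A.d_zero, zero_add]
  -- The end term is the outer term that composes with the value of `G'` on the last entry.
  have key : Chain.RemovesLast (n := q) (x := x) (z := y)
      (fun c => sgn k p • φ.app c (show p + (q + 1) = p + q + 1 by omega))
      (fun s => sgn k (p * s.q) • A.comp ((ofFunctor G').app s.snd rfl) (φ.app s.fst rfl)
        (show _ = p + q + 1 by have := s.h; omega)) :=
    { hasId := fun s hs => by rw [hφ _ hs, DGCat.comp_zero, smul_zero]
      nil := fun c hq h => by subst hq; simp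
      single := fun c q h h' => by
        obtain rfl : q = -1 := by omega
        rw [ofFunctor_single_comp, G'.map_id, sgn_congr (k := k) (n := p) ⟨-p, by ring⟩]
        rw [id_comp_app]
      cons_cons := fun a g g' c h h' h'' => by simp }
  have hF : Chain.Multilin fun c : Chain D x y (q + 1) =>
      sgn k p • φ.app c (show p + (q + 1) = p + q + 1 by omega) := (φ.multilin _ _ _).smul _
  have hF' : ∀ c : Chain D x y (q + 1), c.HasId →
      sgn k p • φ.app c (show p + (q + 1) = p + q + 1 by omega) = 0 :=
    fun c hc => by rw [hφ _ hc, smul_zero]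
  rw [← wsum_smul]
  -- If the identity comes first, what the bar differential leaves is cancelled by φ ∘ G(id).
  -- Otherwise the bar terms and the end term cancel among themselves, and the outer term at the
  -- beginning vanishes because φ is still applied to a chain with an identity.
  cases H with
  | head c h' =>
    rename_i q'
    obtain rfl : q' = q + 1 := by omega
    rw [key.wsum_cons_id hF hF' c rfl h', wsum_cuts_comp_ofFunctor (h' := by omega), G.map_id,
      comp_id_app, smul_comm, sub_self]
  | tail g h' H =>
    rw [key.wsum_cons_of_hasId hF hF' g H, wsum_cuts_comp_ofFunctor (h' := by omega), hφ _ H]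
    simp

end RawCochain

/-- The dg category of dg functors from `D` to `A` and normalized Hochschild cochains. -/
def DGCat.coh {k : Type u} [CommRing k] (D A : DGCat k) : DGCat k :=
  (DGCat.raw D A).twist (O := DGFunctor D A) (fun G => G.obj)
    (fun G => RawCochain.ofFunctor G.toOver) (fun G => RawCochain.maurerCartan G.toOver)
    (fun G G' p => RawCochain.normalized G.obj G'.obj p)
    (fun G => RawCochain.one_mem_normalized G.obj) RawCochain.cup_mem_normalized
    (RawCochain.twistD_mem_normalized _ _)

namespace DGCat.coh

variable {k : Type u} [CommRing k] {D A : DGCat k} {p q n m : ℤ}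

/-- A dg functor as an object of `DGCat.coh`. -/
abbrev of (G : DGFunctor D A) : (coh D A).Obj := G

/-- An object of `DGCat.coh` as a dg functor. -/
abbrev fn (G : (coh D A).Obj) : DGFunctor D A := G

variable {G G' G'' : (coh D A).Obj}

/-- The value of a normalized cochain on a chain. -/
def app (φ : (coh D A).Hom G G' p) {x y : D.Obj} (c : Chain D x y q) (h : p + q = n) :
    A.Hom ((fn G).obj x) ((fn G').obj y) n := RawCochain.app φ.1 c h

theorem ext {φ ψ : (coh D A).Hom G G' p} (H : ∀ {x y : D.Obj} {q n : ℤ} (c : Chain D x y q)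
    (h : p + q = n), app φ c h = app ψ c h) : φ = ψ :=
  Subtype.ext <| RawCochain.ext fun c h => H c h

/-- A normalized cochain from its values. -/
def mk (f : ∀ (x y : D.Obj) (q n : ℤ), Chain D x y q → p + q = n → A.Hom
    ((fn G).obj x) ((fn G').obj y) n)
    (hf : ∀ x y q n h, Chain.Multilin fun c => f x y q n c h)
    (hf' : ∀ x y q n c h, c.HasId → f x y q n c h = 0) : (coh D A).Hom G G' p :=
  ⟨RawCochain.mk f hf, fun _ _ _ _ _ h H => (RawCochain.app_mk f hf _ h).trans (hf' _ _ _ _ _ h H)⟩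

theorem app_mk (f : ∀ (x y : D.Obj) (q n : ℤ), Chain D x y q → p + q = n →
      A.Hom ((fn G).obj x) ((fn G').obj y) n)
    (hf : ∀ x y q n h, Chain.Multilin fun c => f x y q n c h)
    (hf' : ∀ x y q n c h, c.HasId → f x y q n c h = 0) {x y : D.Obj} (c : Chain D x y q)
    (h : p + q = n) : app (mk f hf hf' : (coh D A).Hom G G' p) c h = f x y q n c h :=
  RawCochain.app_mk f hf c h

theorem multilin (φ : (coh D A).Hom G G' p) (x y : D.Obj) (h : p + q = n) :
    Chain.Multilin fun c : Chain D x y q => app φ c h := RawCochain.multilin φ.1 x y h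

theorem app_hasId (φ : (coh D A).Hom G G' p) {x y : D.Obj} {c : Chain D x y q} (h : p + q = n)
    (H : c.HasId) : app φ c h = 0 := φ.2 h H

@[simp] theorem app_add (φ ψ : (coh D A).Hom G G' p) {x y : D.Obj} (c : Chain D x y q)
    (h : p + q = n) : app (φ + ψ) c h = app φ c h + app ψ c h := RawCochain.app_add φ.1 ψ.1 c h

@[simp] theorem app_smul (a : k) (φ : (coh D A).Hom G G' p) {x y : D.Obj} (c : Chain D x y q)
    (h : p + q = n) : app (a • φ) c h = a • app φ c h := RawCochain.app_smul a φ.1 c h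

/-- The evaluation of normalized cochains on a chain, as a linear map. -/
def appLin (G G' : (coh D A).Obj) {x y : D.Obj} (c : Chain D x y q) (h : p + q = n) :
    (coh D A).Hom G G' p →ₗ[k] A.Hom ((fn G).obj x) ((fn G').obj y) n where
  toFun φ := app φ c h
  map_add' φ ψ := app_add φ ψ c h
  map_smul' a φ := app_smul a φ c h

@[simp] theorem app_zero {x y : D.Obj} (c : Chain D x y q) (h : p + q = n) :
    app (0 : (coh D A).Hom G G' p) c h = 0 := map_zero (appLin G G' c h)

@[simp] theorem app_sub (φ ψ : (coh D A).Hom G G' p) {x y : D.Obj} (c : Chain D x y q)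
    (h : p + q = n) : app (φ - ψ) c h = app φ c h - app ψ c h := map_sub (appLin G G' c h) φ ψ

theorem app_wsum {ι : Type*} (l : List (k × ι)) (φ : ι → (coh D A).Hom G G' p) {x y : D.Obj}
    (c : Chain D x y q) (h : p + q = n) : app (wsum l φ) c h = wsum l fun i => app (φ i) c h :=
  map_wsum (appLin G G' c h) l φ

@[simp] theorem app_id_nil (x : D.Obj) (h : (0 : ℤ) + 0 = 0) :
    app ((coh D A).id G) (.nil x) h = A.id ((fn G).obj x) := rfl

@[simp] theorem app_id_cons {x y z : D.Obj} (g : D.Hom x y p) (c : Chain D y z q)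
    (h : p - 1 + q = m) (h' : 0 + m = n) : app ((coh D A).id G) (.cons g c h) h' = 0 :=
  RawCochain.one_cons g c h h'

theorem app_comp {r : ℤ} (ψ : (coh D A).Hom G' G'' q) (φ : (coh D A).Hom G G' p) (h : q + p = n)
    {x y : D.Obj} (c : Chain D x y r) (h' : n + r = m) :
    app ((coh D A).comp ψ φ h) c h' = wsum c.cuts fun s => sgn k (p * s.q) •
      A.comp (app ψ s.snd rfl) (app φ s.fst rfl) (by have := s.h; omega) :=
  RawCochain.app_cup ψ.1 φ.1 h c h'

theorem app_d (φ : (coh D A).Hom G G' p) {x y : D.Obj} (c : Chain D x y q) (h : p + q = n)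
    (h' : p + 1 + q = n + 1) : app ((coh D A).d φ) c h' =
      A.d (app φ c h) + sgn k p • (wsum c.bar fun c' => app φ c' (by omega)) +
      (wsum c.cuts fun s => sgn k (p * s.q) •
        A.comp ((RawCochain.ofFunctor (fn G').toOver).app s.snd rfl) (app φ s.fst rfl)
          (by have := s.h; omega)) -
      sgn k p • wsum c.cuts fun s => sgn k (1 * s.q) •
        A.comp (app φ s.snd rfl) ((RawCochain.ofFunctor (fn G).toOver).app s.fst rfl)
          (by have := s.h; omega) := by
  exact RawCochain.app_twistD φ.1 (fn G').toOver (fn G).toOver c h h'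

theorem comp_app_left (ψ : (coh D A).Hom G G' q) {x y : D.Obj} {w : A.Obj} {r : ℤ}
    (c : Chain D x y r) {n m l : ℤ} (h : q + r = n) (f : A.Hom w ((fn G).obj x) m)
    (h' : n + m = l) :
    A.comp (app ψ c h) f h' = A.comp (app ψ c rfl) f (by omega) := by subst h; rfl

theorem comp_app_right (ψ : (coh D A).Hom G G' q) {x y : D.Obj} {w : A.Obj} {r : ℤ}
    (c : Chain D x y r) {n m l : ℤ} (h : q + r = n) (f : A.Hom ((fn G').obj y) w m)
    (h' : m + n = l) :
    A.comp f (app ψ c h) h' = A.comp f (app ψ c rfl) (by omega) := by subst h; rfl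

end DGCat.coh

/-! ## Values of the differential of a normalized cochain -/

namespace Chain

variable {k : Type u} [CommRing k] {D : DGCat k}

/-- `bar` interleaves differentials and products, as suits recursion. The defining relations of the
twisted tensor product list them separately. -/
theorem wsum_bar_eq {M : Type*} [AddCommGroup M] [Module k M] {x y : D.Obj} {n : ℤ}
    (c : Chain D x y n) (F : Chain D x y (n + 1) → M) :
    wsum c.bar F = (c.dTerms.map fun t => sgn k t.1 • F t.2).sum +
      (c.compTerms.map fun t => sgn k t.1 • F t.2).sum := by
  induction c with
  | nil x => simp only [dTerms, compTerms, wsum_bar_nil, List.map_nil, List.sum_nil, add_zero]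
  | cons g c h ih =>
    rw [wsum_bar_cons, ih]
    cases c with
    | nil x => simp [dTerms, compTerms, mulHead]
    | cons g' c h' =>
      simp only [dTerms, compTerms, mulHead, List.map_cons, List.sum_cons, List.map_map,
        Function.comp_def, smul_add]
      abel

theorem exists_eq_snoc {x y z : D.Obj} {p q n : ℤ} (g : D.Hom x y p) (c : Chain D y z q)
    (h : p - 1 + q = n) : ∃ (w : D.Obj) (r s : ℤ) (c' : Chain D x w r) (g' : D.Hom w z s)
      (h' : r + (s - 1) = n), cons g c h = c'.snoc g' h' := by
  induction c generalizing x p n with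
  | nil y => exact ⟨_, _, _, .nil x, g, by omega, rfl⟩
  | cons g₁ c h₁ ih =>
    obtain ⟨w, r, s, c', g', h', e⟩ := ih g₁ h₁
    exact ⟨w, _, s, .cons g c' rfl, g', by omega, by subst h'; rw [e]; rfl⟩

theorem cons_snoc {x y z w : D.Obj} {p q r i j n : ℤ} (g : D.Hom x y p) (c : Chain D y z q)
    (g' : D.Hom z w r) (hj : q + (r - 1) = j) (h : p - 1 + j = n) (hi : p - 1 + q = i)
    (h' : i + (r - 1) = n) : cons g (c.snoc g' hj) h = (cons g c hi).snoc g' h' := by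
  subst hj; rfl

/-- A case distinction for chains: the empty chain, the chains of length one, and those of length at
least two. -/
theorem cases_ends {motive : ∀ {x y : D.Obj} {n : ℤ}, Chain D x y n → Prop}
    (nil : ∀ x, motive (.nil x))
    (single : ∀ {x y : D.Obj} {p : ℤ} (g : D.Hom x y p), motive (.single g))
    (ends : ∀ {x x₁ y₁ y : D.Obj} {q₁ q q' j m : ℤ} (g₁ : D.Hom x x₁ q₁) (c : Chain D x₁ y₁ q)
      (g' : D.Hom y₁ y q') (hj : q + (q' - 1) = j) (hm : q₁ - 1 + j = m),
      motive (.cons g₁ (c.snoc g' hj) hm)) {x y : D.Obj} {n : ℤ} (c : Chain D x y n) :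
    motive c := by
  cases c with
  | nil x => exact nil x
  | cons g c h =>
    cases c with
    | nil y =>
      rename_i p
      obtain rfl : n = p - 1 := by omega
      exact single g
    | cons g' c h' =>
      obtain ⟨w, r, s, c', g'', h'', e⟩ := exists_eq_snoc g' c h'
      rw [e]; exact ends g c' g'' h'' h

end Chain

namespace DGCat.coh

variable {k : Type u} [CommRing k] {D A : DGCat k} {G G' : (coh D A).Obj} {p n : ℤ}
  (φ : (coh D A).Hom G G' p)

theorem app_d_nil (x : D.Obj) (h : p + 0 = n) (h' : p + 1 + 0 = n + 1) :
    app ((coh D A).d φ) (.nil x) h' = A.d (app φ (.nil x) h) := by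
  rw [app_d φ _ h]
  simp only [Chain.wsum_bar_nil, Chain.wsum_cuts_nil, RawCochain.ofFunctor_nil, zero_comp,
    comp_zero,
    smul_zero, add_zero, sub_zero]

/-- The chain is given from both ends because one outer term involves its first entry and the other
its last. The result has the shape of the relation `Twisted.Rel.d_eps`. -/
theorem app_d_snoc {x x₁ y₁ y : D.Obj} {q₁ q' i j m : ℤ} (g₁ : D.Hom x x₁ q₁)
    (c₁ : Chain D x₁ y j) (c₂ : Chain D x y₁ i) (g' : D.Hom y₁ y q') (hm : q₁ - 1 + j = m)
    (hi : i + (q' - 1) = m) (e : Chain.cons g₁ c₁ hm = c₂.snoc g' hi) (h : p + m = n)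
    (h' : p + 1 + m = n + 1) :
    app ((coh D A).d φ) (.cons g₁ c₁ hm) h' = A.d (app φ (.cons g₁ c₁ hm) h) +
      (((Chain.cons g₁ c₁ hm).dTerms.map fun t => sgn k (p + t.1) • app φ t.2 (by omega)).sum +
      (sgn k (p * q' + p) • A.comp ((fn G').toOver.map g') (app φ c₂ rfl) (by omega) +
      (sgn k (p + j + 1) • A.comp (app φ c₁ rfl) ((fn G).toOver.map g₁) (by omega) +
      ((Chain.cons g₁ c₁ hm).compTerms.map fun t =>
        sgn k (p + t.1) • app φ t.2 (by omega)).sum))) := by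
  rw [app_d φ _ h, Chain.wsum_bar_eq]
  have h₁ := RawCochain.wsum_cuts_comp_ofFunctor (fn G).toOver φ.1 g₁ c₁ hm
    (show p + 1 + m = n + 1 by omega)
  have h₂ := RawCochain.wsum_cuts_ofFunctor_comp (fn G').toOver φ.1 c₂ g' hi
    (show 1 + p + m = n + 1 by omega)
  rw [← e] at h₂
  unfold app
  rw [h₁, h₂]
  have e₁ : sgn k (p * (q' - 1)) = sgn k (p * q' + p) := sgn_congr ⟨-p, by ring⟩
  have e₂ : sgn k (p + j + 1) = -(sgn k p * sgn k j) := by rw [sgn_add_one, sgn_add]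
  simp only [sgn_add p, e₁, e₂, mul_smul, smul_add, List.smul_sum, List.map_map, Function.comp_def,
    neg_smul]
  abel

theorem app_cons_congr {x y z : D.Obj} {q r m m' : ℤ} (g : D.Hom x y q) (c : Chain D y z r)
    (h₁ : q - 1 + r = m) (h₂ : p + m = n) (h₁' : q - 1 + r = m') (h₂' : p + m' = n) :
    app φ (.cons g c h₁) h₂ = app φ (.cons g c h₁') h₂' := by
  subst h₁ h₁'; rfl

theorem app_d_single {x y : D.Obj} {q : ℤ} (g : D.Hom x y q) (h : p + (q - 1) = n)
    (h' : p + 1 + (q - 1) = n + 1) :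
    app ((coh D A).d φ) (.single g) h' = A.d (app φ (.single g) h) +
      (sgn k p • app φ (.single (D.d g)) (by omega) +
      (sgn k (p * q + p) • A.comp ((fn G').toOver.map g) (app φ (.nil x) (Int.add_zero p))
        (by omega) +
      sgn k (p + 1) • A.comp (app φ (.nil y) (Int.add_zero p)) ((fn G).toOver.map g)
        (by omega))) := by
  have := app_d_snoc φ g (.nil y) (.nil x) g (Int.add_zero _) (zero_add _) rfl h h'
  rw [comp_app_left φ _ (Int.add_zero p), comp_app_right φ _ (Int.add_zero p)]
  simp only [Chain.dTerms, Chain.compTerms, List.map_cons, List.map_nil, List.sum_cons,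
    List.sum_nil, add_zero] at this
  rw [app_cons_congr φ (D.d g) _ _ _ (Int.add_zero _)] at this
  exact this

end DGCat.coh

/-! ## The universal property of the twisted tensor product -/

namespace Twisted

variable {k : Type u} [CommRing k] {C D A : DGCat k}

/-- An expression as a morphism of the twisted tensor product. -/
def mor {x y : (C.twisted D).Obj} {n : ℤ} (s : Expr C D x y n) : (C.twisted D).Hom x y n := Mor.mk s

theorem mor_sum {x y : (C.twisted D).Obj} {n : ℤ} (l : List (Expr C D x y n)) :
    mor (Expr.sum l) = (l.map mor).sum := by
  induction l with
  | nil => rfl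
  | cons s l ih =>
    rw [List.map_cons, List.sum_cons, ← ih]; rfl

/-- The dg functor `id_c ⊗ -`. -/
def rightOver (D : DGCat k) (c : C.Obj) : DGFunctorOver D (C.twisted D) (pt c) where
  map g := right c g
  map_add g g' := Mor.sound (.right_add c g g')
  map_smul a g := Mor.sound (.right_smul c a g)
  map_id x := Mor.sound (.right_id c x)
  map_comp g f h := Mor.sound (.right_comp c g f h)
  map_d g := Mor.sound (.right_d c g)

theorem eps_multilin {a b : C.Obj} {p q n : ℤ} (f : C.Hom a b p) (x y : D.Obj) (h : p + q = n) :
    Chain.Multilin fun c : Chain D x y q => eps f c h :=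
  .of_isAdd_of_isSMul (fun H => Mor.sound (.eps_chain_add f h H))
    fun H => Mor.sound (.eps_chain_smul _ f h H)

theorem eps_hasId {a b : C.Obj} {p q n : ℤ} (f : C.Hom a b p) {x y : D.Obj} {c : Chain D x y q}
    (h : p + q = n) (H : c.HasId) : eps f c h = 0 := Mor.sound (.eps_hasId f h H)

/-- The cochain `ε(f; -)`. -/
def epsHom (D : DGCat k) {a b : C.Obj} {p : ℤ} (f : C.Hom a b p) :
    (DGCat.coh D (C.twisted D)).Hom (DGCat.coh.of ⟨_, rightOver D a⟩)
      (DGCat.coh.of ⟨_, rightOver D b⟩) p :=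
  DGCat.coh.mk (fun _ _ _ _ c h => eps f c h) (fun _ _ _ _ h => eps_multilin f _ _ h)
    fun _ _ _ _ _ h H => eps_hasId f h H

theorem app_epsHom {a b : C.Obj} {p q n : ℤ} (f : C.Hom a b p) {x y : D.Obj} (c : Chain D x y q)
    (h : p + q = n) : DGCat.coh.app (epsHom D f) c h = eps f c h :=
  DGCat.coh.app_mk _ _ _ _ _

theorem eps_comp {a b e : C.Obj} {x y : D.Obj} {p₁ p₂ p q n : ℤ} (f₂ : C.Hom b e p₂)
    (f₁ : C.Hom a b p₁) (hp : p₂ + p₁ = p) (c : Chain D x y q) (h : p + q = n) :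
    eps (C.comp f₂ f₁ hp) c h = wsum c.cuts fun s => sgn k (p₁ * s.q) •
      (C.twisted D).comp (eps f₂ s.snd rfl) (eps f₁ s.fst rfl) (by have := s.h; omega) := by
  rw [Chain.cuts, wsum_unweighted]
  refine (Mor.sound (.eps_comp f₂ f₁ hp c h)).trans ((mor_sum _).trans ?_)
  rw [List.map_map]
  rfl

/-- The dg functor `C → Coh(D, C ⊗ D)` that is given by `f ↦ ε(f; -)`. -/
def etaOver (C D : DGCat k) : DGFunctorOver C (DGCat.coh D (C.twisted D))
    (fun a => DGCat.coh.of ⟨_, rightOver D a⟩) where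
  map f := epsHom D f
  map_add f f' := DGCat.coh.ext fun c h => by
    simp only [DGCat.coh.app_add, app_epsHom]
    exact Mor.sound (.eps_add f f' c h)
  map_smul a f := DGCat.coh.ext fun c h => by
    simp only [DGCat.coh.app_smul, app_epsHom]
    exact Mor.sound (.eps_smul a f c h)
  map_id a := DGCat.coh.ext fun c h => by
    rw [app_epsHom]
    cases c with
    | nil x => subst h; exact Mor.sound (.eps_id_nil a _)
    | cons g c h' =>
      rw [DGCat.coh.app_id_cons]
      exact Mor.sound (.eps_id_cons a g c h' h)
  map_comp f₂ f₁ h := DGCat.coh.ext fun c h' => by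
    rw [app_epsHom, eps_comp, DGCat.coh.app_comp]
    rfl
  map_d {_ _ p} f := DGCat.coh.ext fun {x y q n} c h => by
    obtain ⟨n, rfl⟩ : ∃ m, n = m + 1 := ⟨n - 1, by omega⟩
    rw [app_epsHom]
    -- The relations give the differential of ε(f; …) separately for chains of length zero, one, and
    -- at least two.
    induction c using Chain.cases_ends with
    | nil x =>
      rw [DGCat.coh.app_d_nil _ _ (by omega), app_epsHom]
      exact Mor.sound (.d_eps_nil x f _)
    | single g =>
      rw [DGCat.coh.app_d_single _ _ (by omega)]
      simp only [app_epsHom]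
      exact Mor.sound (.d_eps_single f g (by omega))
    | @ends z _ _ w _ _ _ _ m g₁ c g' hj hm =>
      rw [DGCat.coh.app_d_snoc (epsHom D f) g₁ (c.snoc g' hj) (.cons g₁ c rfl) g' hm (by omega)
        (Chain.cons_snoc ..) (by omega)]
      simp only [app_epsHom]
      have key : ∀ l : List (ℤ × Chain D z w (m + 1)),
          (l.map fun t => sgn k (p + t.1) • eps f t.2 (by omega : _ = n + 1)).sum =
            mor (Expr.sum (l.map fun t => .smul (sgn k (p + t.1)) (.eps f t.2 (by omega)))) :=
        fun l => by refine Eq.trans ?_ (mor_sum _).symm; rw [List.map_map]; rfl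
      rw [key, key]
      exact Mor.sound (.d_eps f g₁ c g' rfl hj hm (by omega))

/-! ### From dg functors C → Coh(D, A) to dg functors C ⊗ D → A. -/

section Uncurry

open DGCat.coh

variable {o : C.Obj → (DGCat.coh D A).Obj} (Φ : DGFunctorOver C (DGCat.coh D A) o)

/-- The morphism that an expression represents under the interpretation of the generators by
`Φ`. -/
def Expr.eval {x y : C.Obj × D.Obj} {n : ℤ} :
    Expr C D x y n → A.Hom ((fn (o x.1)).obj x.2) ((fn (o y.1)).obj y.2) n
  | .right c g => (fn (o c)).toOver.map g
  | .eps f c h => app (Φ.map f) c h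
  | .id x => A.id _
  | .comp t s h => A.comp t.eval s.eval h
  | .d s => A.d s.eval
  | .zero => 0
  | .add s t => s.eval + t.eval
  | .neg s => -s.eval
  | .smul a s => a • s.eval

theorem Expr.eval_sum {x y : C.Obj × D.Obj} {n : ℤ} (l : List (Expr C D x y n)) :
    (Expr.sum l).eval Φ = (l.map (Expr.eval Φ)).sum := by
  induction l with
  | nil => rfl
  | cons s l ih =>
    rw [List.map_cons, List.sum_cons, ← ih]; rfl

/-- Each relation is an axiom of the dg category A, or the functoriality of some `o c`, or the
normalization or multilinearity of a cochain, or a dg functor axiom of `Φ` evaluated on one chain.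
-/
theorem Expr.eval_congr {x y : C.Obj × D.Obj} {n : ℤ} {s t : Expr C D x y n} (H : Rel C D s t) :
    s.eval Φ = t.eval Φ := by
  induction H with
  | refl s => rfl
  | symm _ ih => exact ih.symm
  | trans _ _ ih₁ ih₂ => exact ih₁.trans ih₂
  | comp_congr h _ _ ih₁ ih₂ => simp only [Expr.eval, ih₁, ih₂]
  | d_congr _ ih => simp only [Expr.eval, ih]
  | add_congr _ _ ih₁ ih₂ => simp only [Expr.eval, ih₁, ih₂]
  | neg_congr _ ih => simp only [Expr.eval, ih]
  | smul_congr a _ ih => simp only [Expr.eval, ih]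
  | add_assoc r s t => exact add_assoc _ _ _
  | add_comm s t => exact add_comm _ _
  | zero_add s => exact zero_add _
  | neg_add s => exact neg_add_cancel _
  | smul_add a s t => exact smul_add _ _ _
  | add_smul a b s => exact add_smul _ _ _
  | mul_smul a b s => exact mul_smul _ _ _
  | one_smul s => exact one_smul _ _
  | add_comp t t' s h => exact A.add_comp _ _ _ h
  | comp_add t s s' h => exact A.comp_add _ _ _ h
  | smul_comp a t s h => exact A.smul_comp _ _ _ h
  | comp_smul a t s h => exact A.comp_smul _ _ _ h
  | id_comp s h => exact A.id_comp _ h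
  | comp_id s h => exact A.comp_id _ h
  | assoc t s v h₁ h₂ h₃ h₄ => exact A.assoc _ _ _ h₁ h₂ h₃ h₄
  | d_add s t => exact A.d_add _ _
  | d_smul a s => exact A.d_smul _ _
  | d_d s => exact A.d_d _
  | leibniz t s h => exact A.leibniz _ _ h
  | right_add c g g' => exact (fn (o c)).toOver.map_add _ _
  | right_smul c a g => exact (fn (o c)).toOver.map_smul _ _
  | right_id c x => exact (fn (o c)).toOver.map_id _
  | right_comp c g₂ g₁ h => exact (fn (o c)).toOver.map_comp _ _ h
  | right_d c g => exact (fn (o c)).toOver.map_d _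
  | eps_add f f' c h => simp only [Expr.eval, Φ.map_add, app_add]
  | eps_smul r f c h => simp only [Expr.eval, Φ.map_smul, app_smul]
  | eps_chain_add f h H => exact (multilin (Φ.map f) _ _ h).isAdd H
  | eps_chain_smul r f h H => exact (multilin (Φ.map f) _ _ h).isSMul H
  | eps_id_nil a x => simp only [Expr.eval, Φ.map_id]; rfl
  | eps_id_cons a g c hc h => simp only [Expr.eval, Φ.map_id, app_id_cons]
  | eps_hasId f h H => exact app_hasId _ h H
  | eps_comp f₂ f₁ hp c h =>
    simp only [Expr.eval_sum, Expr.eval, Φ.map_comp, app_comp, Chain.cuts, wsum_unweighted,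
      List.map_map]
    rfl
  | d_eps_nil x f h => simp only [Expr.eval, Φ.map_d, app_d_nil _ _ h]
  | d_eps_single f g h => simp only [Expr.eval, Φ.map_d, app_d_single _ _ h]
  | d_eps f g₁ c g' hi hj hm h =>
    simp only [Expr.eval, Φ.map_d, Expr.eval_sum, List.map_map]
    exact app_d_snoc (Φ.map f) g₁ (c.snoc g' hj) (.cons g₁ c hi) g' hm (by omega)
      (Chain.cons_snoc ..) h _

/-- The dg functor on the twisted tensor product `C ⊗ D` that corresponds to a dg functor from
`C` to `Coh(D, A)`. -/
def uncurry : DGFunctorOver (C.twisted D) A (fun x => (fn (o x.1)).obj x.2) where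
  map s := Quotient.lift (Expr.eval Φ) (fun _ _ h => Expr.eval_congr Φ h) s
  map_add s t := by
    induction t using Mor.ind; induction s using Mor.ind; rfl
  map_smul a s := by
    induction s using Mor.ind; rfl
  map_id _ := rfl
  map_comp t s h := by
    induction t using Mor.ind; induction s using Mor.ind; rfl
  map_d s := by
    induction s using Mor.ind; rfl

end Uncurry

end Twisted

/-! ## Sums over the insertions of one chain into another -/

theorem wsum_flatMap {k : Type u} [CommRing k] {ι κ M : Type*} [AddCommGroup M] [Module k M]
    (l : List κ) (f : κ → List (k × ι)) (F : ι → M) :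
    wsum (l.flatMap f) F = (l.map fun i => wsum (f i) F).sum := by
  induction l with
  | nil => rfl
  | cons i l ih => rw [List.flatMap_cons, wsum_append, ih, List.map_cons, List.sum_cons]

theorem wsum_map_mul {k : Type u} [CommRing k] {ι κ M : Type*} [AddCommGroup M] [Module k M]
    (a : k) (f : κ → ι) (l : List (k × κ)) (F : ι → M) :
    wsum (l.map fun w => (a * w.1, f w.2)) F = a • wsum l fun i => F (f i) := by
  induction l with
  | nil => simp
  | cons w l ih => simp only [List.map_cons, wsum_cons, ih, smul_add, mul_smul]

namespace Twisted

open Chain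

variable {k : Type u} [CommRing k] {D E : DGCat k} {M : Type*} [AddCommGroup M] [Module k M]
  {x y : D.Obj} {e e' : E.Obj} {m n N : ℤ}

/-- The sum of the values of `F` over the insertions of the chain `gs` into the chain `hs`. -/
def ins (gs : Chain D x y m) (hs : Chain E e e' n) (h : m + n = N)
    (F : Chain (D.twisted E) (pt x e) (pt y e') N → M) : M := wsum (insertions gs hs h) F

/-- The part of `ins` where the first entry is of the form `ε(g; h₁, …, h_j)`. -/
def insEps (gs : Chain D x y m) (hs : Chain E e e' n) (h : m + n = N)
    (F : Chain (D.twisted E) (pt x e) (pt y e') N → M) : M :=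
  match gs with
  | .nil _ => 0
  | .cons (p := p) g gs _ => wsum hs.cuts fun t => sgn k ((p - 1) * t.q) •
      ins gs t.snd rfl fun w => F (.cons (eps g t.fst rfl) w (by have := t.h; omega))

/-- The part of `ins` where the first entry is of the form `id ⊗ h₁`. -/
def insRight (gs : Chain D x y m) (hs : Chain E e e' n) (h : m + n = N)
    (F : Chain (D.twisted E) (pt x e) (pt y e') N → M) : M :=
  match hs with
  | .nil _ => 0
  | .cons e hs _ => ins gs hs rfl fun w => F (.cons (right x e) w (by omega))

theorem prependRight_nil_cons {d : D.Obj} {z z' : (D.twisted E).Obj} {p q : ℤ}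
    (a : (D.twisted E).Hom (pt d e) z' p) (w : Chain (D.twisted E) z' z q) (h₁ : p - 1 + q = n)
    (h : 0 + n = N) :
    prependRight d (.nil e) (.cons a w h₁) h = .cons a w (by omega) := by
  obtain rfl : n = N := by omega
  rfl

theorem prependRight_cons {d : D.Obj} {e₁ : E.Obj} {z : (D.twisted E).Obj} {p q r l : ℤ}
    (a : E.Hom e e₁ p) (c : Chain E e₁ e' q) (h' : p - 1 + q = n)
    (w : Chain (D.twisted E) (pt d e') z r) (h : n + r = N) (hl : q + r = l) :
    prependRight d (.cons a c h') w h =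
      .cons (right d a) (prependRight d c w hl) (by omega) := by
  subst hl; rfl

theorem ins_nil_nil (F : Chain (D.twisted E) (pt x e) (pt x e) 0 → M) (h : (0 : ℤ) + 0 = 0) :
    ins (.nil x) (.nil e) h F = F (.nil _) := by
  change (1 : k) • F (.nil _) + 0 = _
  simp

theorem ins_nil_left {e₁ : E.Obj} {p q : ℤ} (a : E.Hom e e₁ p) (hs : Chain E e₁ e' q)
    (h' : p - 1 + q = n) (h : 0 + n = N)
    (F : Chain (D.twisted E) (pt x e) (pt x e') N → M) :
    ins (.nil x) (.cons a hs h') h F = insRight (.nil x) (.cons a hs h') h F := by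
  simp only [insRight, ins, insertions, wsum_cons, wsum_nil, one_smul, add_zero]
  exact congrArg F (prependRight_cons ..)

/-- The first entry of an insertion is ε(g₁; h₁, …, h_j) if i₁ = 0, and id ⊗ h₁ if i₁ > 0. All
inductions over insertions rest on this recursion: one part shortens the first chain, the other the
second. -/
theorem ins_cons_left {x₁ : D.Obj} {p q : ℤ} (g : D.Hom x x₁ p) (gs : Chain D x₁ y q)
    (hs : Chain E e e' n) (h' : p - 1 + q = m) (h : m + n = N)
    (F : Chain (D.twisted E) (pt x e) (pt y e') N → M) :
    ins (.cons g gs h') hs h F =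
      insEps (.cons g gs h') hs h F + insRight (.cons g gs h') hs h F := by
  -- `insertions` cuts the second chain twice, at i₁ and at j₁.
  have key : ∀ {e : E.Obj} {n N : ℤ} (hs : Chain E e e' n) (h : m + n = N)
      (F : Chain (D.twisted E) (pt x e) (pt y e') N → M), ins (.cons g gs h') hs h F =
        wsum hs.cuts fun s => wsum s.snd.cuts fun t => sgn k ((p - 1) * t.q) •
          ins gs t.snd rfl fun w => F (prependRight x s.fst (.cons (eps g t.fst rfl) w rfl)
              (by have := s.h; have := t.h; omega)) := by
    intro e n N hs h F
    simp only [ins, insertions, wsum_flatMap, cuts, wsum_unweighted]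
    congr 1
    refine List.map_congr_left fun s _ => ?_
    congr 1
    refine List.map_congr_left fun t _ => ?_
    rw [wsum_map_mul (f := fun w => prependRight x s.fst (Chain.cons (eps g t.fst rfl) w rfl) _)]
  rw [key]
  cases hs with
  | nil _ =>
    simp only [wsum_cuts_nil, insEps, insRight, prependRight_nil_cons, add_zero]
  | cons a hs h'' =>
    -- The cut with empty initial piece is the case i₁ = 0; in all others the first entry is id ⊗
    -- h₁.
    rw [wsum_cuts_cons]
    simp only [prependRight_nil_cons]
    refine congrArg₂ _ rfl ?_
    rw [insRight, key]
    refine wsum_congr _ fun s => wsum_congr _ fun t => ?_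
    congr 2
    funext w
    exact congrArg F (prependRight_cons ..)

theorem ins_cons_right {e₁ : E.Obj} {p q : ℤ} (gs : Chain D x y m) (a : E.Hom e e₁ p)
    (hs : Chain E e₁ e' q) (h' : p - 1 + q = n) (h : m + n = N)
    (F : Chain (D.twisted E) (pt x e) (pt y e') N → M) :
    ins gs (.cons a hs h') h F = insEps gs (.cons a hs h') h F +
      ins gs hs rfl fun w => F (.cons (right x a) w (by omega)) := by
  cases gs with
  | nil _ => rw [ins_nil_left, insEps, zero_add, insRight]
  | cons g gs h'' => rw [ins_cons_left, insRight]

theorem ins_nil_cons {e₁ : E.Obj} {p q : ℤ} (a : E.Hom e e₁ p) (hs : Chain E e₁ e' q)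
    (h' : p - 1 + q = n) (h : 0 + n = N)
    (F : Chain (D.twisted E) (pt x e) (pt x e') N → M) :
    ins (.nil x) (.cons a hs h') h F =
      ins (.nil x) hs rfl fun w => F (.cons (right x a) w (by omega)) := by
  rw [ins_nil_left, insRight]

theorem ins_cons_nil {x₁ : D.Obj} {p q : ℤ} (g : D.Hom x x₁ p) (gs : Chain D x₁ y q)
    (h' : p - 1 + q = m) (h : m + 0 = N)
    (F : Chain (D.twisted E) (pt x e) (pt y e) N → M) :
    ins (.cons g gs h') (.nil e) h F = insEps (.cons g gs h') (.nil e) h F := by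
  rw [ins_cons_left, insRight, add_zero]

section Linear

variable {N' : ℤ} (gs : Chain D x y m) (hs : Chain E e e' n) (h : m + n = N)

theorem ins_congr {F G : Chain (D.twisted E) (pt x e) (pt y e') N → M} (H : ∀ w, F w = G w) :
    ins gs hs h F = ins gs hs h G := wsum_congr _ H

theorem ins_add (F G : Chain (D.twisted E) (pt x e) (pt y e') N → M) :
    (ins gs hs h fun w => F w + G w) = ins gs hs h F + ins gs hs h G := wsum_add _ _ _

theorem ins_smul (a : k) (F : Chain (D.twisted E) (pt x e) (pt y e') N → M) :
    (ins gs hs h fun w => a • F w) = a • ins gs hs h F := wsum_smul _ _ _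

theorem ins_zero : (ins gs hs h fun _ => (0 : M)) = 0 := wsum_zero _

theorem ins_wsum {ι : Type*} (l : List (k × ι))
    (F : ι → Chain (D.twisted E) (pt x e) (pt y e') N → M) :
    (ins gs hs h fun w => wsum l fun i => F i w) = wsum l fun i => ins gs hs h (F i) :=
  wsum_comm _ _ _

theorem map_ins {M' : Type*} [AddCommGroup M'] [Module k M'] (L : M →ₗ[k] M')
    (F : Chain (D.twisted E) (pt x e) (pt y e') N → M) :
    L (ins gs hs h F) = ins gs hs h fun w => L (F w) := map_wsum _ _ _

theorem ins_ins_comm {D' E' : DGCat k} {x' y' : D'.Obj} {f f' : E'.Obj} {m' n' : ℤ}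
    (gs' : Chain D' x' y' m') (hs' : Chain E' f f' n') (h' : m' + n' = N')
    (F : Chain (D.twisted E) (pt x e) (pt y e') N →
      Chain (D'.twisted E') (pt x' f) (pt y' f') N' → M) :
    (ins gs hs h fun w => ins gs' hs' h' fun w' => F w w') =
      ins gs' hs' h' fun w' => ins gs hs h fun w => F w w' := wsum_comm _ _ _

end Linear

/-! ### Multilinearity and normalization -/

theorem eps_add {a b : D.Obj} {p q n : ℤ} (f f' : D.Hom a b p) (c : Chain E e e' q)
    (h : p + q = n) : eps (f + f') c h = eps f c h + eps f' c h := Mor.sound (.eps_add f f' c h)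

theorem eps_smul {a b : D.Obj} {p q n : ℤ} (r : k) (f : D.Hom a b p) (c : Chain E e e' q)
    (h : p + q = n) : eps (r • f) c h = r • eps f c h := Mor.sound (.eps_smul r f c h)

/-- The dependence of `ε(f; g₁, …, g_N)` on `f`, as a linear map. -/
def epsLin (a b : D.Obj) {p q n : ℤ} (c : Chain E e e' q) (h : p + q = n) :
    D.Hom a b p →ₗ[k] (D.twisted E).Hom (pt a e) (pt b e') n where
  toFun f := eps f c h
  map_add' f f' := eps_add f f' c h
  map_smul' r f := eps_smul r f c h

theorem eps_wsum {ι : Type*} {a b : D.Obj} {p q n : ℤ} (l : List (k × ι)) (f : ι → D.Hom a b p)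
    (c : Chain E e e' q) (h : p + q = n) :
    eps (wsum l f) c h = wsum l fun i => eps (f i) c h := map_wsum (epsLin a b c h) l f

theorem right_wsum {ι : Type*} (l : List (k × ι)) (g : ι → E.Hom e e' n) :
    right x (wsum l g) = wsum l fun i => right x (g i) := (rightOver E x).map_wsum l g

theorem right_id (x : D.Obj) (e : E.Obj) : right x (E.id e) = (D.twisted E).id (pt x e) :=
  (rightOver E x).map_id e

theorem eps_id_nil (x : D.Obj) (e : E.Obj) (h : (0 : ℤ) + 0 = 0) :
    eps (D.id x) (.nil e) h = (D.twisted E).id (pt x e) := Mor.sound (.eps_id_nil x e)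

theorem eps_id_cons (x : D.Obj) {e₁ : E.Obj} {p q : ℤ} (g : E.Hom e e₁ p) (c : Chain E e₁ e' q)
    (hc : p - 1 + q = m) (h : 0 + m = n) : eps (D.id x) (.cons g c hc) h = 0 :=
  Mor.sound (.eps_id_cons x g c hc h)

theorem insEps_multilin_left {x₁ : D.Obj} {p q : ℤ} (hs : Chain E e e' n) (h : m + n = N)
    {F : Chain (D.twisted E) (pt x e) (pt y e') N → M} (hF : Multilin F)
    (l : List (k × D.Hom x x₁ p))
    (c : Chain D x₁ y q) (h' : p - 1 + q = m) :
    insEps (.cons (wsum l fun g => g) c h') hs h F =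
      wsum l fun g => insEps (.cons g c h') hs h F := by
  simp only [insEps, eps_wsum, hF.cons_wsum, ins_wsum]
  rw [wsum_comm]
  exact wsum_congr _ fun t => (wsum_smul _ _ _).symm

/-- The sum over the insertions is multilinear in the first chain. -/
theorem ins_multilin_left (hs : Chain E e e' n) (h : m + n = N)
    {F : Chain (D.twisted E) (pt x e) (pt y e') N → M} (hF : Multilin F) :
    Multilin fun gs : Chain D x y m => ins gs hs h F := by
  intro c l H
  beta_reduce
  -- The induction runs over the position of the linear combination. As `insEps` shortens the first
  -- chain and `insRight` the second, each case contains an induction on the second chain.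
  induction H generalizing e n N with
  | head l c h' =>
    rw [wsum_map fun g => cons g c h']
    induction hs generalizing N with
    | nil e => simp only [ins_cons_left, wsum_add, insEps_multilin_left _ _ hF, insRight, wsum_zero]
    | cons a hs h'' ih =>
      simp only [ins_cons_right, wsum_add, insEps_multilin_left _ _ hF, ih _ (hF.cons _ _)]
  | @tail x₁ x₂ y p q m g c l h' H ih =>
    rw [wsum_map fun c => cons g c h']
    have key : ∀ {e : E.Obj} {n N : ℤ} (hs : Chain E e e' n) (h : m + n = N)
        {F : Chain (D.twisted E) (pt x₁ e) (pt y e') N → M} (hF : Multilin F),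
        insEps (.cons g c h') hs h F = wsum l fun c => insEps (.cons g c h') hs h F := by
      intro e n N hs h F hF
      simp only [insEps]
      rw [wsum_comm]
      refine wsum_congr _ fun t => ?_
      rw [ih _ _ (hF.cons _ _), wsum_smul]
    induction hs generalizing N with
    | nil e =>
      simp only [ins_cons_left, wsum_add, insRight, wsum_zero, ← key _ _ hF]
    | cons a hs h'' ih' =>
      simp only [ins_cons_right, wsum_add, ← key _ _ hF]
      rw [ih' ih _ (hF.cons _ _) key]

/-- The sum over the insertions is multilinear in the second chain. -/
theorem ins_multilin_right (gs : Chain D x y m) (h : m + n = N)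
    {F : Chain (D.twisted E) (pt x e) (pt y e') N → M} (hF : Multilin F) :
    Multilin fun hs : Chain E e e' n => ins gs hs h F := by
  induction gs generalizing e n N with
  | nil x =>
    intro c l H
    beta_reduce
    induction H generalizing N with
    | head l c h' =>
      rw [wsum_map fun g => cons g c h']
      simp only [ins_cons_right, insEps, zero_add, right_wsum, hF.cons_wsum, ins_wsum]
    | tail g h' H ih =>
      rw [wsum_map fun c => cons g c h']
      simp only [ins_cons_right, insEps, zero_add]
      exact ih _ (hF.cons _ _)
  | @cons x₁ x₂ y p q m g gs h₀ ih =>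
    have key : ∀ {e : E.Obj} {n N : ℤ} (h : m + n = N)
        {F : Chain (D.twisted E) (pt x₁ e) (pt y e') N → M} (hF : Multilin F),
        Multilin fun hs : Chain E e e' n => insEps (.cons g gs h₀) hs h F := by
      intro e n N h F hF
      dsimp only [insEps]
      refine .cuts (fun {z p' q'} b h' => ?_) (fun {z p' q'} a h' => ?_) <;> dsimp only
      · refine Multilin.smul (F := fun a => wsum (insertions gs b rfl) fun w =>
          F (.cons (eps g a rfl) w (by omega))) (.wsum _ fun w => ?_) _
        exact (eps_multilin g e z rfl).map (hF.headLin w (by omega))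
      · exact (ih (F := fun w => F (.cons (eps g a rfl) w (by omega))) rfl (hF.cons _ _)).smul _
    intro c l H
    have key' := key h hF H
    beta_reduce at key' ⊢
    induction H generalizing N with
    | head l c h' =>
      rw [wsum_map fun g => cons g c h'] at key' ⊢
      simp only [ins_cons_right, key', wsum_add, right_wsum, hF.cons_wsum, ins_wsum]
    | tail a h' H ih' =>
      rw [wsum_map fun c => cons a c h'] at key' ⊢
      simp only [ins_cons_right, key', wsum_add]
      rw [ih' ih _ (hF.cons _ _) key (key _ (hF.cons _ _) H)]

/-- If an inserted morphism is an identity, ε(id; …) is zero on a nonempty piece and an identity on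
an empty one, so every term vanishes. -/
theorem ins_eq_zero_of_hasId_left {gs : Chain D x y m} (H : gs.HasId) (hs : Chain E e e' n)
    (h : m + n = N) {F : Chain (D.twisted E) (pt x e) (pt y e') N → M} (hF : Multilin F)
    (hF' : ∀ c : Chain _ _ _ _, c.HasId → F c = 0) : ins gs hs h F = 0 := by
  induction H generalizing e n N with
  | @head x y q m c h' =>
    have key : ∀ {e : E.Obj} {n N : ℤ} (hs : Chain E e e' n) (h : m + n = N)
        {F : Chain (D.twisted E) (pt x e) (pt y e') N → M} (hF : Multilin F)
        (hF' : ∀ c : Chain _ _ _ _, c.HasId → F c = 0),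
        insEps (.cons (D.id x) c h') hs h F = 0 := by
      intro e n N hs h F hF hF'
      dsimp only [insEps]
      rw [Chain.wsum_cuts_of_fst]
      · simp only [eps_id_nil]
        rw [ins_congr (G := fun _ => 0) _ _ _ fun w => hF' _ (.head _ _), ins_zero, smul_zero]
      · intro w z p q r m g a b h h'
        simp only [eps_id_cons, hF.cons_zero, ins_zero, smul_zero]
    induction hs generalizing N with
    | nil e => rw [ins_cons_left, key _ _ hF hF', insRight, add_zero]
    | cons a hs h'' ih' =>
      rw [ins_cons_right, key _ _ hF hF', ih' _ (hF.cons _ _) (fun c hc => hF' _ (.tail _ _ hc))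
        key,
        add_zero]
  | @tail x₁ x₂ y p q m g c h' H ih =>
    have key : ∀ {e : E.Obj} {n N : ℤ} (hs : Chain E e e' n) (h : m + n = N)
        {F : Chain (D.twisted E) (pt x₁ e) (pt y e') N → M} (hF : Multilin F)
        (hF' : ∀ c : Chain _ _ _ _, c.HasId → F c = 0),
        insEps (.cons g c h') hs h F = 0 := by
      intro e n N hs h F hF hF'
      dsimp only [insEps]
      refine wsum_eq_zero _ fun t => ?_
      rw [ih _ _ (hF.cons _ _) fun c hc => hF' _ (.tail _ _ hc), smul_zero]
    induction hs generalizing N with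
    | nil e => rw [ins_cons_left, key _ _ hF hF', insRight, add_zero]
    | cons a hs h'' ih' =>
      rw [ins_cons_right, key _ _ hF hF',
        ih' ih _ (hF.cons _ _) (fun c hc => hF' _ (.tail _ _ hc)) key, add_zero]

/-- An identity of the second chain either lies inside some ε(g; …), which is then zero, or becomes
an entry id ⊗ id, which is an identity. -/
theorem ins_eq_zero_of_hasId_right (gs : Chain D x y m) {hs : Chain E e e' n} (H : hs.HasId)
    (h : m + n = N) {F : Chain (D.twisted E) (pt x e) (pt y e') N → M} (hF : Multilin F)
    (hF' : ∀ c : Chain _ _ _ _, c.HasId → F c = 0) : ins gs hs h F = 0 := by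
  induction gs generalizing e n N with
  | nil x =>
    induction H generalizing N with
    | head c h' =>
      rw [ins_cons_right, insEps, zero_add,
        ins_congr (G := fun _ => 0) _ _ _ fun w => hF' _ (right_id (D := D) _ _ ▸ .head _ _),
          ins_zero]
    | tail a h' H ih =>
      rw [ins_cons_right, insEps, zero_add, ih _ (hF.cons _ _) fun c hc => hF' _ (.tail _ _ hc)]
  | @cons x₁ x₂ y p q m g gs h₀ ih =>
    have key : ∀ {e : E.Obj} {n N : ℤ} {hs : Chain E e e' n} (H : hs.HasId) (h : m + n = N)
        {F : Chain (D.twisted E) (pt x₁ e) (pt y e') N → M} (hF : Multilin F)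
        (hF' : ∀ c : Chain _ _ _ _, c.HasId → F c = 0),
        insEps (.cons g gs h₀) hs h F = 0 := by
      intro e n N hs H h F hF hF'
      dsimp only [insEps]
      refine wsum_cuts_of_hasId H _ (fun s hc => ?_) fun s hc => ?_
      · simp only [eps_hasId g _ hc, hF.cons_zero, ins_zero, smul_zero]
      · rw [ih hc _ (hF.cons _ _) fun c hc => hF' _ (.tail _ _ hc), smul_zero]
    induction H generalizing N with
    | head c h' =>
      rw [ins_cons_right, key (.head _ _) _ hF hF', zero_add,
        ins_congr (G := fun _ => 0) _ _ _ fun w => hF' _ (right_id (D := D) _ _ ▸ .head _ _),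
          ins_zero]
    | tail a h' H ih' =>
      rw [ins_cons_right, key (.tail _ _ H) _ hF hF', zero_add,
        ih' ih _ (hF.cons _ _) (fun c hc => hF' _ (.tail _ _ hc)) key]

end Twisted

namespace Twisted

open Chain

variable {k : Type u} [CommRing k] {D E : DGCat k} {M : Type*} [AddCommGroup M] [Module k M]
  {x y : D.Obj} {e e' : E.Obj} {m n N : ℤ}

/-! ### Insertions and cuts -/

/-- The inductive step of `ins_cuts` for insertions that begin with ε(g; …). Splitting off the piece
used by this entry and then cutting the rest amounts to cutting into three pieces, so
`wsum_cuts_assoc` exchanges the two cuts. -/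
theorem insEps_cuts {x₁ : D.Obj} {p q : ℤ} (g : D.Hom x x₁ p) (gs : Chain D x₁ y q)
    (ih : ∀ {e : E.Obj} {n N : ℤ} (hs : Chain E e e' n) (h : q + n = N)
      (F : Split (D.twisted E) (pt x₁ e) (pt y e') N → M),
      (ins gs hs h fun w => wsum w.cuts F) = wsum gs.cuts fun s => wsum hs.cuts fun t =>
        sgn k (s.p * t.q) • ins s.fst t.fst rfl fun w => ins s.snd t.snd rfl fun w' =>
          F ⟨pt s.mid t.mid, _, _, w, w', by have := s.h; have := t.h; omega⟩)
    (hs : Chain E e e' n) (h' : p - 1 + q = m) (h : m + n = N)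
    (F : Split (D.twisted E) (pt x e) (pt y e') N → M) :
    (insEps (.cons g gs h') hs h fun w => wsum w.cuts F) =
      (insEps (.cons g gs h') hs h fun w => F ⟨pt x e, 0, N, .nil _, w, by omega⟩) +
      wsum gs.cuts fun s => wsum hs.cuts fun t => sgn k ((p - 1 + s.p) * t.q) •
        insEps (.cons g s.fst rfl) t.fst rfl fun w => ins s.snd t.snd rfl fun w' =>
          F ⟨pt s.mid t.mid, _, _, w, w', by have := s.h; have := t.h; omega⟩ := by
  have key := fun s : Split D x₁ y q => wsum_cuts_assoc hs fun {_ _ p' q' r'} a b c h'' =>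
    sgn k ((p - 1 + s.p) * r' + (p - 1) * q') • ins s.fst b rfl fun w => ins s.snd c rfl fun w' =>
      F ⟨pt s.mid _, p + p' - 1 + (s.p + q'), s.q + r', .cons (eps g a rfl) w (by omega), w',
        by have := s.h; omega⟩
  simp only [insEps, wsum_cuts_cons, ins_add, smul_add, wsum_add, ih, ← wsum_smul, smul_smul,
    ← sgn_add]
  refine congrArg₂ _ rfl ?_
  rw [wsum_comm]
  refine wsum_congr _ fun s => ?_
  refine Eq.trans (wsum_congr _ fun t => wsum_congr _ fun u => ?_) ((key s).symm.trans
    (wsum_congr _ fun t => wsum_congr _ fun u => ?_))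
  · rw [sgn_congr ⟨0, _⟩]
    linear_combination -(p - 1) * u.h
  · refine congrArg _ (ins_congr _ _ _ fun w => ins_congr _ _ _ fun w' => congrArg F ?_)
    exact Split.mk_congr _ _ (by have := u.h; omega) (cons_heq ..) .rfl

theorem ins_nil_nil_ins (gs : Chain D x y m) (hs : Chain E e e' n) (h : m + n = N)
    (F : Split (D.twisted E) (pt x e) (pt y e') N → M) :
    (ins (.nil x) (.nil e) rfl fun w => ins gs hs rfl fun w' =>
      F ⟨pt x e, 0 + 0, m + n, w, w', by omega⟩) =
        ins gs hs h fun w => F ⟨pt x e, 0, N, .nil _, w, by omega⟩ := by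
  subst h
  exact ins_nil_nil (fun w => ins gs hs rfl fun w' => F ⟨pt x e, 0, m + n, w, w', by omega⟩) rfl

theorem wsum_cuts_cons_right {p q : ℤ} {e₁ : E.Obj} (a : E.Hom e e₁ p) (hs : Chain E e₁ e' q)
    (h' : p - 1 + q = n) (h : m + n = N) (s : Split D x y m)
    (F : Split (D.twisted E) (pt x e) (pt y e') N → M) :
    (wsum hs.cuts fun t => sgn k (s.p * t.q) • ins s.fst t.fst rfl fun w =>
      ins s.snd t.snd rfl fun w' => F ⟨pt s.mid t.mid, _, _, .cons (right x a) w rfl, w', by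
        have := s.h; have := t.h; omega⟩) =
    wsum hs.cuts fun t => sgn k (s.p * t.q) • ins s.fst t.fst rfl fun w =>
      ins s.snd t.snd rfl fun w' => F ⟨pt s.mid t.mid, s.p + (p - 1 + t.p), _,
        .cons (right x a) w (by omega), w', by have := s.h; have := t.h; omega⟩ := by
  refine wsum_congr _ fun t => congrArg _ (ins_congr _ _ _ fun w => ins_congr _ _ _ fun w' =>
    congrArg F ?_)
  exact Split.mk_congr _ _ (by omega) (cons_heq ..) .rfl

/-- The sum over the insertions is compatible with cutting chains. -/
theorem ins_cuts (gs : Chain D x y m) (hs : Chain E e e' n) (h : m + n = N)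
    (F : Split (D.twisted E) (pt x e) (pt y e') N → M) :
    (ins gs hs h fun w => wsum w.cuts F) = wsum gs.cuts fun s => wsum hs.cuts fun t =>
      sgn k (s.p * t.q) • ins s.fst t.fst rfl fun w => ins s.snd t.snd rfl fun w' =>
        F ⟨pt s.mid t.mid, _, _, w, w', by have := s.h; have := t.h; omega⟩ := by
  -- A cut of an inserted chain falls between two entries, so it cuts both `gs` and `hs`, and its
  -- two pieces are insertions of the pieces. The sign is that of moving the initial piece of `gs`
  -- past the final piece of `hs`.
  induction gs generalizing e n N with
  | nil x =>
    induction hs generalizing N with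
    | nil e =>
      simp only [wsum_cuts_nil, mul_zero, sgn_zero, one_smul]
      rw [ins_nil_nil_ins _ _ h]
      obtain rfl : N = 0 := by omega
      simp only [ins_nil_nil, wsum_cuts_nil]
    | cons a hs h' ih =>
      rw [wsum_cuts_nil, wsum_cuts_cons, ins_nil_cons]
      simp only [wsum_cuts_cons, ins_add, zero_mul, sgn_zero, one_smul]
      rw [ins_nil_nil_ins _ _ h, ins_nil_cons, ih, wsum_cuts_nil,
        wsum_cuts_cons_right a hs h' h ⟨x, 0, 0, .nil x, .nil x, rfl⟩ F]
      simp only [zero_mul, sgn_zero, one_smul, ins_nil_cons a]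
  | @cons x₁ x₂ y p q m g gs h₀ ih =>
    induction hs generalizing N with
    | nil e =>
      rw [ins_cons_nil, insEps_cuts g gs ih]
      simp only [wsum_cuts_cons, wsum_cuts_nil, mul_zero, sgn_zero, one_smul]
      rw [ins_nil_nil_ins _ _ h, ins_cons_nil]
      simp only [ins_cons_nil]
    | cons a hs h' ih' =>
      rw [ins_cons_right, insEps_cuts g gs ih]
      simp only [wsum_cuts_cons (right x₁ a), ins_add]
      rw [ih' ih, wsum_congr _ fun s => wsum_cuts_cons_right a hs h' h s F]
      simp only [wsum_cuts_cons, zero_mul, sgn_zero, one_smul]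
      rw [ins_nil_nil_ins _ _ h, ins_cons_right]
      simp only [ins_cons_nil, ins_nil_cons, ins_cons_right (cons g _ _), smul_add, wsum_add]
      abel

end Twisted

namespace Twisted

open Chain

variable {k : Type u} [CommRing k] {D E : DGCat k} {M : Type*} [AddCommGroup M] [Module k M]
  {x y : D.Obj} {e e' : E.Obj} {m n N : ℤ}

/-! ### Insertions and the bar differential -/

section InsHead

variable {X : (D.twisted E).Obj} {x₁ : D.Obj} {z : E.Obj} {q r s : ℤ} (gs : Chain D x₁ y q)

/-- The sum of the values of `F` over the chains that consist of `φ` and of an insertion of `gs`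
into `c`. -/
def insHead (F : Chain (D.twisted E) X (pt y e') N → M) (φ : (D.twisted E).Hom X (pt x₁ z) r)
    (c : Chain E z e' s) (h : r - 1 + (q + s) = N) : M :=
  ins gs c rfl fun w => F (.cons φ w h)

variable {F : Chain (D.twisted E) X (pt y e') N → M} (hF : Multilin F)

/-- The dependence of `insHead` on the first entry, as a linear map. -/
def insHeadLin (c : Chain E z e' s) (h : r - 1 + (q + s) = N) :
    (D.twisted E).Hom X (pt x₁ z) r →ₗ[k] M where
  toFun φ := insHead gs F φ c h
  map_add' φ ψ := by simp only [insHead, hF.cons_add, ins_add]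
  map_smul' a φ := by simp only [insHead, hF.cons_smul, ins_smul]; rfl

theorem insHead_comp_congr {Y : (D.twisted E).Obj} {p t : ℤ} (b : (D.twisted E).Hom Y (pt x₁ z) t)
    (a : (D.twisted E).Hom X Y p) (h : t + p = r) (c : Chain E z e' s) (h' : r - 1 + (q + s) = N) :
    insHead gs F ((D.twisted E).comp b a h) c h' =
      insHead gs F ((D.twisted E).comp b a rfl) c (by omega) := by
  subst h; rfl

theorem ins_cons_eq {X : (D.twisted E).Obj} {x₁ : D.Obj} {z : E.Obj} {q r s t : ℤ}
    (gs : Chain D x₁ y q) {F : Chain (D.twisted E) X (pt y e') N → M}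
    (φ : (D.twisted E).Hom X (pt x₁ z) r) (c : Chain E z e' s) (h : q + s = t)
    (h' : r - 1 + t = N) :
    (ins gs c h fun w => F (.cons φ w h')) = insHead gs F φ c (by omega) := by
  subst h; rfl

theorem insHead_eps_congr {X x₁ : D.Obj} {f z : E.Obj} {p q r r' s t : ℤ} (gs : Chain D x₁ y q)
    {F : Chain (D.twisted E) (pt X f) (pt y e') N → M} (g : D.Hom X x₁ p) (b : Chain E f z t)
    (h : p + t = r) (h' : p + t = r') (c : Chain E z e' s) (h'' : r - 1 + (q + s) = N) :
    insHead gs F (eps g b h) c h'' = insHead gs F (eps g b h') c (by omega) := by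
  subst h h'; rfl

end InsHead

/-- The cochain of degree one that is `id_x ⊗ g` on the chain with the single entry `g`. -/
abbrev tau (E : DGCat k) (x : D.Obj) :
    RawCochain (A := D.twisted E) (pt (C := D) (D := E) x) (pt x) 1 :=
  RawCochain.ofFunctor (rightOver E x)

/-- The compatibility of `etaOver` with differentials, evaluated on one chain and solved for dε(g;
…). Writing the outer terms as products with `tau` covers chains of all lengths at once. -/
theorem d_eps {p q l : ℤ} (g : D.Hom x y p) (c : Chain E e e' q) (h : p + q = l)
    (h' : p + 1 + q = l + 1) :
    (D.twisted E).d (eps g c h) = eps (D.d g) c h' -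
      sgn k p • (wsum c.bar fun c' => eps g c' (by omega)) -
      (wsum c.cuts fun s => sgn k (p * s.q) • (D.twisted E).comp ((tau E y).app s.snd rfl)
        (eps g s.fst rfl) (by have := s.h; omega)) +
      sgn k p • wsum c.cuts fun s => sgn k s.q • (D.twisted E).comp (eps g s.snd rfl)
        ((tau E x).app s.fst rfl) (by have := s.h; omega) := by
  have key := app_epsHom (D.d g) c h'
  have hd : epsHom E (D.d g) = (DGCat.coh E (D.twisted E)).d (epsHom E g) := (etaOver D E).map_d g
  rw [hd, DGCat.coh.app_d _ _ h] at key
  simp only [app_epsHom, one_mul] at key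
  rw [← key]
  abel

/-- A sum over the cuts whose first piece has length one. -/
theorem wsum_cuts_tau_fst {M : Type*} [AddCommGroup M] [Module k M] {p q : ℤ} {e₁ : E.Obj}
    (a : E.Hom e e₁ p) (c : Chain E e₁ e' q) (h : p - 1 + q = n)
    (K : ∀ {z : E.Obj} {r s : ℤ}, (D.twisted E).Hom (pt x e) (pt x z) (1 + r) →
      Chain E z e' s → r + s = n → M)
    (hK : ∀ {z : E.Obj} {r s : ℤ} (c : Chain E z e' s) (h : r + s = n),
      K (0 : (D.twisted E).Hom (pt x e) (pt x z) (1 + r)) c h = 0) :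
    (wsum (Chain.cons a c h).cuts fun s => K ((tau E x).app s.fst rfl) s.snd s.h) =
      K ((tau E x).app (.cons a (.nil _) (Int.add_zero _)) rfl) c h := by
  rw [wsum_cuts_cons, wsum_cuts_of_fst]
  · rw [RawCochain.ofFunctor_nil, hK, zero_add]
    have : ∀ (r : ℤ) (hr : p - 1 + 0 = r) (h : r + _ = n),
        K ((tau E x).app (.cons a (.nil _) hr) rfl) c h =
          K ((tau E x).app (.cons a (.nil _) (Int.add_zero _)) rfl) c (by omega) := by
      intro r hr h
      obtain rfl : r = p - 1 := by omega
      rfl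
    exact this _ _ _
  · intro w z p' q' r m g a b h h'
    simp only [RawCochain.ofFunctor_cons_cons, hK]


section InsEpsBar

variable {x₁ : D.Obj} {p q : ℤ} (g : D.Hom x x₁ p) (gs : Chain D x₁ y q) (hs : Chain E e e' n)
  (h' : p - 1 + q = m) (h : m + n = N) {F : Chain (D.twisted E) (pt x e) (pt y e') (N + 1) → M}
  (hF : Multilin F)

/-- The terms that arise from the entries `ε(g; h₂, …, h_j) ∘ (id ⊗ h₁)`. -/
def insEdge (F : Chain (D.twisted E) (pt x e) (pt y e') (N + 1) → M) : M :=
  wsum hs.cuts fun s => wsum s.snd.cuts fun t => sgn k (p * t.q + q + p + t.p) •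
    insHead gs F ((D.twisted E).comp (eps g t.fst rfl) ((tau E x).app s.fst rfl) rfl) t.snd
      (by have := s.h; have := t.h; omega)

include hF in
theorem insHead_d_eps {z : E.Obj} {r s : ℤ} (b : Chain E e z r) (c : Chain E z e' s)
    (h'' : r + s = n) : insHead gs F ((D.twisted E).d (eps g b rfl)) c (by omega) =
      insHead gs F (eps (D.d g) b rfl) c (by omega) -
      sgn k p • (wsum b.bar fun b' => insHead gs F (eps g b' rfl) c (by omega)) -
      (wsum b.cuts fun t => sgn k (p * t.q) • insHead gs F ((D.twisted E).comp
        ((tau E x₁).app t.snd rfl) (eps g t.fst rfl) rfl) c (by have := t.h; omega)) +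
      sgn k p • wsum b.cuts fun t => sgn k t.q • insHead gs F ((D.twisted E).comp
        (eps g t.snd rfl) ((tau E x).app t.fst rfl) rfl) c (by have := t.h; omega) := by
  rw [d_eps g b rfl (by omega : p + 1 + r = p + r + 1)]
  change insHeadLin gs hF c _ _ = _
  simp only [map_add, map_sub, map_smul, map_wsum]
  refine congrArg₂ _ (congrArg₂ _ (congrArg₂ _ (insHead_eps_congr ..) (congrArg _
    (wsum_congr _ fun b' => insHead_eps_congr ..))) (wsum_congr _ fun t => congrArg _
    (insHead_comp_congr ..))) (congrArg _ (wsum_congr _ fun t => congrArg _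
    (insHead_comp_congr ..)))

/-- The decomposition by the first entry fails in general for two empty chains. It holds here
because nothing can be multiplied with the head of an empty chain. -/
theorem ins_mulHead {X : (D.twisted E).Obj} {r : ℤ} (φ : (D.twisted E).Hom X (pt x e) r)
    (gs : Chain D x y m) (hs : Chain E e e' n) {l : ℤ} (h : m + n = N) (h' : r - 1 + N = l)
    (F : Chain (D.twisted E) X (pt y e') (l + 1) → M) :
    (ins gs hs h fun w => mulHead φ w h' F) = (insEps gs hs h fun w => mulHead φ w h' F) +
      insRight gs hs h fun w => mulHead φ w h' F := by
  cases gs with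
  | nil x =>
    cases hs with
    | nil e =>
      obtain rfl : N = 0 := by omega
      rw [ins_nil_nil, mulHead_nil, insEps, insRight, add_zero]
    | cons a hs h'' => rw [ins_nil_left, insEps, zero_add]
  | cons g gs h'' => rw [ins_cons_left]

include hF in
/-- The contribution of the composites `ε(g₂; -) ∘ ε(g; -)` to `insEps_bar`. -/
theorem wsum_insEps_mulHead : (wsum hs.cuts fun t => sgn k (p * t.q + q) •
      insEps gs t.snd rfl fun w => mulHead (eps g t.fst rfl) w (by have := t.h; omega) F) =
    sgn k q • mulHead g gs h' fun c => insEps c hs (by omega) F := by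
  cases gs with
  | nil _ => simp only [insEps, smul_zero, wsum_zero, mulHead_nil]
  | @cons _ x₂ _ p₂ q₂ _ g₂ gs h₂ =>
    have key := wsum_cuts_assoc hs fun {_ _ p' q' r'} a b c h'' =>
      sgn k (p * (q' + r') + q + (p₂ - 1) * r') • insHead gs F
        ((D.twisted E).comp (eps g₂ b rfl) (eps g a rfl) rfl) c (by omega)
    -- For adjacent entries that together use the piece `b`, the composites over all cuts of `b` add
    -- up to the single entry ε(g₂g; b).
    have e₁ : ∀ {z : E.Obj} {r s : ℤ} (b : Chain E e z r) (c : Chain E z e' s) (h'' : r + s = n),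
        insHead gs F (eps (D.comp g₂ g rfl) b rfl) c (by omega) = wsum b.cuts fun t =>
          sgn k (p * t.q) • insHead gs F ((D.twisted E).comp (eps g₂ t.snd rfl) (eps g t.fst rfl)
            rfl)
            c (by have := t.h; omega) := by
      intro z r s b c h''
      rw [eps_comp]
      change insHeadLin gs hF c _ _ = _
      simp only [map_smul, map_wsum]
      exact wsum_congr _ fun t => congrArg _ (insHead_comp_congr ..)
    rw [mulHead_cons, insEps, ← wsum_smul]
    refine Eq.trans (wsum_congr _ fun t => ?_) (key.symm.trans (wsum_congr _ fun t => ?_))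
    · dsimp only [insEps]
      rw [← wsum_smul]
      refine wsum_congr _ fun u => ?_
      rw [smul_smul, ← sgn_add]
      refine congrArg₂ _ (sgn_congr ⟨0, ?_⟩) rfl
      linear_combination -p * u.h
    · refine Eq.trans ?_ (congrArg _ (congrArg _ (e₁ t.fst t.snd t.h).symm))
      rw [← wsum_smul, ← wsum_smul]
      refine wsum_congr _ fun u => ?_
      rw [smul_smul, smul_smul, ← sgn_add, ← sgn_add]
      refine congrArg₂ _ (sgn_congr ⟨0, ?_⟩) rfl
      ring

include hF in
/-- The contribution of the composites `(id ⊗ h) ∘ ε(g; -)` to `insEps_bar`. -/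
theorem wsum_insRight_mulHead : (wsum hs.cuts fun t => sgn k (p * t.q + q) •
      insRight gs t.snd rfl fun w => mulHead (eps g t.fst rfl) w (by have := t.h; omega) F) =
    wsum hs.cuts fun t => sgn k (p * t.q + q) • wsum t.fst.cuts fun s => sgn k (p * s.q) •
      insHead gs F ((D.twisted E).comp ((tau E x₁).app s.snd rfl) (eps g s.fst rfl) rfl) t.snd
        (by have := s.h; have := t.h; omega) := by
  have key := wsum_cuts_assoc hs fun {_ _ p' q' r'} a b c h'' =>
    sgn k (p * (q' + r') + q) • insHead gs F
      ((D.twisted E).comp ((tau E x₁).app b rfl) (eps g a rfl) rfl) c (by omega)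
  refine Eq.trans (wsum_congr _ fun t => ?_) (key.symm.trans (wsum_congr _ fun t => ?_))
  · obtain ⟨z, r, s, b, c, h''⟩ := t
    dsimp only
    cases c with
    | nil _ =>
      simp only [insRight, smul_zero, wsum_cuts_nil, RawCochain.ofFunctor_nil, DGCat.zero_comp]
      exact (smul_eq_zero_of_right _ (map_zero (insHeadLin gs hF _ _))).symm
    | @cons _ z' _ l _ _ a c h₃ =>
      rw [wsum_cuts_tau_fst a c h₃ fun {_ r' s'} φ c h => sgn k (p * (r' + s') + q) • insHead gs F
        ((D.twisted E).comp φ (eps g b rfl) rfl) c (by omega)]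
      · rw [h₃]
        refine congrArg _ ?_
        rw [RawCochain.ofFunctor_single_comp]
        exact (insHead_comp_congr ..).symm
      · intro z r s c h
        rw [DGCat.zero_comp]
        exact smul_eq_zero_of_right _ (map_zero (insHeadLin gs hF _ _))
  · rw [← wsum_smul]
    refine wsum_congr _ fun u => ?_
    rw [smul_smul, ← sgn_add]
    refine congrArg₂ _ (sgn_congr ⟨0, ?_⟩) rfl
    ring

theorem insEdge_eq : insEdge g gs hs h' h F = wsum hs.cuts fun t => sgn k (p * t.q + q + p) •
    wsum t.fst.cuts fun s => sgn k s.q •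
      insHead gs F ((D.twisted E).comp (eps g s.snd rfl) ((tau E x).app s.fst rfl) rfl) t.snd
        (by have := s.h; have := t.h; omega) := by
  have key := wsum_cuts_assoc hs fun {_ _ p' q' r'} a b c h'' =>
    sgn k (p * r' + q + p + q') • insHead gs F
      ((D.twisted E).comp (eps g b rfl) ((tau E x).app a rfl) rfl) c (by omega)
  refine key.symm.trans (wsum_congr _ fun t => ?_)
  rw [← wsum_smul]
  refine wsum_congr _ fun u => ?_
  rw [smul_smul, ← sgn_add]

theorem wsum_bar_insEps : (sgn k m • wsum hs.bar fun c => insEps (.cons g gs h') c (by omega) F) =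
    wsum hs.cuts fun t => -(sgn k (p * t.q + q + p) •
      wsum t.fst.bar fun b => insHead gs F (eps g b rfl) t.snd (by have := t.h; omega)) +
      sgn k ((p - 1) * t.q + q) • wsum t.snd.bar fun c => insHead gs F (eps g t.fst rfl) c
        (by have := t.h; omega) := by
  simp only [insEps]
  rw [wsum_bar_cuts, ← wsum_smul]
  refine wsum_congr _ fun t => ?_
  simp only [wsum_smul]
  rw [smul_add, smul_smul, smul_smul, smul_smul, ← sgn_add, ← sgn_add, ← sgn_add, ← neg_smul,
    ← sgn_add_one]
  refine congrArg₂ _ (congrArg₂ _ (sgn_congr ⟨-1, ?_⟩) rfl)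
    (congrArg₂ _ (sgn_congr ⟨p - 1, ?_⟩) rfl)
  · linear_combination -h'
  · linear_combination -h'

-- Differentiating the leading entry ε(g; …) yields composites with id ⊗ h on both sides. Those of
-- the form (id ⊗ h) ∘ ε(g; …) cancel against the products of the leading entry with a following id
-- ⊗ h. Those of the form ε(g; …) ∘ (id ⊗ h) would need a preceding entry id ⊗ h, which is absent
-- when ε comes first, so they remain as `insEdge`.
include hF in
theorem insEps_bar (ih : ∀ {e : E.Obj} {n N : ℤ} (hs : Chain E e e' n) (h : q + n = N)
      {F : Chain (D.twisted E) (pt x₁ e) (pt y e') (N + 1) → M}, Multilin F →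
      (ins gs hs h fun w => wsum w.bar F) =
        (wsum gs.bar fun c : Chain D x₁ y (q + 1) => ins c hs (by omega) F) +
        sgn k q • wsum hs.bar fun c : Chain E e e' (n + 1) => ins gs c (by omega) F) :
    (insEps (.cons g gs h') hs h fun w => wsum w.bar F) =
      sgn k q • (insEps (.cons (D.d g) gs (by omega)) hs (by omega : m + 1 + n = N + 1) F +
        mulHead g gs h' fun c => insEps c hs (by omega) F) +
      (wsum gs.bar fun c => insEps (.cons g c (by omega : _ = m + 1)) hs (by omega) F) +
      (sgn k m • wsum hs.bar fun c => insEps (.cons g gs h') c (by omega) F) +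
      insEdge g gs hs h' h F := by
  have h₀ : sgn k q • insEps (.cons (D.d g) gs (by omega)) hs (by omega : m + 1 + n = N + 1) F =
      wsum hs.cuts fun t => sgn k (p * t.q + q) • insHead gs F (eps (D.d g) t.fst rfl) t.snd
        (by have := t.h; omega) := by
    rw [insEps, ← wsum_smul]
    refine wsum_congr _ fun t => ?_
    rw [smul_smul, ← sgn_add]
    exact congrArg₂ _ (sgn_congr ⟨0, by ring⟩) rfl
  have h₁ : (wsum gs.bar fun c => insEps (.cons g c (by omega : _ = m + 1)) hs (by omega) F) =
      wsum hs.cuts fun t => sgn k ((p - 1) * t.q) • wsum gs.bar fun c =>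
        insHead c F (eps g t.fst rfl) t.snd (by have := t.h; omega) := by
    simp only [insEps]
    rw [wsum_comm]
    refine wsum_congr _ fun t => ?_
    rw [wsum_smul]
    rfl
  -- The expansion of the left side: the differential of the leading entry, its product with the
  -- next entry (an ε or an id ⊗ h), and the bar differential of the rest by the induction
  -- hypothesis.
  have hL : (insEps (.cons g gs h') hs h fun w => wsum w.bar F) =
      wsum hs.cuts fun t => sgn k (p * t.q + q) • insHead gs F ((D.twisted E).d (eps g t.fst rfl))
        t.snd (by have := t.h; omega) +
      (sgn k (p * t.q + q) • (insEps gs t.snd rfl fun w => mulHead (eps g t.fst rfl) w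
        (by have := t.h; omega) F) +
      sgn k (p * t.q + q) • (insRight gs t.snd rfl fun w => mulHead (eps g t.fst rfl) w
        (by have := t.h; omega) F) +
      sgn k ((p - 1) * t.q) • (wsum gs.bar fun c => insHead c F (eps g t.fst rfl) t.snd
        (by have := t.h; omega)) +
      sgn k ((p - 1) * t.q + q) • wsum t.snd.bar fun c => insHead gs F (eps g t.fst rfl) c
        (by have := t.h; omega)) := by
    rw [insEps]
    refine wsum_congr _ fun t => ?_
    simp only [wsum_bar_cons, ins_add, ins_smul, ins_mulHead]
    rw [ih t.snd rfl (F := fun w => F (.cons (eps g t.fst rfl) w (by have := t.h; omega)))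
      (hF.cons _ _)]
    simp only [ins_cons_eq, smul_add, smul_smul, ← sgn_add]
    rw [sgn_congr (k := k) (m := (p - 1) * t.q + (q + t.q)) (n := p * t.q + q) ⟨0, by ring⟩]
    abel
  have hR := fun t : Split E e e' n => insHead_d_eps g gs h' h hF t.fst t.snd t.h
  rw [insEdge_eq, wsum_bar_insEps g gs hs h' h, smul_add, ← wsum_insEps_mulHead g gs hs h' h hF,
    h₀, h₁, hL]
  simp only [hR, wsum_add, smul_add, smul_sub, wsum_sub, wsum_insRight_mulHead g gs hs h' h hF,
    smul_smul, ← sgn_add, wsum_neg]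
  abel

end InsEpsBar

theorem insRight_mulHead {e₁ : E.Obj} {p l n' : ℤ} (a : E.Hom e₁ e p) (gs : Chain D x y m)
    (hs : Chain E e e' n) (h : m + n = N) (h₁ : p - 1 + N = l) (h₂ : p - 1 + n = n')
    (F : Chain (D.twisted E) (pt x e₁) (pt y e') (l + 1) → M) :
    (insRight gs hs h fun w => mulHead (right x a) w h₁ F) =
      mulHead a hs h₂ fun c => insRight gs c (by omega) F := by
  cases hs with
  | nil _ => rfl
  | cons b hs h' =>
    simp only [insRight, mulHead_cons]
    have := (rightOver E x).map_comp b a rfl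
    change right x _ = (D.twisted E).comp (right x b) (right x a) rfl at this
    rw [this]

theorem insEdge_nil {x₁ : D.Obj} {p q : ℤ} (g : D.Hom x x₁ p) (gs : Chain D x₁ y q)
    (h' : p - 1 + q = m) (h : m + 0 = N) {F : Chain (D.twisted E) (pt x e) (pt y e) (N + 1) → M}
    (hF : Multilin F) : insEdge g gs (.nil e) h' h F = 0 := by
  simp only [insEdge, wsum_cuts_nil, RawCochain.ofFunctor_nil, DGCat.comp_zero]
  exact smul_eq_zero_of_right _ (map_zero (insHeadLin gs hF _ _))

/-- `tau` picks out the first entry `a` of the second chain. The leftover composites are thus, up to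
sign, the products of a leading entry id ⊗ a with a following ε(g; …), and the two cancel in
`ins_bar`. -/
theorem insEdge_cons {x₁ : D.Obj} {e₁ : E.Obj} {p q r s : ℤ} (g : D.Hom x x₁ p)
    (gs : Chain D x₁ y q) (a : E.Hom e e₁ r) (hs : Chain E e₁ e' s) (h'' : r - 1 + s = n)
    (h' : p - 1 + q = m) (h : m + n = N)
    {F : Chain (D.twisted E) (pt x e) (pt y e') (N + 1) → M} (hF : Multilin F) :
    insEdge g gs (.cons a hs h'') h' h F = -(sgn k (m + s) •
      insEps (.cons g gs h') hs rfl fun w => mulHead (right x a) w (by omega : _ = N) F) := by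
  have key := wsum_cuts_tau_fst (x := x) a hs h'' fun {_ r' s'} φ c h => wsum c.cuts fun t =>
    sgn k (p * t.q + q + p + t.p) • insHead gs F ((D.twisted E).comp (eps g t.fst rfl) φ rfl) t.snd
      (by have := t.h; omega)
  refine (key ?_).trans ?_
  · intro z r s c h
    refine wsum_eq_zero _ fun t => ?_
    rw [DGCat.comp_zero]
    exact smul_eq_zero_of_right _ (map_zero (insHeadLin gs hF _ _))
  · rw [insEps, ← wsum_smul, ← wsum_neg]
    refine wsum_congr _ fun t => ?_
    rw [smul_smul, ← sgn_add, ← neg_smul, ← sgn_add_one]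
    refine congrArg₂ _ (sgn_congr ⟨0, ?_⟩) ?_
    · linear_combination h' + t.h
    · rw [RawCochain.comp_ofFunctor_single]
      exact insHead_comp_congr ..

/-- The sum over the insertions is compatible with the bar differential. -/
theorem ins_bar (gs : Chain D x y m) (hs : Chain E e e' n) (h : m + n = N)
    {F : Chain (D.twisted E) (pt x e) (pt y e') (N + 1) → M} (hF : Multilin F) :
    (ins gs hs h fun w => wsum w.bar F) =
      (wsum gs.bar fun c : Chain D x y (m + 1) => ins c hs (by omega) F) +
        sgn k m • wsum hs.bar fun c : Chain E e e' (n + 1) => ins gs c (by omega) F := by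
  have hright : ∀ {e e' : E.Obj} {x : D.Obj} {n : ℤ} (a : E.Hom e e' n),
      (D.twisted E).d (right x a) = right x (E.d a) :=
    fun {_ _ x _} a => ((rightOver E x).map_d a).symm
  induction gs generalizing e n N with
  | nil x =>
    induction hs generalizing N with
    | nil e =>
      obtain rfl : N = 0 := by omega
      rw [ins_nil_nil, wsum_bar_nil, wsum_bar_nil, wsum_bar_nil, smul_zero, add_zero]
    | cons a hs h' ih =>
      have ih := ih rfl (F := fun w => F (.cons (right x a) w (by omega))) (hF.cons _ _)
      simp only [wsum_bar_nil, sgn_zero, one_smul, zero_add (_ : M)] at ih ⊢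
      rw [ins_nil_cons, wsum_bar_cons]
      simp only [wsum_bar_cons, ins_add, ins_smul, ins_mulHead, hright, ins_nil_cons]
      rw [ih, insRight_mulHead (h₂ := h')]
      simp only [insEps, zero_add (_ : M)]
      refine congrArg₂ _ (congrArg₂ _ (by rw [zero_add]) (congrArg _ ?_))
        (wsum_congr _ fun c => (ins_cons_eq ..).trans (ins_cons_eq ..).symm)
      cases hs with
      | nil _ => rfl
      | cons b hs h'' => simp only [mulHead_cons, ins_nil_left]
  | @cons x₁ x₂ y p q m g gs h₀ ih =>
    induction hs generalizing N with
    | nil e =>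
      rw [ins_cons_nil, insEps_bar g gs _ h₀ h hF ih, insEdge_nil g gs h₀ h hF, wsum_bar_nil,
        wsum_bar_nil, wsum_bar_cons]
      simp only [ins_cons_nil, smul_zero, add_zero]
      cases gs with
      | nil _ => rfl
      | cons g₂ gs h₂ => simp only [mulHead_cons, ins_cons_nil]
    | cons a hs h' ih' =>
      -- The edge terms of the insertions that begin with ε(g; …) cancel products in the insertions
      -- that begin with id ⊗ a.
      rw [ins_cons_right, insEps_bar g gs _ h₀ h hF ih, insEdge_cons g gs a hs h' h₀ h hF]
      simp only [wsum_bar_cons (right x₁ a), ins_add, ins_smul, ins_mulHead, hright]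
      rw [ih' ih rfl (F := fun w => F (.cons (right x₁ a) w (by omega))) (hF.cons _ _)]
      have e₁ : (wsum (cons g gs h₀).bar fun c => ins c (cons a hs h') (by omega) F) =
          (wsum (cons g gs h₀).bar fun c => insEps c (cons a hs h') (by omega) F) +
          wsum (cons g gs h₀).bar fun c => ins c hs rfl fun w =>
            F (cons (right x₁ a) w (by omega)) := by
        simp only [ins_cons_right _ a, wsum_add]
      have e₂ : (wsum (cons a hs h').bar fun c => ins (cons g gs h₀) c (by omega) F) =
          (wsum (cons a hs h').bar fun c => insEps (cons g gs h₀) c (by omega) F) +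
          wsum (cons a hs h').bar fun c => insRight (cons g gs h₀) c (by omega) F := by
        simp only [ins_cons_left, wsum_add]
      rw [e₁, e₂, wsum_bar_cons g gs h₀ fun c => insEps c (cons a hs h') _ F,
        wsum_bar_cons a hs h' fun c => insRight (cons g gs h₀) c _ F,
        insRight_mulHead (h₂ := h')]
      simp only [insRight, ins_cons_eq, smul_add, smul_smul, sgn_add]
      abel

end Twisted

/-- The composite of two dg functors with prescribed maps on objects. -/
def DGFunctorOver.comp {k : Type u} [CommRing k] {A B C : DGCat k} {φ : A.Obj → B.Obj}
    {ψ : B.Obj → C.Obj} (F : DGFunctorOver A B φ) (G : DGFunctorOver B C ψ) :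
    DGFunctorOver A C (fun x => ψ (φ x)) where
  map f := G.map (F.map f)
  map_add f f' := by rw [F.map_add, G.map_add]
  map_smul a f := by rw [F.map_smul, G.map_smul]
  map_id x := by rw [F.map_id, G.map_id]
  map_comp g f h := by rw [F.map_comp, G.map_comp]
  map_d f := by rw [F.map_d, G.map_d]

/-- Composition with a dg functor carries Maurer–Cartan elements to Maurer–Cartan elements. Hence it
is compatible with the twisted differentials. -/
theorem RawCochain.map_ofFunctor {k : Type u} [CommRing k] {D A B : DGCat k} {X : D.Obj → A.Obj}
    {ψ : A.Obj → B.Obj} (G : DGFunctorOver D A X) (H : DGFunctorOver A B ψ) {x y : D.Obj} {q n : ℤ}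
    (c : Chain D x y q) (h : 1 + q = n) :
    H.map ((ofFunctor G).app c h) = (ofFunctor (G.comp H)).app c h := by
  cases c with
  | nil x =>
    obtain rfl : n = 1 := by omega
    rw [ofFunctor_nil, ofFunctor_nil, H.map_zero]
  | cons g c h' =>
    rename_i p _
    cases c with
    | nil y =>
      obtain rfl : p = n := by omega
      rw [ofFunctor_single, ofFunctor_single]
      rfl
    | cons g' c h'' => rw [ofFunctor_cons_cons, ofFunctor_cons_cons, H.map_zero]

/-! ### Functoriality of Coh(D, A) in A. -/

namespace DGCat.coh

variable {k : Type u} [CommRing k] {D A B : DGCat k} {ψ : A.Obj → B.Obj} (H : DGFunctorOver A B ψ)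

/-- The image of a dg functor under composition with `H`. -/
abbrev postObj (G : (coh D A).Obj) : (coh D B).Obj :=
  of ⟨fun x => ψ ((fn G).obj x), (fn G).toOver.comp H⟩

/-- The image of a cochain under a dg functor. -/
def postHom {G G' : (coh D A).Obj} {p : ℤ} (φ : (coh D A).Hom G G' p) :
    (coh D B).Hom (postObj H G) (postObj H G') p :=
  mk (G := postObj H G) (G' := postObj H G') (fun _ _ _ _ c h => H.map (app φ c h))
    (fun _ _ _ _ h => (multilin φ _ _ h).map (H.mapLin _ _ _))
    (fun _ _ _ _ _ h hc => (congrArg H.map (app_hasId φ h hc)).trans H.map_zero)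

theorem app_postHom {G G' : (coh D A).Obj} {p q n : ℤ} (φ : (coh D A).Hom G G' p) {x y : D.Obj}
    (c : Chain D x y q) (h : p + q = n) : app (postHom H φ) c h = H.map (app φ c h) :=
  app_mk _ _ _ _ _

/-- The dg functor `Coh(D, A) → Coh(D, B)` induced by a dg functor `A → B`. -/
def post (D : DGCat k) : DGFunctorOver (coh D A) (coh D B) (postObj H) where
  map φ := postHom H φ
  map_add φ φ' := ext fun c h => by
    rw [app_postHom, app_add, app_add, app_postHom, app_postHom, H.map_add]
  map_smul a φ := ext fun c h => by
    rw [app_postHom, app_smul, app_smul, app_postHom, H.map_smul]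
  map_id G := ext fun c h => by
    rw [app_postHom]
    cases c with
    | nil x =>
      subst h
      exact H.map_id _
    | cons g c h' => rw [app_id_cons, app_id_cons, H.map_zero]
  map_comp ψ φ h := ext fun c h' => by
    rw [app_postHom, app_comp, app_comp, H.map_wsum]
    simp only [app_postHom, H.map_smul, H.map_comp]
  map_d φ := ext fun {x y q n} c h => by
    obtain ⟨n, rfl⟩ : ∃ m, n = m + 1 := ⟨n - 1, by omega⟩
    rw [app_postHom, app_d _ _ (by omega), app_d _ _ (by omega)]
    simp only [app_postHom, ← H.mapLin_apply, map_add, map_sub, map_smul, map_wsum]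
    simp only [H.mapLin_apply, H.map_comp, H.map_d, RawCochain.map_ofFunctor]

end DGCat.coh

/-! ### Currying, and the comparison map on cochains. -/

namespace Twisted

open DGCat.coh Chain

variable {k : Type u} [CommRing k] {D E A : DGCat k}

/-- The dg functor `D → Coh(E, A)` that corresponds to a dg functor `D ⊗ E → A`. -/
def curryOver (G : (DGCat.coh (D.twisted E) A).Obj) :
    DGFunctorOver D (DGCat.coh E A) (fun d => postObj (fn G).toOver (of ⟨_, rightOver E d⟩)) :=
  (etaOver D E).comp (post (fn G).toOver E)

theorem app_curryOver (G : (DGCat.coh (D.twisted E) A).Obj) {x y : D.Obj} {e e' : E.Obj}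
    {p q n : ℤ} (g : D.Hom x y p) (c : Chain E e e' q) (h : p + q = n) :
    app ((curryOver G).map g) c h = (fn G).toOver.map (eps g c h) :=
  (app_postHom ..).trans (congrArg _ (app_epsHom ..))

/-- The object of `Coh(D, Coh(E, A))` that corresponds to a dg functor `D ⊗ E → A`. -/
abbrev thetaObj (G : (DGCat.coh (D.twisted E) A).Obj) : (DGCat.coh D (DGCat.coh E A)).Obj :=
  of ⟨_, curryOver G⟩

section Theta

variable {G G' G'' : (DGCat.coh (D.twisted E) A).Obj} {p q r n m : ℤ}

/-- The value of a cochain on `D ⊗ E`, summed over the insertions of a chain in `D` into the chains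
in `E`. -/
def thetaApp (φ : (DGCat.coh (D.twisted E) A).Hom G G' p) {x y : D.Obj} (gs : Chain D x y q)
    (h : p + q = n) : (DGCat.coh E A).Hom ((fn (thetaObj G)).obj x) ((fn (thetaObj G')).obj y) n :=
  mk (G := (fn (thetaObj G)).obj x) (G' := (fn (thetaObj G')).obj y)
    (fun e e' r m hs h' => (ins gs hs rfl fun w => app φ w (by omega : p + (q + r) = m) :
      A.Hom ((fn G).obj (pt x e)) ((fn G').obj (pt y e')) m))
    (fun _ _ _ _ _ => ins_multilin_right gs rfl (multilin φ _ _ _))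
    (fun _ _ _ _ _ _ hc => ins_eq_zero_of_hasId_right gs hc rfl (multilin φ _ _ _)
      fun _ => app_hasId φ _)

theorem app_thetaApp (φ : (DGCat.coh (D.twisted E) A).Hom G G' p) {x y : D.Obj}
    (gs : Chain D x y q) (h : p + q = n) {e e' : E.Obj} (hs : Chain E e e' r) (h' : n + r = m) :
    app (thetaApp φ gs h) hs h' = ins gs hs rfl fun w => app φ w (by omega : p + (q + r) = m) :=
  app_mk _ _ _ _ _

/-- The cochain on `D` with values in cochains on `E` that is given by `thetaApp`. -/
def thetaHom (φ : (DGCat.coh (D.twisted E) A).Hom G G' p) :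
    (DGCat.coh D (DGCat.coh E A)).Hom (thetaObj G) (thetaObj G') p :=
  mk (G := thetaObj G) (G' := thetaObj G') (fun _ _ _ _ gs h => thetaApp φ gs h)
    (fun x y q n h c l H => DGCat.coh.ext fun hs h' => by
      rw [app_wsum]
      simp only [app_thetaApp]
      exact ins_multilin_left hs rfl (multilin φ _ _ _) H)
    (fun x y q n c h H => DGCat.coh.ext fun hs h' => by
      rw [app_thetaApp, app_zero]
      exact ins_eq_zero_of_hasId_left H hs rfl (multilin φ _ _ _) fun _ => app_hasId φ _)

theorem app_thetaHom (φ : (DGCat.coh (D.twisted E) A).Hom G G' p) {x y : D.Obj}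
    (gs : Chain D x y q) (h : p + q = n) : app (thetaHom φ) gs h = thetaApp φ gs h :=
  app_mk _ _ _ _ _

theorem app_app_thetaHom (φ : (DGCat.coh (D.twisted E) A).Hom G G' p) {x y : D.Obj}
    (gs : Chain D x y q) (h : p + q = n) {e e' : E.Obj} (hs : Chain E e e' r) (h' : n + r = m) :
    app (app (thetaHom φ) gs h) hs h' =
      ins gs hs rfl fun w => app φ w (by omega : p + (q + r) = m) := by
  rw [app_thetaHom, app_thetaApp]

end Theta

end Twisted

/-! ### The comparison map is a dg functor; the associator. -/

namespace Twisted

open DGCat.coh Chain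

variable {k : Type u} [CommRing k] {D E A : DGCat k}

section Vanishing

variable {M : Type*} [AddCommGroup M] [Module k M] {x y : D.Obj} {e e' : E.Obj} {m n N : ℤ}

/-- These vanishing lemmas concern functions that see only the empty chain: the unit cochain, or
`ofFunctor` once one entry has been split off. -/
theorem insRight_eq_zero (gs : Chain D x y m) (hs : Chain E e e' n) (h : m + n = N)
    {F : Chain (D.twisted E) (pt x e) (pt y e') N → M}
    (hF : ∀ {z : (D.twisted E).Obj} {p q : ℤ} (a : (D.twisted E).Hom _ z p) (c : Chain _ z _ q)
      (h : p - 1 + q = N), F (.cons a c h) = 0) : insRight gs hs h F = 0 := by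
  cases hs with
  | nil _ => rfl
  | cons a hs h' => simp only [insRight, hF, ins_zero]

theorem insEps_eq_zero (gs : Chain D x y m) (hs : Chain E e e' n) (h : m + n = N)
    {F : Chain (D.twisted E) (pt x e) (pt y e') N → M}
    (hF : ∀ {z : (D.twisted E).Obj} {p q : ℤ} (a : (D.twisted E).Hom _ z p) (c : Chain _ z _ q)
      (h : p - 1 + q = N), F (.cons a c h) = 0) : insEps gs hs h F = 0 := by
  cases gs with
  | nil _ => rfl
  | cons a gs h' => simp only [insEps, hF, ins_zero, smul_zero, wsum_zero]

theorem ins_cons_left_eq_zero {x₁ : D.Obj} {p q : ℤ} (g : D.Hom x x₁ p) (gs : Chain D x₁ y q)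
    (hs : Chain E e e' n) (h' : p - 1 + q = m) (h : m + n = N)
    {F : Chain (D.twisted E) (pt x e) (pt y e') N → M}
    (hF : ∀ {z : (D.twisted E).Obj} {p q : ℤ} (a : (D.twisted E).Hom _ z p) (c : Chain _ z _ q)
      (h : p - 1 + q = N), F (.cons a c h) = 0) : ins (.cons g gs h') hs h F = 0 := by
  rw [ins_cons_left, insEps_eq_zero _ _ _ hF, insRight_eq_zero _ _ _ hF, add_zero]

theorem ins_cons_right_eq_zero {e₁ : E.Obj} {p q : ℤ} (gs : Chain D x y m) (a : E.Hom e e₁ p)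
    (hs : Chain E e₁ e' q) (h' : p - 1 + q = n) (h : m + n = N)
    {F : Chain (D.twisted E) (pt x e) (pt y e') N → M}
    (hF : ∀ {z : (D.twisted E).Obj} {p q : ℤ} (a : (D.twisted E).Hom _ z p) (c : Chain _ z _ q)
      (h : p - 1 + q = N), F (.cons a c h) = 0) : ins gs (.cons a hs h') h F = 0 := by
  rw [ins_cons_right, insEps_eq_zero _ _ _ hF]
  simp only [hF, ins_zero, add_zero]

end Vanishing

section Theta

variable {G G' G'' : (DGCat.coh (D.twisted E) A).Obj} {p q r n m : ℤ}

/-- The part of the curvature of a dg functor on `D ⊗ E` that only involves morphisms of `E`. -/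
def tauRight (G : (DGCat.coh (D.twisted E) A).Obj) {x y : D.Obj} {e e' : E.Obj}
    (gs : Chain D x y q) (hs : Chain E e e' r) (h : 1 + (q + r) = n) :
    A.Hom ((fn G).obj (pt x e)) ((fn G).obj (pt y e')) n :=
  match gs with
  | .nil x => (RawCochain.ofFunctor ((rightOver E x).comp (fn G).toOver)).app hs (by omega)
  | .cons _ _ _ => 0

/-- As `ofFunctor` sees only chains of length one, two kinds of insertions contribute: a single
entry ε(g; hs), or a single entry id ⊗ h with `gs` empty. The first gives the Maurer–Cartan element
that twists Coh(D, Coh(E, A)), the second the one that twists Coh(E, A). -/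
theorem ins_ofFunctor (G : (DGCat.coh (D.twisted E) A).Obj) {x y : D.Obj} {e e' : E.Obj}
    (gs : Chain D x y q) (hs : Chain E e e' r) (h : q + r = m) (h' : 1 + m = n) {l : ℤ}
    (hl : 1 + q = l) :
    (ins gs hs h fun w => (RawCochain.ofFunctor (fn G).toOver).app w h') =
      app ((RawCochain.ofFunctor (curryOver G)).app gs hl) hs (by omega) +
        tauRight G gs hs (by omega) := by
  cases gs with
  | nil x =>
    rw [RawCochain.ofFunctor_nil, app_zero, zero_add, tauRight]
    cases hs with
    | nil e =>
      obtain rfl : m = 0 := by omega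
      rw [ins_nil_nil, RawCochain.ofFunctor_nil, RawCochain.ofFunctor_nil]
    | cons a hs h₁ =>
      rw [ins_nil_cons]
      cases hs with
      | nil e =>
        rename_i s
        obtain rfl : s = n := by omega
        rw [ins_nil_nil, RawCochain.ofFunctor_single, RawCochain.ofFunctor_single]
        rfl
      | cons a' hs h₂ =>
        rw [RawCochain.ofFunctor_cons_cons]
        exact ins_cons_right_eq_zero _ _ _ _ _ fun _ _ _ => RawCochain.ofFunctor_cons_cons ..
  | cons g gs h₁ =>
    rw [tauRight, add_zero, ins_cons_left]
    cases gs with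
    | nil y =>
      rename_i s
      obtain rfl : s = l := by omega
      rw [RawCochain.ofFunctor_single, app_curryOver, insEps, Chain.wsum_cuts_of_snd]
      · have h₂ : insRight (.cons g (.nil y) h₁) hs h (fun w =>
            (RawCochain.ofFunctor (fn G).toOver).app w h') = 0 := by
          cases hs with
          | nil e => rfl
          | cons a hs h₃ =>
            exact ins_cons_left_eq_zero _ _ _ _ _ fun _ _ _ => RawCochain.ofFunctor_cons_cons ..
        rw [h₂, add_zero, ins_nil_nil, mul_zero, sgn_zero, one_smul]
        have h₄ : ∀ {j : ℤ} (hj : s + r = j) (h₅ : j - 1 + 0 = m),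
            (RawCochain.ofFunctor (fn G).toOver).app (.cons (eps g hs hj) (.nil (pt y e')) h₅) h' =
              (fn G).toOver.map (eps g hs (by omega)) := by
          intro j hj h₅
          obtain rfl : j = n := by omega
          rw [RawCochain.ofFunctor_single]
        exact h₄ _ _
      · intro w z p q r m g a b h h'
        rw [ins_cons_right_eq_zero, smul_zero]
        exact fun _ _ _ => RawCochain.ofFunctor_cons_cons ..
    | cons g' gs h₂ =>
      rw [RawCochain.ofFunctor_cons_cons, app_zero]
      have h₃ : insRight (.cons g (.cons g' gs h₂) h₁) hs h (fun w =>
          (RawCochain.ofFunctor (fn G).toOver).app w h') = 0 := by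
        cases hs with
        | nil e => rfl
        | cons a hs h₃ =>
          exact ins_cons_left_eq_zero _ _ _ _ _ fun _ _ _ => RawCochain.ofFunctor_cons_cons ..
      rw [h₃, add_zero, insEps]
      refine wsum_eq_zero _ fun t => smul_eq_zero_of_right _ ?_
      exact ins_cons_left_eq_zero _ _ _ _ _ fun _ _ _ => RawCochain.ofFunctor_cons_cons ..

theorem ins_comp {X Y Z : (D.twisted E).Obj → A.Obj} {x y z : D.Obj} {e e₁ e₂ : E.Obj}
    {q' r' a b i j i' j' l : ℤ} (ψ : RawCochain Y Z b) (φ : RawCochain X Y a) (gs : Chain D x y q)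
    (hs : Chain E e e₁ r) (gs' : Chain D y z q') (hs' : Chain E e₁ e₂ r') (hi : a + (q + r) = i)
    (hj : b + (q' + r') = j) (h : j + i = l) (hi' : a + (q + r) = i') (hj' : b + (q' + r') = j') :
    (ins gs hs rfl fun w => ins gs' hs' rfl fun w' => A.comp (ψ.app w' hj) (φ.app w hi) h) =
      A.comp (ins gs' hs' rfl fun w' => ψ.app w' hj') (ins gs hs rfl fun w => φ.app w hi')
        (by omega) := by
  subst hi hj hi' hj'
  unfold ins
  rw [DGCat.comp_wsum]
  exact wsum_congr _ fun w => (DGCat.wsum_comp _ _ _ _).symm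

theorem ins_app_comp {x y z : D.Obj} {e e₁ e₂ : E.Obj} {q' r' a b i j i' j' l : ℤ}
    (ψ : (DGCat.coh (D.twisted E) A).Hom G' G'' b) (φ : (DGCat.coh (D.twisted E) A).Hom G G' a)
    (gs : Chain D x y q) (hs : Chain E e e₁ r) (gs' : Chain D y z q') (hs' : Chain E e₁ e₂ r')
    (hi : a + (q + r) = i) (hj : b + (q' + r') = j) (h : j + i = l) (hi' : a + (q + r) = i')
    (hj' : b + (q' + r') = j') :
    (ins gs hs rfl fun w => ins gs' hs' rfl fun w' => A.comp (app ψ w' hj) (app φ w hi) h) =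
      A.comp (ins gs' hs' rfl fun w' => app ψ w' hj') (ins gs hs rfl fun w => app φ w hi')
        (by omega) :=
  ins_comp ψ.1 φ.1 gs hs gs' hs' hi hj h hi' hj'

theorem ins_ofFunctor_app {x y z : D.Obj} {e e₁ e₂ : E.Obj} {q' r' a i i' l : ℤ}
    (φ : (DGCat.coh (D.twisted E) A).Hom G G' a) (gs : Chain D x y q) (hs : Chain E e e₁ r)
    (gs' : Chain D y z q') (hs' : Chain E e₁ e₂ r') (hi : a + (q + r) = i)
    (h : 1 + (q' + r') + i = l) (hi' : a + (q + r) = i') :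
    (ins gs hs rfl fun w => ins gs' hs' rfl fun w' =>
      A.comp ((RawCochain.ofFunctor (fn G').toOver).app w' rfl) (app φ w hi) h) =
    A.comp (app ((RawCochain.ofFunctor (curryOver G')).app gs' rfl) hs' rfl)
      (ins gs hs rfl fun w => app φ w hi') (by omega) +
    A.comp (tauRight G' gs' hs' rfl) (ins gs hs rfl fun w => app φ w hi') (by omega) := by
  refine (ins_comp (RawCochain.ofFunctor (fn G').toOver) φ.1 gs hs gs' hs' hi
    rfl h hi' rfl).trans ?_
  rw [ins_ofFunctor G' gs' hs' rfl rfl rfl, A.add_comp]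
  refine congrArg₂ _ ?_ rfl
  rw [comp_app_left]
  rfl

theorem ins_app_ofFunctor {x y z : D.Obj} {e e₁ e₂ : E.Obj} {q' r' b j j' l : ℤ}
    (ψ : (DGCat.coh (D.twisted E) A).Hom G G' b) (gs : Chain D x y q) (hs : Chain E e e₁ r)
    (gs' : Chain D y z q') (hs' : Chain E e₁ e₂ r') (hj : b + (q' + r') = j)
    (h : j + (1 + (q + r)) = l) (hj' : b + (q' + r') = j') :
    (ins gs hs rfl fun w => ins gs' hs' rfl fun w' =>
      A.comp (app ψ w' hj) ((RawCochain.ofFunctor (fn G).toOver).app w rfl) h) =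
    A.comp (ins gs' hs' rfl fun w => app ψ w hj')
      (app ((RawCochain.ofFunctor (curryOver G)).app gs rfl) hs rfl) (by omega) +
    A.comp (ins gs' hs' rfl fun w => app ψ w hj') (tauRight G gs hs rfl) (by omega) := by
  refine (ins_comp ψ.1 (RawCochain.ofFunctor (fn G).toOver) gs hs gs' hs' rfl hj h rfl hj').trans ?_
  rw [ins_ofFunctor G gs hs rfl rfl rfl, A.comp_add]
  refine congrArg₂ _ ?_ rfl
  exact comp_app_right ((RawCochain.ofFunctor (curryOver G)).app gs rfl) hs _ _ _

/-- By `ins_cuts`, a cut of an inserted chain is a pair of cuts. The Koszul signs of the cup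
products in the D direction and in the E direction combine to that of the cup product on D ⊗ E. -/
theorem thetaHom_comp (ψ : (DGCat.coh (D.twisted E) A).Hom G' G'' q)
    (φ : (DGCat.coh (D.twisted E) A).Hom G G' p) (h : q + p = n) :
    thetaHom ((DGCat.coh (D.twisted E) A).comp ψ φ h) =
      (DGCat.coh D (DGCat.coh E A)).comp (thetaHom ψ) (thetaHom φ) h :=
  DGCat.coh.ext fun {x y i l} gs h' => DGCat.coh.ext fun {e e' j m} hs h'' => by
    rw [app_app_thetaHom, app_comp, app_wsum]
    simp only [app_smul, app_comp, app_app_thetaHom]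
    rw [ins_cuts]
    refine wsum_congr _ fun s => ?_
    rw [← wsum_smul]
    refine wsum_congr _ fun t => ?_
    simp only [ins_smul]
    rw [smul_smul, smul_smul, ← sgn_add, ← sgn_add,
      sgn_congr (show Even (s.p * t.q + p * (s.q + t.q) - (p * s.q + (p + s.p) * t.q)) from
        ⟨0, by ring⟩)]
    refine congrArg _ ?_
    exact ins_app_comp ψ φ s.fst t.fst s.snd t.snd rfl rfl
      (by have := s.h; have := t.h; omega : _ = m) (by omega : _ = p + s.p + t.p)
      (by omega : _ = q + s.q + t.q)

/-- By `ins_ofFunctor`, an outer term of the differential on D ⊗ E splits into an outer term in the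
D direction and one in the E direction. In the latter all of `gs` is consumed by `φ`, because
`tauRight` vanishes on nonempty chains. -/
theorem ins_ofFunctor_comp (φ : (DGCat.coh (D.twisted E) A).Hom G G' p) {x y : D.Obj}
    {e e' : E.Obj} (gs : Chain D x y m) (hs : Chain E e e' r) (h : 1 + p + (m + r) = n) :
    (ins gs hs rfl fun w => wsum w.cuts fun s => sgn k (p * s.q) •
      A.comp ((RawCochain.ofFunctor (fn G').toOver).app s.snd rfl) (app φ s.fst rfl)
        (by have := s.h; omega : _ = n)) =
    (wsum gs.cuts fun s => sgn k (p * s.q) • wsum hs.cuts fun t => sgn k ((p + s.p) * t.q) •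
      A.comp (app ((RawCochain.ofFunctor (curryOver G')).app s.snd rfl) t.snd rfl)
        (app (app (thetaHom φ) s.fst rfl) t.fst rfl)
        (by have := s.h; have := t.h; omega : _ = n)) +
    wsum hs.cuts fun t => sgn k ((p + m) * t.q) •
      A.comp ((RawCochain.ofFunctor ((rightOver E y).comp (fn G').toOver)).app t.snd rfl)
        (app (app (thetaHom φ) gs rfl) t.fst rfl) (by have := t.h; omega : _ = n) := by
  rw [ins_cuts]
  have key : ∀ (s : Chain.Split D x y m) (t : Chain.Split E e e' r),
      (sgn k (s.p * t.q) • ins s.fst t.fst rfl fun w => ins s.snd t.snd rfl fun w' =>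
        sgn k (p * (s.q + t.q)) • A.comp ((RawCochain.ofFunctor (fn G').toOver).app w' rfl)
          (app φ w rfl) (by have := s.h; have := t.h; omega : _ = n)) =
      sgn k (p * s.q) • (sgn k ((p + s.p) * t.q) • A.comp
        (app ((RawCochain.ofFunctor (curryOver G')).app s.snd rfl) t.snd rfl)
        (app (app (thetaHom φ) s.fst rfl) t.fst rfl)
        (by have := s.h; have := t.h; omega : _ = n)) +
      sgn k (p * s.q) • (sgn k ((p + s.p) * t.q) • A.comp
        (tauRight G' s.snd t.snd rfl) (app (app (thetaHom φ) s.fst rfl) t.fst rfl)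
        (by have := s.h; have := t.h; omega : _ = n)) := by
    intro s t
    simp only [ins_smul]
    rw [← smul_add, ← smul_add, smul_smul, smul_smul, ← sgn_add, ← sgn_add,
      sgn_congr (show Even (s.p * t.q + p * (s.q + t.q) - (p * s.q + (p + s.p) * t.q)) from
        ⟨0, by ring⟩)]
    refine congrArg _ ?_
    rw [app_app_thetaHom]
    exact ins_ofFunctor_app φ _ _ _ _ _ _ _
  refine (wsum_congr _ fun s => wsum_congr _ fun t => key s t).trans ?_
  simp only [wsum_add, wsum_smul]
  refine congrArg _ ?_
  rw [Chain.wsum_cuts_of_snd]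
  · simp only [mul_zero, sgn_zero, one_smul, tauRight]
    have key : ∀ (t : Chain.Split E e e' r) {i : ℤ} (hi : 1 + (0 + t.q) = i) (hi' : 1 + t.q = i)
        {j : ℤ} (f : A.Hom ((fn G).obj (pt x e)) ((fn G').obj (pt y t.mid)) j) (hj : i + j = n),
        A.comp ((RawCochain.ofFunctor ((rightOver E y).comp (fn G').toOver)).app t.snd hi') f hj =
        A.comp ((RawCochain.ofFunctor ((rightOver E y).comp (fn G').toOver)).app t.snd rfl) f
          (by omega) := by
      intro t i hi hi' j f hj
      subst hi'; rfl
    exact wsum_congr _ fun t => congrArg _ (key t rfl _ _ _)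
  · intro w z p q r m g a b h h'
    simp only [tauRight, DGCat.zero_comp, smul_zero, wsum_zero]

theorem ins_comp_ofFunctor (φ : (DGCat.coh (D.twisted E) A).Hom G G' p) {x y : D.Obj}
    {e e' : E.Obj} (gs : Chain D x y m) (hs : Chain E e e' r) (h : p + 1 + (m + r) = n) :
    (ins gs hs rfl fun w => wsum w.cuts fun s => sgn k (1 * s.q) •
      A.comp (app φ s.snd rfl) ((RawCochain.ofFunctor (fn G).toOver).app s.fst rfl)
        (by have := s.h; omega : _ = n)) =
    (wsum gs.cuts fun s => sgn k (1 * s.q) • wsum hs.cuts fun t => sgn k ((1 + s.p) * t.q) •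
      A.comp (app (app (thetaHom φ) s.snd rfl) t.snd rfl)
        (app ((RawCochain.ofFunctor (curryOver G)).app s.fst rfl) t.fst rfl)
        (by have := s.h; have := t.h; omega : _ = n)) +
    sgn k m • wsum hs.cuts fun t => sgn k (1 * t.q) •
      A.comp (app (app (thetaHom φ) gs rfl) t.snd rfl)
        ((RawCochain.ofFunctor ((rightOver E x).comp (fn G).toOver)).app t.fst rfl)
        (by have := t.h; omega : _ = n) := by
  rw [ins_cuts]
  have key : ∀ (s : Chain.Split D x y m) (t : Chain.Split E e e' r),
      (sgn k (s.p * t.q) • ins s.fst t.fst rfl fun w => ins s.snd t.snd rfl fun w' =>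
        sgn k (1 * (s.q + t.q)) • A.comp (app φ w' rfl)
          ((RawCochain.ofFunctor (fn G).toOver).app w rfl)
          (by have := s.h; have := t.h; omega : _ = n)) =
      sgn k (1 * s.q) • (sgn k ((1 + s.p) * t.q) • A.comp
        (app (app (thetaHom φ) s.snd rfl) t.snd rfl)
        (app ((RawCochain.ofFunctor (curryOver G)).app s.fst rfl) t.fst rfl)
        (by have := s.h; have := t.h; omega : _ = n)) +
      sgn k (1 * s.q) • (sgn k ((1 + s.p) * t.q) • A.comp
        (app (app (thetaHom φ) s.snd rfl) t.snd rfl) (tauRight G s.fst t.fst rfl)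
        (by have := s.h; have := t.h; omega : _ = n)) := by
    intro s t
    simp only [ins_smul]
    rw [← smul_add, ← smul_add, smul_smul, smul_smul, ← sgn_add, ← sgn_add,
      sgn_congr (show Even (s.p * t.q + 1 * (s.q + t.q) - (1 * s.q + (1 + s.p) * t.q)) from
        ⟨0, by ring⟩)]
    refine congrArg _ ?_
    rw [app_app_thetaHom]
    exact ins_app_ofFunctor φ _ _ _ _ _ _ _
  refine (wsum_congr _ fun s => wsum_congr _ fun t => key s t).trans ?_
  simp only [wsum_add, wsum_smul]
  refine congrArg _ ?_
  rw [Chain.wsum_cuts_of_fst]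
  · simp only [one_mul, add_zero, tauRight]
    have key : ∀ (t : Chain.Split E e e' r) {i : ℤ} (hi : 1 + (0 + t.p) = i) (hi' : 1 + t.p = i)
        {j : ℤ} (f : A.Hom ((fn G).obj (pt x t.mid)) ((fn G').obj (pt y e')) j) (hj : j + i = n),
        A.comp f ((RawCochain.ofFunctor ((rightOver E x).comp (fn G).toOver)).app t.fst hi') hj =
        A.comp f ((RawCochain.ofFunctor ((rightOver E x).comp (fn G).toOver)).app t.fst rfl)
          (by omega) := by
      intro t i hi hi' j f hj
      subst hi'; rfl
    exact congrArg _ (wsum_congr _ fun t => congrArg _ (key t rfl _ _ _))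
  · intro w z p q r m g a b h h'
    simp only [tauRight, DGCat.comp_zero, smul_zero, wsum_zero]

theorem ins_app_congr (φ : (DGCat.coh (D.twisted E) A).Hom G G' p) {x y : D.Obj}
    {e e' : E.Obj} (gs : Chain D x y m) (hs : Chain E e e' r) {l : ℤ} (h : m + r = l)
    (h' : p + l = n) : (ins gs hs h fun w => app φ w h') =
      ins gs hs rfl fun w => app φ w (by omega : p + (m + r) = n) := by
  subst h; rfl

/-- The differential of A corresponds to itself. The bar term splits by `ins_bar`, and the two outer
terms by `ins_ofFunctor_comp` and `ins_comp_ofFunctor`, each into a part in the D direction and a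
part in the E direction. -/
theorem thetaHom_d (φ : (DGCat.coh (D.twisted E) A).Hom G G' p) :
    thetaHom ((DGCat.coh (D.twisted E) A).d φ) =
      (DGCat.coh D (DGCat.coh E A)).d (thetaHom φ) :=
  DGCat.coh.ext fun {x y m m'} gs h => DGCat.coh.ext fun {e e' r n} hs h' => by
    obtain ⟨n, rfl⟩ : ∃ l, n = l + 1 := ⟨n - 1, by omega⟩
    obtain ⟨m', rfl⟩ : ∃ l, m' = l + 1 := ⟨m' - 1, by omega⟩
    obtain rfl : p + m = m' := by omega
    have h₁ : p + (m + r) = n := by omega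
    have hd := app_d (app (thetaHom φ) gs rfl) hs (by omega : p + m + r = n) h'
    have hl : app (app (thetaHom ((DGCat.coh (D.twisted E) A).d φ)) gs h) hs h' =
        ins gs hs rfl fun w => app ((DGCat.coh (D.twisted E) A).d φ) w (by omega) :=
      app_app_thetaHom _ _ _ _ _
    have hd' : ∀ w : Chain (D.twisted E) (pt x e) (pt y e') (m + r), _ := fun w =>
      app_d φ w h₁ (by omega)
    rw [hl, app_d _ _ rfl, app_sub, app_add, app_add, hd, app_smul, app_smul, app_wsum, app_wsum,
      app_wsum, ins_congr _ _ _ hd']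
    have hA : (ins gs hs rfl fun w => A.d (app φ w h₁)) = A.d (app (app (thetaHom φ) gs rfl) hs
        (by omega : p + m + r = n)) := by
      rw [app_app_thetaHom]
      exact (map_ins gs hs rfl (A.dLin _ _ n) fun w => app φ w h₁).symm
    have hB := ins_bar gs hs rfl (multilin φ (pt x e) (pt y e')
      (by omega : p + (m + r + 1) = n + 1))
    have hi : ∀ {q s : ℤ} (gs : Chain D x y q) (hs : Chain E e e' s) (h : q + s = m + r + 1),
        (ins gs hs h fun w => app φ w (by omega : p + (m + r + 1) = n + 1)) =
          ins gs hs rfl fun w => app φ w (by omega : p + (q + s) = n + 1) := by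
      intro q s gs hs h
      exact ins_app_congr φ gs hs h _
    simp only [hi] at hB
    have hC := ins_ofFunctor_comp φ gs hs (by omega : _ = n + 1)
    have hD := ins_comp_ofFunctor φ gs hs (by omega : _ = n + 1)
    simp only [sub_eq_add_neg, ← neg_smul]
    rw [ins_add, ins_add, ins_add, ins_smul, ins_smul, hA, hB, hC, hD]
    simp only [app_smul, app_comp, app_app_thetaHom]
    rw [sgn_add p m]
    -- On the right, the first four summands are the differential in Coh(E, A) of a value of degree
    -- p + m. The last three are the bar term and the outer terms in the D direction.
    have key : ∀ a b₁ b₂ c₁ c₂ d₁ d₂ : A.Hom ((fn G).obj (pt x e)) ((fn G').obj (pt y e')) (n + 1),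
        a + sgn k p • (b₁ + sgn k m • b₂) + (c₁ + c₂) + -sgn k p • (d₁ + sgn k m • d₂) =
        a + (sgn k p * sgn k m) • b₂ + c₂ + -(sgn k p * sgn k m) • d₂ + sgn k p • b₁ + c₁ +
          -sgn k p • d₁ := by
      intro a b₁ b₂ c₁ c₂ d₁ d₂
      module
    exact key _ _ _ _ _ _ _

theorem thetaHom_id (G : (DGCat.coh (D.twisted E) A).Obj) :
    thetaHom ((DGCat.coh (D.twisted E) A).id G) = (DGCat.coh D (DGCat.coh E A)).id (thetaObj G) :=
  DGCat.coh.ext fun {x y q n} gs h => DGCat.coh.ext fun {e e' r m} hs h' => by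
    rw [app_app_thetaHom]
    cases gs with
    | cons g gs h₁ =>
      rw [app_id_cons, app_zero]
      exact ins_cons_left_eq_zero _ _ _ _ _ fun a c h₂ => app_id_cons a c h₂ _
    | nil x =>
      obtain rfl : n = 0 := by omega
      rw [app_id_nil]
      cases hs with
      | cons a hs h₁ =>
        rw [app_id_cons]
        exact ins_cons_right_eq_zero _ _ _ _ _ fun a c h₂ => app_id_cons a c h₂ _
      | nil e =>
        obtain rfl : m = 0 := by omega
        rw [ins_nil_nil]
        exact app_id_nil _ _

/-- The comparison dg functor `Coh(D ⊗ E, A) → Coh(D, Coh(E, A))`. -/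
def theta (D E A : DGCat k) :
    DGFunctorOver (DGCat.coh (D.twisted E) A) (DGCat.coh D (DGCat.coh E A)) thetaObj where
  map φ := thetaHom φ
  map_add φ φ' := DGCat.coh.ext fun gs h => DGCat.coh.ext fun hs h' => by
    simp only [app_add, app_app_thetaHom, ins_add]
  map_smul a φ := DGCat.coh.ext fun gs h => DGCat.coh.ext fun hs h' => by
    simp only [app_smul, app_app_thetaHom, ins_smul]
  map_id := thetaHom_id
  map_comp := thetaHom_comp
  map_d := thetaHom_d

end Theta

/-- The associativity dg functor. -/
def assoc (C D E : DGCat k) : DGFunctorOver ((C.twisted D).twisted E) (C.twisted (D.twisted E))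
    (fun x => pt x.1.1 (pt x.1.2 x.2)) :=
  uncurry (uncurry ((etaOver C (D.twisted E)).comp (theta D E (C.twisted (D.twisted E)))))

section Assoc

variable {C : DGCat k}

theorem assoc_right (c : C.Obj) (d : D.Obj) {e e' : E.Obj} {n : ℤ} (h : E.Hom e e' n) :
    (assoc C D E).map (right (pt c d) h) = right c (right d h) := rfl

theorem assoc_eps_right (c : C.Obj) {x y : D.Obj} {e e' : E.Obj} {p q n : ℤ} (g : D.Hom x y p)
    (hs : Chain E e e' q) (h : p + q = n) :
    (assoc C D E).map (eps (right c g) hs h) = right c (eps g hs h) :=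
  app_curryOver (G := of ⟨_, rightOver (D.twisted E) c⟩) g hs h

theorem assoc_eps_eps {a b : C.Obj} {x y : D.Obj} {e e' : E.Obj} {p q r i n : ℤ}
    (f : C.Hom a b p) (gs : Chain D x y q) (hs : Chain E e e' r) (hi : p + q = i) (h : i + r = n) :
    (assoc C D E).map (eps (eps f gs hi) hs h) =
      ins gs hs rfl fun w => eps f w (by omega : p + (q + r) = n) :=
  (app_app_thetaHom (epsHom (D.twisted E) f) gs hi hs h).trans
    (ins_congr _ _ _ fun w => app_epsHom f w _)

theorem isAssociator_assoc (C D E : DGCat k) : IsAssociator (assoc C D E) where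
  map_right := assoc_right
  map_eps_right := assoc_eps_right
  map_eps_eps := assoc_eps_eps

end Assoc

end Twisted

/-! ## Generation by the generators -/

/-- A family of homogeneous morphisms that is a dg subcategory with all the objects. -/
structure DGCat.IsSub {k : Type u} [CommRing k] (A : DGCat k)
    (S : ∀ ⦃x y : A.Obj⦄ ⦃n : ℤ⦄, A.Hom x y n → Prop) : Prop where
  id : ∀ x, S (A.id x)
  comp : ∀ {x y z : A.Obj} {p q n : ℤ} (g : A.Hom y z q) (f : A.Hom x y p) (h : q + p = n),
    S g → S f → S (A.comp g f h)
  d : ∀ {x y : A.Obj} {n : ℤ} (f : A.Hom x y n), S f → S (A.d f)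
  zero : ∀ {x y : A.Obj} {n : ℤ}, S (0 : A.Hom x y n)
  add : ∀ {x y : A.Obj} {n : ℤ} (f g : A.Hom x y n), S f → S g → S (f + g)
  smul : ∀ {x y : A.Obj} {n : ℤ} (a : k) (f : A.Hom x y n), S f → S (a • f)

namespace DGCat.IsSub

variable {k : Type u} [CommRing k] {A B : DGCat k}

theorem neg {S : ∀ ⦃x y : A.Obj⦄ ⦃n : ℤ⦄, A.Hom x y n → Prop} (hS : A.IsSub S) {x y : A.Obj} {n : ℤ}
    {f : A.Hom x y n} (hf : S f) : S (-f) := by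
  rw [← neg_one_smul k]; exact hS.smul _ _ hf

theorem sub {S : ∀ ⦃x y : A.Obj⦄ ⦃n : ℤ⦄, A.Hom x y n → Prop} (hS : A.IsSub S) {x y : A.Obj} {n : ℤ}
    {f g : A.Hom x y n} (hf : S f) (hg : S g) : S (f - g) := by
  rw [sub_eq_add_neg]; exact hS.add _ _ hf (hS.neg hg)

theorem wsum {S : ∀ ⦃x y : A.Obj⦄ ⦃n : ℤ⦄, A.Hom x y n → Prop} (hS : A.IsSub S) {ι : Type*}
    {x y : A.Obj} {n : ℤ} (l : List (k × ι)) (f : ι → A.Hom x y n) (hf : ∀ i, S (f i)) :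
    S (wsum l f) := by
  induction l with
  | nil => exact hS.zero
  | cons w l ih => rw [wsum_cons]; exact hS.add _ _ (hS.smul _ _ (hf _)) ih

theorem equalizer {φ : A.Obj → B.Obj} (F G : DGFunctorOver A B φ) :
    A.IsSub fun _ _ _ f => F.map f = G.map f where
  id x := by rw [F.map_id, G.map_id]
  comp g f h hg hf := by rw [F.map_comp, G.map_comp, hg, hf]
  d f hf := by rw [F.map_d, G.map_d, hf]
  zero := by intros; rw [F.map_zero, G.map_zero]
  add f g hf hg := by rw [F.map_add, G.map_add, hf, hg]
  smul a f hf := by rw [F.map_smul, G.map_smul, hf]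

theorem of_unit {S : ∀ ⦃x y : (DGCat.unit k).Obj⦄ ⦃n : ℤ⦄, (DGCat.unit k).Hom x y n → Prop}
    (hS : (DGCat.unit k).IsSub S) {x y : (DGCat.unit k).Obj} {n : ℤ}
    (f : (DGCat.unit k).Hom x y n) : S f := by
  by_cases hn : n = 0
  · subst hn
    have : f = (f.1 : k) • (DGCat.unit k).id x := Subtype.ext (mul_one f.1).symm
    rw [this]
    exact hS.smul _ _ (hS.id x)
  · have : f = 0 := Subtype.ext (f.2 hn)
    rw [this]
    exact hS.zero

end DGCat.IsSub

namespace Twisted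

open DGCat.coh Chain

variable {k : Type u} [CommRing k] {C D E A B : DGCat k}

theorem isSub_induction {S : ∀ ⦃x y : (C.twisted D).Obj⦄ ⦃n : ℤ⦄, (C.twisted D).Hom x y n → Prop}
    (hS : (C.twisted D).IsSub S)
    (hr : ∀ (c : C.Obj) {x y : D.Obj} {n : ℤ} (g : D.Hom x y n), S (right c g))
    (he : ∀ {a b : C.Obj} {p : ℤ} (f : C.Hom a b p) {x y : D.Obj} {q n : ℤ} (c : Chain D x y q)
      (h : p + q = n), S (eps f c h)) {x y : (C.twisted D).Obj} {n : ℤ}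
    (s : (C.twisted D).Hom x y n) : S s := by
  induction s using Mor.ind with
  | h s =>
    induction s with
    | right c g => exact hr c g
    | eps f c h => exact he f c h
    | id x => exact hS.id x
    | comp t s h iht ihs => exact hS.comp _ _ h iht ihs
    | d s ih => exact hS.d _ ih
    | zero => exact hS.zero
    | add s t ihs iht => exact hS.add _ _ ihs iht
    | neg s ih => exact hS.neg ih
    | smul a s ih => exact hS.smul a _ ih

theorem isSub_tau {S : ∀ ⦃x y : (C.twisted D).Obj⦄ ⦃n : ℤ⦄, (C.twisted D).Hom x y n → Prop}
    (hS : (C.twisted D).IsSub S)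
    (hr : ∀ (c : C.Obj) {x y : D.Obj} {n : ℤ} (g : D.Hom x y n), S (right c g)) (c : C.Obj)
    {x y : D.Obj} {q n : ℤ} (w : Chain D x y q) (h : 1 + q = n) : S ((tau D c).app w h) := by
  rw [tau]
  cases w with
  | nil x => rw [RawCochain.ofFunctor_nil]; exact hS.zero
  | cons g w h' =>
    rename_i p _
    cases w with
    | nil y =>
      obtain rfl : p = n := by omega
      rw [RawCochain.ofFunctor_single]
      exact hr c g
    | cons g' w h'' => rw [RawCochain.ofFunctor_cons_cons]; exact hS.zero

/-- The morphisms `f` for which all `ε(f; g₁, …, g_N)` belong to a dg subcategory that contains the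
morphisms `id_c ⊗ g` form a dg subcategory. -/
theorem isSub_eps {S : ∀ ⦃x y : (C.twisted D).Obj⦄ ⦃n : ℤ⦄, (C.twisted D).Hom x y n → Prop}
    (hS : (C.twisted D).IsSub S)
    (hr : ∀ (c : C.Obj) {x y : D.Obj} {n : ℤ} (g : D.Hom x y n), S (right c g)) :
    C.IsSub fun _ _ p f => ∀ {x y : D.Obj} {q n : ℤ} (c : Chain D x y q) (h : p + q = n),
      S (eps f c h) where
  id a x y q n c h := by
    cases c with
    | nil x => subst h; rw [eps_id_nil]; exact hS.id _
    | cons g c h' => rw [eps_id_cons]; exact hS.zero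
  comp g f hp hg hf x y q n c h := by
    rw [eps_comp]
    exact hS.wsum _ _ fun s => hS.smul _ _ (hS.comp _ _ _ (hg _ _) (hf _ _))
  d {_ _ p} f hf x y q n c h := by
    obtain ⟨n, rfl⟩ : ∃ m, n = m + 1 := ⟨n - 1, by omega⟩
    -- The relation expresses ε(df; …) through dε(f; …), through ε(f; …) on other chains, and
    -- through composites with morphisms id ⊗ g, all of which lie in the subcategory.
    have key := d_eps f c (by omega : p + q = n) h
    have e : ∀ {M : Type u} [AddCommGroup M] {a b c d e : M}, a = b - c - d + e →
        b = a + c + d - e := by rintro M _ a b c d e rfl; abel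
    rw [e key]
    refine hS.sub (hS.add _ _ (hS.add _ _ (hS.d _ (hf _ _)) (hS.smul _ _ ?_)) ?_) (hS.smul _ _ ?_)
    · exact hS.wsum _ _ fun c' => hf _ _
    · exact hS.wsum _ _ fun s => hS.smul _ _ (hS.comp _ _ _ (isSub_tau hS hr _ _ _) (hf _ _))
    · exact hS.wsum _ _ fun s => hS.smul _ _ (hS.comp _ _ _ (hf _ _) (isSub_tau hS hr _ _ _))
  zero {_ _ p} x y q n c h := by
    rw [show eps (0 : C.Hom _ _ p) c h = 0 from map_zero (epsLin _ _ c h)]; exact hS.zero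
  add f g hf hg x y q n c h := by rw [eps_add]; exact hS.add _ _ (hf c h) (hg c h)
  smul a f hf x y q n c h := by rw [eps_smul]; exact hS.smul _ _ (hf c h)

theorem hom_ext {φ : (C.twisted D).Obj → A.Obj} {F G : DGFunctorOver (C.twisted D) A φ}
    (hr : ∀ (c : C.Obj) {x y : D.Obj} {n : ℤ} (g : D.Hom x y n),
      F.map (right c g) = G.map (right c g))
    (he : ∀ {a b : C.Obj} {p : ℤ} (f : C.Hom a b p) {x y : D.Obj} {q n : ℤ} (c : Chain D x y q)
      (h : p + q = n), F.map (eps f c h) = G.map (eps f c h)) : F = G :=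
  DGFunctorOver.ext fun s => isSub_induction (.equalizer F G) hr he s

/-- In a generator ε(f; …) of the outer product, f is an arbitrary morphism of C ⊗ D. By `isSub_eps`
the good f form a dg subcategory, so f may be taken among the generators. The four-fold version
repeats the argument. -/
theorem hom_ext₃ {φ : ((C.twisted D).twisted E).Obj → A.Obj}
    {F G : DGFunctorOver ((C.twisted D).twisted E) A φ}
    (hr : ∀ (c : C.Obj) (d : D.Obj) {x y : E.Obj} {n : ℤ} (g : E.Hom x y n),
      F.map (right (pt c d) g) = G.map (right (pt c d) g))
    (her : ∀ (c : C.Obj) {x y : D.Obj} {p : ℤ} (g : D.Hom x y p) {e e' : E.Obj} {q n : ℤ}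
      (hs : Chain E e e' q) (h : p + q = n),
      F.map (eps (right c g) hs h) = G.map (eps (right c g) hs h))
    (hee : ∀ {a b : C.Obj} {p : ℤ} (f : C.Hom a b p) {x y : D.Obj} {q i : ℤ} (gs : Chain D x y q)
      (hi : p + q = i) {e e' : E.Obj} {r n : ℤ} (hs : Chain E e e' r) (h : i + r = n),
      F.map (eps (eps f gs hi) hs h) = G.map (eps (eps f gs hi) hs h)) : F = G :=
  hom_ext (fun c => hr c.1 c.2) fun f => isSub_induction
    (isSub_eps (.equalizer F G) fun c => hr c.1 c.2) her hee f

theorem hom_ext₄ {φ : (((A.twisted C).twisted D).twisted E).Obj → B.Obj}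
    {F G : DGFunctorOver (((A.twisted C).twisted D).twisted E) B φ}
    (hr : ∀ (a : A.Obj) (c : C.Obj) (d : D.Obj) {x y : E.Obj} {n : ℤ} (g : E.Hom x y n),
      F.map (right (pt (pt a c) d) g) = G.map (right (pt (pt a c) d) g))
    (her : ∀ (a : A.Obj) (c : C.Obj) {x y : D.Obj} {p : ℤ} (g : D.Hom x y p) {e e' : E.Obj}
      {q n : ℤ} (hs : Chain E e e' q) (h : p + q = n),
      F.map (eps (right (pt a c) g) hs h) = G.map (eps (right (pt a c) g) hs h))
    (heer : ∀ (a : A.Obj) {z z' : C.Obj} {p : ℤ} (f : C.Hom z z' p) {x y : D.Obj} {q i : ℤ}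
      (gs : Chain D x y q) (hi : p + q = i) {e e' : E.Obj} {r n : ℤ} (hs : Chain E e e' r)
      (h : i + r = n), F.map (eps (eps (right a f) gs hi) hs h) =
        G.map (eps (eps (right a f) gs hi) hs h))
    (heee : ∀ {a b : A.Obj} {p : ℤ} (f : A.Hom a b p) {x y : C.Obj} {q i : ℤ} (gs : Chain C x y q)
      (hi : p + q = i) {z z' : D.Obj} {r j : ℤ} (hs : Chain D z z' r) (hj : i + r = j)
      {e e' : E.Obj} {s n : ℤ} (ks : Chain E e e' s) (h : j + s = n),
      F.map (eps (eps (eps f gs hi) hs hj) ks h) = G.map (eps (eps (eps f gs hi) hs hj) ks h)) :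
    F = G :=
  hom_ext₃ (fun c => hr c.1 c.2) (fun c => her c.1 c.2) fun f => isSub_induction
    (isSub_eps (isSub_eps (.equalizer F G) fun c => hr c.1.1 c.1.2 c.2) fun c => her c.1 c.2)
    heer heee f

end Twisted

/-! ### Naturality of insertions, and insertions with an empty chain. -/

namespace Chain

variable {k : Type u} [CommRing k] {D D' D'' : DGCat k}

theorem map_map {φ : D.Obj → D'.Obj} {ψ : D'.Obj → D''.Obj} (F : DGFunctorOver D D' φ)
    (G : DGFunctorOver D' D'' ψ) {x y : D.Obj} {n : ℤ} (c : Chain D x y n) :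
    (c.map F).map G = c.map (F.comp G) := by
  induction c with
  | nil x => rfl
  | cons g c h ih => exact congrArg (fun c => cons (G.map (F.map g)) c h) ih

theorem map_eq_self (F : DGFunctorOver D D fun x => x)
    (hF : ∀ {x y : D.Obj} {n : ℤ} (f : D.Hom x y n), F.map f = f) {x y : D.Obj} {n : ℤ}
    (c : Chain D x y n) : c.map F = c := by
  induction c with
  | nil x => rfl
  | cons g c h ih => exact congrArg₂ (fun g c => cons g c h) (hF g) ih

end Chain

namespace Twisted

open DGCat.coh Chain

variable {k : Type u} [CommRing k]

section Naturality

variable {D E D' E' : DGCat k} {φ : D.Obj → D'.Obj} {ψ : E.Obj → E'.Obj}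
  (F : DGFunctorOver D D' φ) (G : DGFunctorOver E E' ψ)

theorem prependRight_map (d : D.Obj) {e e' : E.Obj} {z : (D.twisted E).Obj} {m n N : ℤ}
    (c : Chain E e e' m) (w : Chain (D.twisted E) (pt d e') z n) (h : m + n = N) :
    (prependRight d c w h).map (mapOver F G) =
      prependRight (φ d) (c.map G) (w.map (mapOver F G)) h := by
  induction c generalizing n N with
  | nil x =>
    obtain rfl : n = N := by omega
    rfl
  | cons g c h' ih => exact congrArg (fun w => Chain.cons (right (φ d) (G.map g)) w _) (ih w rfl)

theorem insertions_map {x y : D.Obj} {e e' : E.Obj} {m n N : ℤ} (gs : Chain D x y m)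
    (hs : Chain E e e' n) (h : m + n = N) :
    insertions (gs.map F) (hs.map G) h =
      (insertions gs hs h).map fun w => (w.1, w.2.map (mapOver F G)) := by
  induction gs generalizing e n N with
  | nil x => simp only [insertions, Chain.map, List.map_cons, List.map_nil, prependRight_map]
  | cons g gs h' ih =>
    simp only [insertions, Chain.map, Chain.splits_map, List.map_flatMap, List.flatMap_map,
      List.map_map, Function.comp_def, prependRight_map, Chain.Split.map]
    refine congrArg (fun f => List.flatMap f hs.splits) (funext fun s => ?_)
    refine congrArg (fun f => List.flatMap f s.snd.splits) (funext fun t => ?_)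
    refine (congrArg (List.map _) (ih t.snd rfl)).trans ?_
    rw [List.map_map]
    rfl

theorem ins_map {M : Type*} [AddCommGroup M] [Module k M] {x y : D.Obj} {e e' : E.Obj} {m n N : ℤ}
    (gs : Chain D x y m) (hs : Chain E e e' n) (h : m + n = N)
    (K : Chain (D'.twisted E') (pt (φ x) (ψ e)) (pt (φ y) (ψ e')) N → M) :
    ins (gs.map F) (hs.map G) h K = ins gs hs h fun w => K (w.map (mapOver F G)) := by
  rw [ins, insertions_map]
  exact wsum_map _ _ _

end Naturality

variable {C D E : DGCat k}

/-- The dg functor `- ⊗ id_e`. -/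
def leftOver (D : DGCat k) {E : DGCat k} (e : E.Obj) :
    DGFunctorOver D (D.twisted E) (fun x => pt x e) where
  map {_ _ n} f := eps f (.nil e) (Int.add_zero n)
  map_add f f' := eps_add _ _ _ _
  map_smul a f := eps_smul _ _ _ _
  map_id x := eps_id_nil x e _
  map_comp g f h := by
    rw [eps_comp, wsum_cuts_nil, mul_zero, sgn_zero, one_smul]
    have : ∀ {i j : ℤ} (hi : _ + 0 = i) (hj : _ + 0 = j) (h : i + j = _),
        (D.twisted E).comp (eps g (.nil e) hi) (eps f (.nil e) hj) h =
          (D.twisted E).comp (eps g (.nil e) (Int.add_zero _)) (eps f (.nil e) (Int.add_zero _))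
            (by omega) := by
      intro i j hi hj h
      obtain rfl := hi.symm.trans (add_zero _)
      obtain rfl := hj.symm.trans (add_zero _)
      rfl
    exact this _ _ _
  map_d f := Mor.sound (.d_eps_nil e f _)

section

variable {M : Type*} [AddCommGroup M] [Module k M] {x y : D.Obj} {e e' : E.Obj} {n N : ℤ}

/-- An empty chain has exactly one insertion; its entries are the id ⊗ h. -/
theorem ins_nil_left_eq (hs : Chain E e e' n) (h : 0 + n = n)
    (F : Chain (D.twisted E) (pt x e) (pt x e') n → M) :
    ins (.nil x) hs h F = F (hs.map (rightOver E x)) := by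
  induction hs with
  | nil e => exact ins_nil_nil F h
  | @cons _ _ _ p q n a hs h' ih =>
    rw [ins_nil_cons]
    rw [ins_cons_eq, ← ins_cons_eq (.nil x) (right x a) hs (zero_add q) h', ih]
    rfl

/-- Every piece of an empty chain is empty, so the only insertion has the entries ε(g; ) = g ⊗ id.
-/
theorem ins_nil_right_eq (gs : Chain D x y n) (h : n + 0 = n)
    (F : Chain (D.twisted E) (pt x e) (pt y e) n → M) :
    ins gs (.nil e) h F = F (gs.map (leftOver D e)) := by
  induction gs with
  | nil x => exact ins_nil_nil F h
  | @cons _ _ _ p q n g gs h' ih =>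
    rw [ins_cons_nil, insEps, wsum_cuts_nil, mul_zero, sgn_zero, one_smul, ins_cons_eq,
      insHead_eps_congr (h' := Int.add_zero p), ← ins_cons_eq gs _ _ (add_zero q) h', ih]
    rfl

end

end Twisted

/-! ### Associativity of insertions. -/

namespace Twisted

open DGCat.coh Chain

variable {k : Type u} [CommRing k]

section

variable {D E : DGCat k} {M : Type*} [AddCommGroup M] [Module k M] {x y : D.Obj} {e e' : E.Obj}
  {m n N : ℤ}

theorem ins_cons_left_congr {x₁ : D.Obj} {p q : ℤ} (g : D.Hom x x₁ p) (gs : Chain D x₁ y q)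
    (hs : Chain E e e' n) (h' : p - 1 + q = m) (h : m + n = N)
    {F F' : Chain (D.twisted E) (pt x e) (pt y e') N → M}
    (hF : ∀ {z : (D.twisted E).Obj} {p q : ℤ} (a : (D.twisted E).Hom _ z p) (c : Chain _ z _ q)
      (h : p - 1 + q = N), F (.cons a c h) = F' (.cons a c h)) :
    ins (.cons g gs h') hs h F = ins (.cons g gs h') hs h F' := by
  rw [← sub_eq_zero]
  refine (wsum_sub _ _ _).symm.trans ?_
  exact ins_cons_left_eq_zero g gs hs h' h fun a c h => by rw [hF, sub_self]

/-- The decomposition by the first entry, which in this case holds for two empty chains as well,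
since `insRight` vanishes there. -/
theorem ins_insRight {C : DGCat k} {c c' : C.Obj} {l L : ℤ} (cs : Chain C c c' l)
    (gs : Chain D x y m)
    (hs : Chain E e e' n) (h : m + n = N) (h' : l + N = L)
    (F : Chain (C.twisted (D.twisted E)) (pt c (pt x e)) (pt c' (pt y e')) L → M) :
    (ins gs hs h fun u => insRight cs u h' F) = (insEps gs hs h fun u => insRight cs u h' F) +
      insRight gs hs h fun u => insRight cs u h' F := by
  cases gs with
  | cons g gs h' => exact ins_cons_left g gs hs h' h _
  | nil x =>
    rw [insEps, zero_add (M := M)]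
    cases hs with
    | cons a hs h₁ => exact ins_nil_left a hs h₁ h _
    | nil e =>
      obtain rfl : N = 0 := by omega
      rw [ins_nil_nil]
      rfl

end

variable {C D E : DGCat k}

/-- Inserting an empty chain applies id_x ⊗ - to every entry. On D ⊗ E this dg functor is (id_x ⊗ -)
⊗ id_E followed by α, as one sees on generators. -/
theorem ins_ins_nil {M : Type*} [AddCommGroup M] [Module k M] {x : C.Obj} {y y' : D.Obj}
    {z z' : E.Obj} {n r i j N : ℤ} (hs : Chain D y y' n) (ks : Chain E z z' r) (h₁ : n + r = i)
    (h₂ : 0 + i = N) (h₃ : 0 + n = j) (h₄ : j + r = N)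
    (F : Chain (C.twisted (D.twisted E)) (pt x (pt y z)) (pt x (pt y' z')) N → M) :
    (ins hs ks h₁ fun u => ins (.nil x) u h₂ F) =
      ins (.nil x) hs h₃ fun v => ins v ks h₄ fun w => F (w.map (assoc C D E)) := by
  obtain rfl : i = N := by omega
  obtain rfl : n = j := by omega
  rw [ins_nil_left_eq]
  simp only [ins_nil_left_eq]
  have := ins_map (rightOver D x) (𝟙 E : DGFunctor E E).toOver hs ks h₄
    fun w => F (w.map (assoc C D E))
  rw [Chain.map_id] at this
  refine Eq.trans ?_ this.symm
  refine ins_congr _ _ _ fun u => congrArg F ?_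
  refine Eq.trans ?_ (Chain.map_map (mapOver (rightOver D x) (𝟙 E : DGFunctor E E).toOver)
    (assoc C D E) u).symm
  refine congrArg (fun G => u.map G) ?_
  refine hom_ext (fun d _ _ _ g => rfl) fun g _ _ _ _ c h => ?_
  exact ((assoc_eps_right x g (c.map (𝟙 E : DGFunctor E E).toOver) h).trans
    (congrArg (fun c => right x (eps g c h)) c.map_id)).symm

section InsIns

variable {M : Type*} [AddCommGroup M] [Module k M] {x x' : C.Obj} {y y' : D.Obj} {z z' : E.Obj}
  {m n r i j N : ℤ}

/-- On one side the leading entry is ε(g; w), where w runs over the insertions of a piece of `hs`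
into a piece of `ks`. On the other side it is the image under α of ε(ε(g; …); …), which is the sum
of these. Multilinearity of `F` takes the sum out of the entry. -/
theorem insEps_insEps {x₁ : C.Obj} {p q : ℤ} (g : C.Hom x x₁ p) (gs : Chain C x₁ x' q)
    (ih : ∀ {y : D.Obj} {z : E.Obj} {n r i j N : ℤ} (hs : Chain D y y' n) (ks : Chain E z z' r)
      (h₁ : n + r = i) (h₂ : q + i = N) (h₃ : q + n = j) (h₄ : j + r = N)
      {F : Chain (C.twisted (D.twisted E)) (pt x₁ (pt y z)) (pt x' (pt y' z')) N → M}, Multilin F →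
      (ins hs ks h₁ fun u => ins gs u h₂ F) =
        ins gs hs h₃ fun v => ins v ks h₄ fun w => F (w.map (assoc C D E)))
    (hs : Chain D y y' n) (ks : Chain E z z' r) (h' : p - 1 + q = m) (h₁ : n + r = i)
    (h₂ : m + i = N) (h₃ : m + n = j) (h₄ : j + r = N)
    {F : Chain (C.twisted (D.twisted E)) (pt x (pt y z)) (pt x' (pt y' z')) N → M}
    (hF : Multilin F) :
    (ins hs ks h₁ fun u => insEps (.cons g gs h') u h₂ F) =
      insEps (.cons g gs h') hs h₃ fun v => insEps v ks h₄ fun w => F (w.map (assoc C D E)) := by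
  simp only [insEps, ins_cuts]
  refine wsum_congr _ fun s => ?_
  rw [ins_wsum, ← wsum_smul]
  refine wsum_congr _ fun t => ?_
  have := s.h
  have := t.h
  simp only [ins_smul]
  rw [smul_smul, smul_smul, ← sgn_add, ← sgn_add,
    sgn_congr (show Even (s.p * t.q + (p - 1) * (s.q + t.q) -
      ((p - 1) * s.q + (p + s.p - 1) * t.q)) from ⟨0, by ring⟩)]
  refine congrArg _ ?_
  have key : ∀ {d l : ℤ} (w : Chain (D.twisted E) (pt y z) (pt s.mid t.mid) (s.p + t.p))
      (hd : p + (s.p + t.p) = d) (v : Chain (C.twisted D) (pt x₁ s.mid) (pt x' y') (q + s.q))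
      (hl : q + s.q + t.q = l) (hN : d - 1 + l = N),
      (ins v t.snd hl fun w' => F (.cons (eps g w hd) (w'.map (assoc C D E)) hN)) =
        ins v t.snd (by omega : _ = q + (s.q + t.q)) fun w' =>
          F (.cons (eps g w rfl) (w'.map (assoc C D E)) (by omega)) := by
    intro d l w hd v hl hN
    obtain rfl : l = q + (s.q + t.q) := by omega
    subst hd
    rfl
  have hr : ∀ (v : Chain (C.twisted D) (pt x₁ s.mid) (pt x' y') (q + s.q)),
      (ins v t.snd rfl fun w' => F (Chain.map (assoc C D E)
        (.cons (eps (eps g s.fst rfl) t.fst rfl) w' (by omega)))) =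
      ins s.fst t.fst rfl fun w => ins v t.snd (by omega : _ = q + (s.q + t.q)) fun w' =>
          F (.cons (eps g w rfl) (w'.map (assoc C D E)) (by omega)) := by
    intro v
    rw [← ins_congr _ _ _ fun w => key w (by omega : _ = p + s.p + t.p) v rfl (by omega),
      ins_ins_comm]
    refine ins_congr _ _ _ fun w' => ?_
    rw [Chain.map, assoc_eps_eps]
    rw [ins, hF.cons_wsum]
    rfl
  refine Eq.trans (ins_congr s.fst t.fst rfl fun w => ih s.snd t.snd rfl rfl rfl
    (by omega) (hF.cons (eps g w rfl) (by omega))) ?_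
  refine (ins_ins_comm _ _ _ _ _ _ _).trans ?_
  exact ins_congr _ _ _ fun v => (hr v).symm

/-- The leading entry is id ⊗ ε(a; …) with `a` the first morphism of `hs`, which is the image under
α of ε(id ⊗ a; …). The rest has a shorter `hs`. -/
theorem insRight_insEps (gs : Chain C x x' m)
    (hs : Chain D y y' n)  (ih : ∀ {y₁ : D.Obj} {z : E.Obj} {p n' r i j N : ℤ} (a : D.Hom y y₁ p)
      (hs' : Chain D y₁ y' n') (h : p - 1 + n' = n) (_ : hs = .cons a hs' h) (ks : Chain E z z' r)
      (h₁ : n' + r = i) (h₂ : m + i = N) (h₃ : m + n' = j) (h₄ : j + r = N)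
      {F : Chain (C.twisted (D.twisted E)) (pt x (pt y₁ z)) (pt x' (pt y' z')) N → M}, Multilin F →
      (ins hs' ks h₁ fun u => ins gs u h₂ F) =
        ins gs hs' h₃ fun v => ins v ks h₄ fun w => F (w.map (assoc C D E)))
    (ks : Chain E z z' r) (h₁ : n + r = i)
    (h₂ : m + i = N) (h₃ : m + n = j) (h₄ : j + r = N)
    {F : Chain (C.twisted (D.twisted E)) (pt x (pt y z)) (pt x' (pt y' z')) N → M}
    (hF : Multilin F) :
    (insEps hs ks h₁ fun u => insRight gs u h₂ F) =
      insRight gs hs h₃ fun v => insEps v ks h₄ fun w => F (w.map (assoc C D E)) := by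
  cases hs with
  | nil y => rfl
  | @cons _ y₁ _ p q _ a hs h =>
    simp only [insEps, insRight]
    rw [ins_wsum]
    refine wsum_congr _ fun t => ?_
    have := t.h
    rw [ins_smul]
    refine congrArg _ ?_
    have key : ∀ {l : ℤ} (v : Chain (C.twisted D) (pt x y₁) (pt x' y') (m + q))
        (hl : m + q + t.q = l) (hN : p + t.p - 1 + l = N),
        (ins v t.snd hl fun w' => F (.cons (right x (eps a t.fst rfl)) (w'.map (assoc C D E)) hN)) =
          ins v t.snd (by omega : _ = m + (q + t.q)) fun w' =>
            F (.cons (right x (eps a t.fst rfl)) (w'.map (assoc C D E)) (by omega)) := by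
      intro l v hl hN
      obtain rfl : l = m + (q + t.q) := by omega
      rfl
    refine (ih a hs h rfl t.snd rfl rfl rfl (by omega) (hF.cons _ _)).trans ?_
    refine ins_congr _ _ _ fun v => ((key v rfl (by omega)).symm.trans ?_)
    refine ins_congr _ _ _ fun w' => ?_
    rw [Chain.map, assoc_eps_right]

/-- The leading entry is id ⊗ (id ⊗ a) with `a` the first morphism of `ks`. The rest has a shorter
`ks`. -/
theorem insRight_insRight (gs : Chain C x x' m)
    (hs : Chain D y y' n) (ks : Chain E z z' r)
    (ih : ∀ {z₁ : E.Obj} {p r' i N : ℤ} (a : E.Hom z z₁ p)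
      (ks' : Chain E z₁ z' r') (h : p - 1 + r' = r) (_ : ks = .cons a ks' h)
      (h₁ : n + r' = i) (h₂ : m + i = N) (h₃ : m + n = j) (h₄ : j + r' = N)
      {F : Chain (C.twisted (D.twisted E)) (pt x (pt y z₁)) (pt x' (pt y' z')) N → M}, Multilin F →
      (ins hs ks' h₁ fun u => ins gs u h₂ F) =
        ins gs hs h₃ fun v => ins v ks' h₄ fun w => F (w.map (assoc C D E)))
    (h₁ : n + r = i)
    (h₂ : m + i = N) (h₃ : m + n = j) (h₄ : j + r = N)
    {F : Chain (C.twisted (D.twisted E)) (pt x (pt y z)) (pt x' (pt y' z')) N → M}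
    (hF : Multilin F) :
    (insRight hs ks h₁ fun u => insRight gs u h₂ F) =
      ins gs hs h₃ fun v => insRight v ks h₄ fun w => F (w.map (assoc C D E)) := by
  cases ks with
  | nil y => simp only [insRight, ins_zero]
  | @cons _ y₁ _ p q _ a ks h =>
    simp only [insRight]
    have key : ∀ {l : ℤ} (v : Chain (C.twisted D) (pt x y) (pt x' y') j)
        (hl : j + q = l) (hN : p - 1 + l = N),
        (ins v ks hl fun w' => F (.cons (right x (right y a)) (w'.map (assoc C D E)) hN)) =
          ins v ks (by omega : _ = m + (n + q)) fun w' =>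
            F (.cons (right x (right y a)) (w'.map (assoc C D E)) (by omega)) := by
      intro l v hl hN
      obtain rfl : l = m + (n + q) := by omega
      rfl
    refine (ih a ks h rfl rfl rfl h₃ (by omega) (hF.cons _ _)).trans ?_
    exact ins_congr _ _ _ fun v => ((key v rfl (by omega)).symm)

/-- Insertions are associative up to the associativity dg functor. -/
theorem ins_ins (gs : Chain C x x' m) (hs : Chain D y y' n) (ks : Chain E z z' r)
    (h₁ : n + r = i) (h₂ : m + i = N) (h₃ : m + n = j) (h₄ : j + r = N)
    {F : Chain (C.twisted (D.twisted E)) (pt x (pt y z)) (pt x' (pt y' z')) N → M}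
    (hF : Multilin F) :
    (ins hs ks h₁ fun u => ins gs u h₂ F) =
      ins gs hs h₃ fun v => ins v ks h₄ fun w => F (w.map (assoc C D E)) := by
  -- The three possible leading entries ε(g; …), id ⊗ ε(h; …) and id ⊗ (id ⊗ k) shorten `gs`, `hs`
  -- and `ks` respectively, so three inductions are nested in this order.
  induction gs generalizing y z n r i j N with
  | nil x => exact ins_ins_nil hs ks h₁ h₂ h₃ h₄ F
  | @cons x₀ x₁ x₂ p q m g gs h' ih =>
    have key : ∀ {y : D.Obj} {z : E.Obj} {n r i j N : ℤ} (hs : Chain D y y' n)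
        (ks : Chain E z z' r) (h₁ : n + r = i) (h₂ : m + i = N) (h₃ : m + n = j) (h₄ : j + r = N)
        {F : Chain (C.twisted (D.twisted E)) (pt x₀ (pt y z)) (pt x₂ (pt y' z')) N → M}
        (_ : Multilin F)
        (_ : (insEps hs ks h₁ fun u => insRight (.cons g gs h') u h₂ F) =
          insRight (.cons g gs h') hs h₃ fun v => insEps v ks h₄ fun w => F (w.map (assoc C D E)))
        (_ : (insRight hs ks h₁ fun u => insRight (.cons g gs h') u h₂ F) =
          ins (.cons g gs h') hs h₃ fun v => insRight v ks h₄ fun w => F (w.map (assoc C D E))),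
        (ins hs ks h₁ fun u => ins (.cons g gs h') u h₂ F) =
          ins (.cons g gs h') hs h₃ fun v => ins v ks h₄ fun w => F (w.map (assoc C D E)) := by
      intro y z n r i j N hs ks h₁ h₂ h₃ h₄ F hF e₁ e₂
      simp only [ins_cons_left g gs _ h' h₂]
      rw [ins_add, insEps_insEps g gs ih hs ks h' h₁ h₂ h₃ h₄ hF, ins_insRight, e₁, e₂,
        ← add_assoc (G := M), ← ins_cons_left, ← ins_add]
      exact ins_cons_left_congr _ _ _ _ _ fun a c h => (ins_cons_left a c ks h h₄ _).symm
    -- The innermost induction, on `ks`, with the statement for shorter `hs` as a hypothesis.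
    have step : ∀ {y : D.Obj} {n : ℤ} (hs : Chain D y y' n)
        (_ : ∀ {y₁ : D.Obj} {z : E.Obj} {p n' r i j N : ℤ} (a : D.Hom y y₁ p)
          (hs' : Chain D y₁ y' n') (h : p - 1 + n' = n) (_ : hs = .cons a hs' h)
          (ks : Chain E z z' r) (h₁ : n' + r = i) (h₂ : m + i = N) (h₃ : m + n' = j)
          (h₄ : j + r = N)
          {F : Chain (C.twisted (D.twisted E)) (pt x₀ (pt y₁ z)) (pt x₂ (pt y' z')) N → M},
          Multilin F → (ins hs' ks h₁ fun u => ins (.cons g gs h') u h₂ F) =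
            ins (.cons g gs h') hs' h₃ fun v => ins v ks h₄ fun w => F (w.map (assoc C D E)))
        {z : E.Obj} {r i j N : ℤ} (ks : Chain E z z' r) (h₁ : n + r = i) (h₂ : m + i = N)
        (h₃ : m + n = j) (h₄ : j + r = N)
        {F : Chain (C.twisted (D.twisted E)) (pt x₀ (pt y z)) (pt x₂ (pt y' z')) N → M}
        (_ : Multilin F), (ins hs ks h₁ fun u => ins (.cons g gs h') u h₂ F) =
          ins (.cons g gs h') hs h₃ fun v => ins v ks h₄ fun w => F (w.map (assoc C D E)) := by
      intro y n hs ihs z r i j N ks h₁ h₂ h₃ h₄ F hF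
      induction ks generalizing i N with
      | nil z =>
        exact key hs _ h₁ h₂ h₃ h₄ hF (insRight_insEps _ hs ihs _ h₁ h₂ h₃ h₄ hF)
          (insRight_insRight _ hs _ (fun _ _ _ e => absurd e (by simp)) h₁ h₂ h₃ h₄ hF)
      | cons b ks h ihk =>
        refine key hs _ h₁ h₂ h₃ h₄ hF (insRight_insEps _ hs ihs _ h₁ h₂ h₃ h₄ hF)
          (insRight_insRight _ hs _ ?_ h₁ h₂ h₃ h₄ hF)
        intro _ _ _ _ _ _ _ _ e
        cases e
        intro h₁ h₂ h₃ h₄ F hF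
        exact ihk ih ks ‹_› key ihs h₁ h₂ h₄ hF
    induction hs generalizing z r i j N with
    | nil y => exact step _ (fun _ _ _ e => absurd e (by simp)) ks h₁ h₂ h₃ h₄ hF
    | cons a hs h ihh =>
      refine step _ ?_ ks h₁ h₂ h₃ h₄ hF
      intro _ _ _ _ _ _ _ _ _ _ _ e
      cases e
      intro ks h₁ h₂ h₃ h₄ F hF
      exact ihh ih ks h₁ h₂ h₃ h₄ hF key step

end InsIns

end Twisted

/-! ## The unit dg category -/

namespace DGCat

variable {k : Type u} [CommRing k]

theorem unit_hom_cases {x y : (unit k).Obj} {n : ℤ} (f : (unit k).Hom x y n)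
    {motive : ∀ {x y : (unit k).Obj} {n : ℤ}, (unit k).Hom x y n → Prop}
    (smul_id : ∀ (a : k) (x : (unit k).Obj), motive (a • (unit k).id x))
    (zero : ∀ {x y : (unit k).Obj} {n : ℤ}, motive (0 : (unit k).Hom x y n)) : motive f := by
  by_cases hn : n = 0
  · subst hn
    rw [show f = (f.1 : k) • (unit k).id x from Subtype.ext (mul_one f.1).symm]
    exact smul_id _ _
  · rw [show f = 0 from Subtype.ext (f.2 hn)]
    exact zero

/-- The identity of an object in degree `0`, and zero in the other degrees. -/
def idIn (A : DGCat k) (X : A.Obj) (n : ℤ) : A.Hom X X n :=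
  if h : n = 0 then A.reindex h.symm (A.id X) else 0

theorem d_idIn (A : DGCat k) (X : A.Obj) (n : ℤ) : A.d (A.idIn X n) = 0 := by
  rw [idIn]
  split
  · next h => subst h; exact A.d_id X
  · exact d_zero

/-- The dg functor on the unit dg category that is given by an object. -/
def unitOver (A : DGCat k) (X : A.Obj) : DGFunctorOver (unit k) A (fun _ => X) where
  map {_ _ n} a := (a.1 : k) • A.idIn X n
  map_add a b := add_smul a.1 b.1 _
  map_smul r a := mul_smul r a.1 _
  map_id _ := one_smul k _
  map_comp {_ _ _ p q n} b a h := by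
    rw [A.comp_smul, A.smul_comp]
    refine (mul_smul b.1 a.1 _).trans ((smul_comm _ _ _).trans ?_)
    by_cases hp : p = 0
    · by_cases hq : q = 0
      · subst hp hq
        obtain rfl : n = 0 := by omega
        exact congrArg _ (congrArg _ (A.id_comp _ _).symm)
      · rw [show (b.1 : k) = 0 from b.2 hq, zero_smul, zero_smul]
    · rw [show (a.1 : k) = 0 from a.2 hp, zero_smul, zero_smul]
  map_d a := by
    rw [A.d_smul, d_idIn, smul_zero]
    exact zero_smul _ _

namespace coh

variable {A : DGCat k} {p q m n : ℤ}

/-- The normalized cochains on the unit dg category vanish on the nonempty chains. -/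
theorem app_unit_cons {G G' : (coh (unit k) A).Obj} (φ : (coh (unit k) A).Hom G G' p)
    {x y z : (unit k).Obj} (g : (unit k).Hom x y q) (c : Chain (unit k) y z m) (h : q - 1 + m = n)
    {l : ℤ} (h' : p + n = l) : app φ (.cons g c h) h' = 0 :=
  unit_hom_cases (motive := fun {x y q} g => ∀ {m n l : ℤ} (c : Chain (unit k) y z m)
      (h : q - 1 + m = n) (h' : p + n = l), app φ (.cons g c h) h' = 0) g
    (fun a x m n l c h h' => by
      rw [(multilin φ _ _ h').cons_smul, app_hasId φ h' (.head c h), smul_zero])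
    (fun c h h' => (multilin φ _ _ h').cons_zero c h) c h h'

theorem ext_unit {G G' : (coh (unit k) A).Obj} {φ ψ : (coh (unit k) A).Hom G G' p}
    (H : ∀ (x : (unit k).Obj), app φ (.nil x) (Int.add_zero p) = app ψ (.nil x) (Int.add_zero p)) :
    φ = ψ :=
  ext fun {x y q n} c h => by
    cases c with
    | nil x =>
      obtain rfl : p = n := by omega
      exact H x
    | cons g c h' => rw [app_unit_cons, app_unit_cons]

/-- The cochain on the unit dg category that is given by a morphism. -/
def constHom {x y : A.Obj} (f : A.Hom x y p) :
    (coh (unit k) A).Hom (of ⟨_, unitOver A x⟩) (of ⟨_, unitOver A y⟩) p :=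
  mk (fun _ _ q n c h => match c, h with
      | .nil _, h => A.reindex (by omega) f
      | .cons _ _ _, _ => 0)
    (fun x y q n h c l H => by
      cases H with
      | head l c h => rw [wsum_map fun g => Chain.cons g c h]; simp
      | tail g h H => rw [wsum_map fun c => Chain.cons g c h]; simp)
    (fun _ _ _ _ c h hc => by cases hc <;> rfl)

theorem app_constHom {x y : A.Obj} (f : A.Hom x y p) (z : (unit k).Obj) :
    app (constHom f) (.nil z) (Int.add_zero p) = f :=
  app_mk _ _ _ _ _

/-- The dg functor `A → Coh(k, A)`. -/
def const (A : DGCat k) : DGFunctorOver A (coh (unit k) A) (fun x => of ⟨_, unitOver A x⟩) where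
  map f := constHom f
  map_add f g := ext_unit fun x => by rw [app_add, app_constHom, app_constHom, app_constHom]
  map_smul a f := ext_unit fun x => by rw [app_smul, app_constHom, app_constHom]
  map_id x := ext_unit fun z => by rw [app_constHom]; rfl
  map_comp {_ _ _ p q n} g f h := ext_unit fun z => by
    rw [app_constHom, app_comp, Chain.wsum_cuts_nil, mul_zero, sgn_zero, one_smul]
    have key : ∀ {i j : ℤ} (hi : q + 0 = i) (hj : p + 0 = j) (h' : i + j = n),
        A.comp (app (constHom g) (.nil z) hi) (app (constHom f) (.nil z) hj) h' =
          A.comp g f (by omega) := by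
      intro i j hi hj h'
      obtain rfl : q = i := by omega
      obtain rfl : p = j := by omega
      rw [app_constHom, app_constHom]
    exact (key rfl rfl _).symm
  map_d f := ext_unit fun z => by
    rw [app_constHom, app_d_nil _ _ (Int.add_zero _), app_constHom]

end coh

end DGCat

/-! ### The unit dg functors λ and ρ, and the inverse of ρ. -/

namespace Twisted

open DGCat.coh Chain

variable {k : Type u} [CommRing k]

section Unit

variable {A C : DGCat k}

/-- The unit dg functor `k ⊗ C → C`. -/
def lam (C : DGCat k) : DGFunctorOver ((DGCat.unit k).twisted C) C (fun x => x.2) :=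
  uncurry (DGCat.unitOver (DGCat.coh C C) (of (𝟙 C)))

/-- The unit dg functor `C → C ⊗ k`. -/
abbrev rho (C : DGCat k) : DGFunctorOver C (C.twisted (DGCat.unit k)) (fun c => pt c PUnit.unit) :=
  leftOver C (E := DGCat.unit k) PUnit.unit

/-- The inverse of the unit dg functor `C → C ⊗ k`. -/
def rhoInv (C : DGCat k) : DGFunctorOver (C.twisted (DGCat.unit k)) C (fun x => x.1) :=
  uncurry (const C)

theorem rho_comp_rhoInv (C : DGCat k) {x y : C.Obj} {n : ℤ} (f : C.Hom x y n) :
    (rhoInv C).map ((rho C).map f) = f := app_constHom f _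

theorem eps_unit_cons {x y : C.Obj} {p q r n m : ℤ} (f : C.Hom x y p) {a b c : (DGCat.unit k).Obj}
    (g : (DGCat.unit k).Hom a b q) (w : Chain (DGCat.unit k) b c r) (h : q - 1 + r = m)
    (h' : p + m = n) : eps f (.cons g w h) h' = 0 :=
  (app_epsHom f _ _).symm.trans (app_unit_cons _ _ _ _ _)

/-- On generators: id_c ⊗ g is a multiple of an identity because g is one, and ε(f; …) vanishes
unless the chain is empty, when it is ρ(f). -/
theorem rhoInv_comp_rho (C : DGCat k) {x y : (C.twisted (DGCat.unit k)).Obj} {n : ℤ}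
    (f : (C.twisted (DGCat.unit k)).Hom x y n) : (rho C).map ((rhoInv C).map f) = f :=
  isSub_induction (.equalizer ((rhoInv C).comp (rho C))
    (𝟙 (C.twisted (DGCat.unit k)) : DGFunctor _ _).toOver)
    (fun c _ _ _ g => DGCat.IsSub.of_unit
      (.equalizer (((rightOver (DGCat.unit k) c).comp (rhoInv C)).comp (rho C)) (rightOver _ c)) g)
    (fun {_ _ p} f _ _ q n c h => by
      cases c with
      | nil x =>
        obtain rfl : p = n := by omega
        exact congrArg (rho C).map (rho_comp_rhoInv C f)
      | cons g w h' =>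
        rw [eps_unit_cons, DGFunctorOver.map_zero, DGFunctorOver.map_zero]
        rfl) f

/-- The dg category k is generated by its identity, so by `isSub_eps` the morphisms ε(f; …) with f
in k are covered once the id ⊗ g are. -/
theorem hom_ext_unit {φ : ((DGCat.unit k).twisted C).Obj → A.Obj}
    {F G : DGFunctorOver ((DGCat.unit k).twisted C) A φ}
    (hr : ∀ (c : (DGCat.unit k).Obj) {x y : C.Obj} {n : ℤ} (g : C.Hom x y n),
      F.map (right c g) = G.map (right c g)) : F = G :=
  hom_ext hr fun f => DGCat.IsSub.of_unit (isSub_eps (.equalizer F G) hr) f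

end Unit

/-! ### The coherence axioms. -/

section Coherence

variable {A C D E C' D' E' : DGCat k} {φ : C.Obj → C'.Obj} {ψ : D.Obj → D'.Obj}
  {χ : E.Obj → E'.Obj}

/-- The identity dg functor. -/
abbrev idOver (C : DGCat k) : DGFunctorOver C C (fun x => x) := (𝟙 C : DGFunctor C C).toOver

theorem _root_.DGFunctorOver.map_ins {B B' : DGCat k} {ω : B.Obj → B'.Obj}
    (F : DGFunctorOver B B' ω) {X Y : B.Obj} {x y : D.Obj} {e e' : E.Obj} {m n N l : ℤ}
    (gs : Chain D x y m) (hs : Chain E e e' n) (h : m + n = N)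
    (K : Chain (D.twisted E) (pt x e) (pt y e') N → B.Hom X Y l) :
    F.map (ins gs hs h K) = ins gs hs h fun w => F.map (K w) := F.map_wsum _ _

theorem eps_ins {a b : C.Obj} {x y : D.Obj} {e e' : E.Obj} {z z' : A.Obj} {m n N l p q : ℤ}
    (gs : Chain D x y m) (hs : Chain E e e' n) (h : m + n = N)
    (K : Chain (D.twisted E) (pt x e) (pt y e') N → C.Hom a b l) (c : Chain A z z' p)
    (h' : l + p = q) : eps (ins gs hs h K) c h' = ins gs hs h fun w => eps (K w) c h' :=
  eps_wsum _ _ _ _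

theorem assoc_eps_eps_of_eq {a b : C.Obj} {x y : D.Obj} {e e' : E.Obj} {p q r i j n : ℤ}
    (f : C.Hom a b p) (gs : Chain D x y q) (hs : Chain E e e' r) (hi : p + q = i) (h : i + r = n)
    (hj : q + r = j) : (assoc C D E).map (eps (eps f gs hi) hs h) =
      ins gs hs hj fun w => eps f w (by omega : p + j = n) := by
  subst hj; exact assoc_eps_eps f gs hs hi h

theorem assoc_naturality (F : DGFunctorOver C C' φ) (G : DGFunctorOver D D' ψ)
    (H : DGFunctorOver E E' χ) : (mapOver (mapOver F G) H).comp (assoc C' D' E') =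
      (assoc C D E).comp (mapOver F (mapOver G H)) := by
  refine hom_ext₃ (fun _ _ _ _ _ _ => rfl) (fun c _ _ _ g _ _ _ _ hs h => ?_)
    fun f _ _ _ _ gs hi _ _ _ _ hs h => ?_
  · exact (assoc_eps_right (φ c) (G.map g) (hs.map H) h).trans
      (congrArg (mapOver F (mapOver G H)).map (assoc_eps_right c g hs h)).symm
  · rename_i p _ _ q i _ _ r n
    refine (assoc_eps_eps (F.map f) (gs.map G) (hs.map H) hi h).trans ?_
    refine (ins_map G H gs hs rfl _).trans ?_
    refine Eq.trans ?_ (congrArg (mapOver F (mapOver G H)).map (assoc_eps_eps f gs hs hi h)).symm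
    have e := DGFunctorOver.map_ins (mapOver F (mapOver G H)) gs hs rfl
      fun w => eps f w (by omega : p + (q + r) = n)
    exact e.symm

/-- On ε(ε(ε(f; gs); hs); ks) both sides are sums of ε(f; -) over double insertions: one side
inserts `hs` into `ks` and then `gs` into the result, the other `gs` into `hs` and the result into
`ks`. These agree by `ins_ins`. The remaining generators only involve the formulas for α on three
factors. -/
theorem pentagon (A C D E : DGCat k) :
    (assoc (A.twisted C) D E).comp (assoc A C (D.twisted E)) =
      (mapOver (assoc A C D) (idOver E)).comp ((assoc A (C.twisted D) E).comp
        (mapOver (idOver A) (assoc C D E))) := by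
  refine hom_ext₄ (fun _ _ _ _ _ _ _ => rfl) (fun a c _ _ _ g _ _ _ _ hs h => ?_)
    (fun a _ _ _ g _ _ _ _ hs hi _ _ _ _ ks h => ?_)
    fun f _ _ _ _ gs hi _ _ _ _ hs hj _ _ _ _ ks h => ?_
  · refine (congrArg (assoc A C (D.twisted E)).map (assoc_eps_right (pt a c) g hs h)).trans ?_
    refine Eq.trans ?_ (congrArg (mapOver (idOver A) (assoc C D E)).map
      (assoc_eps_right a (right c g) (hs.map (idOver E)) h)).symm
    refine Eq.trans ?_ (congrArg (right a) (assoc_eps_right c g (hs.map (idOver E)) h)).symm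
    rw [Chain.map_id]
    rfl
  · refine (congrArg (assoc A C (D.twisted E)).map (assoc_eps_eps (right a g) hs ks hi h)).trans ?_
    refine (DGFunctorOver.map_ins _ _ _ _ _).trans ?_
    have e : (mapOver (assoc A C D) (idOver E)).map (eps (eps (right a g) hs hi) ks h) =
        eps (right a (eps g hs hi)) ks h :=
      congrArg₂ (fun f c => eps f c h) (assoc_eps_right a g hs hi) ks.map_id
    refine Eq.trans ?_ (congrArg ((assoc A (C.twisted D) E).comp
        (mapOver (idOver A) (assoc C D E))).map e).symm
    refine Eq.trans ?_ (congrArg (mapOver (idOver A) (assoc C D E)).map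
      (assoc_eps_right a (eps g hs hi) ks h)).symm
    refine Eq.trans ?_ (congrArg (right a) (assoc_eps_eps g hs ks hi h)).symm
    refine Eq.trans ?_ (right_wsum _ _).symm
    exact ins_congr _ _ _ fun w => assoc_eps_right a g w _
  · rename_i a b p x y q i z z' r j e e' s n
    refine (congrArg (assoc A C (D.twisted E)).map
      (assoc_eps_eps (eps f gs hi) hs ks hj h)).trans ?_
    refine (DGFunctorOver.map_ins _ _ _ _ _).trans ?_
    refine (ins_congr _ _ _ fun w => assoc_eps_eps f gs w hi _).trans ?_
    -- The first argument of the outer ε becomes a sum under α, and ε is linear in it.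
    have he : (mapOver (assoc A C D) (idOver E)).map (eps (eps (eps f gs hi) hs hj) ks h) =
        ins gs hs rfl fun v => eps (eps f v (by omega)) ks h :=
      (congrArg₂ (fun f c => eps f c h) (assoc_eps_eps f gs hs hi hj) ks.map_id).trans
        (eps_ins gs hs rfl _ ks h)
    refine Eq.trans ?_ (congrArg ((assoc A (C.twisted D) E).comp
        (mapOver (idOver A) (assoc C D E))).map he).symm
    refine Eq.trans ?_ (DGFunctorOver.map_ins ((assoc A (C.twisted D) E).comp
      (mapOver (idOver A) (assoc C D E))) gs hs rfl
        fun v => eps (eps f v (by omega : p + (q + r) = j)) ks h).symm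
    have hv : ∀ v : Chain (C.twisted D) (pt x z) (pt y z') (q + r),
        ((assoc A (C.twisted D) E).comp (mapOver (idOver A) (assoc C D E))).map
          (eps (eps f v (by omega : p + (q + r) = j)) ks h) = ins v ks (add_assoc q r s)
            fun w => eps f (w.map (assoc C D E)) (by omega : p + (q + (r + s)) = n) := fun v => by
      have e₁ := assoc_eps_eps_of_eq f v ks (by omega : p + (q + r) = j) h (add_assoc q r s)
      have e₂ := DGFunctorOver.map_ins (mapOver (idOver A) (assoc C D E)) v ks (add_assoc q r s)
        fun w => eps f w (by omega : p + (q + (r + s)) = n)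
      exact (congrArg (mapOver (idOver A) (assoc C D E)).map e₁).trans e₂
    exact (ins_ins gs hs ks rfl rfl rfl (add_assoc _ _ _) (eps_multilin f _ _ _)).trans
      (congrArg (ins gs hs rfl) (funext fun v => (hv v).symm))

/-- On generators with an identity of k in the first place, both sides are immediate. All others
reduce to these because f, as a morphism of k, lies in the dg subcategory generated by the identity.
-/
theorem assoc_comp_lam (C D : DGCat k) : (assoc (DGCat.unit k) C D).comp (lam (C.twisted D)) =
    mapOver (lam C) (idOver D) := by
  have hr : ∀ (c : (DGCat.unit k).Obj) (d : C.Obj) {x y : D.Obj} {n : ℤ} (g : D.Hom x y n),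
      ((assoc (DGCat.unit k) C D).comp (lam (C.twisted D))).map (right (pt c d) g) =
        (mapOver (lam C) (idOver D)).map (right (pt c d) g) := fun _ _ _ _ _ _ => rfl
  have her : ∀ (c : (DGCat.unit k).Obj) {x y : C.Obj} {p : ℤ} (g : C.Hom x y p) {e e' : D.Obj}
      {q n : ℤ} (hs : Chain D e e' q) (h : p + q = n),
      ((assoc (DGCat.unit k) C D).comp (lam (C.twisted D))).map (eps (right c g) hs h) =
        (mapOver (lam C) (idOver D)).map (eps (right c g) hs h) := fun c _ _ _ g _ _ _ _ hs h =>
    (congrArg (lam (C.twisted D)).map (assoc_eps_right c g hs h)).trans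
      (congrArg (fun w => eps g w h) hs.map_id).symm
  refine hom_ext₃ hr her fun f _ _ _ _ gs hi _ _ _ _ hs h => ?_
  exact DGCat.IsSub.of_unit (isSub_eps (isSub_eps (.equalizer _ _) fun c => hr c.1 c.2) her) f
    gs hi hs h

/-- ρ makes ε(f; hs) into ε(f ⊗ id; hs), whose image under α has a single summand as the middle
chain is empty. Its entries id_* ⊗ h are taken back to h by λ. -/
theorem rho_comp_assoc_comp_lam (C D : DGCat k) :
    (mapOver (rho C) (idOver D)).comp ((assoc C (DGCat.unit k) D).comp
      (mapOver (idOver C) (lam D))) = idOver (C.twisted D) := by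
  refine hom_ext (fun _ _ _ _ _ => rfl) fun {_ _ p} f _ _ q n hs h => ?_
  have e : (mapOver (rho C) (idOver D)).map (eps f hs h) =
      eps (eps f (.nil (D := DGCat.unit k) PUnit.unit) (Int.add_zero p)) hs h :=
    congrArg (fun w => eps _ w h) hs.map_id
  refine (congrArg ((assoc C (DGCat.unit k) D).comp (mapOver (idOver C) (lam D))).map e).trans ?_
  refine (congrArg (mapOver (idOver C) (lam D)).map (assoc_eps_eps_of_eq f
    (.nil (D := DGCat.unit k) PUnit.unit) hs _ h (zero_add q))).trans ?_
  refine (congrArg (mapOver (idOver C) (lam D)).map (ins_nil_left_eq (D := DGCat.unit k)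
    (x := PUnit.unit) hs (zero_add q) fun w => eps f w h)).trans ?_
  refine congrArg (fun w => eps f w h) ?_
  refine (Chain.map_map (rightOver D PUnit.unit) (lam D) hs).trans ?_
  exact Chain.map_eq_self _ (fun _ => rfl) hs

theorem rho_comp_assoc (C D : DGCat k) : (rho (C.twisted D)).comp (assoc C D (DGCat.unit k)) =
    mapOver (idOver C) (rho D) := by
  refine hom_ext (fun c _ _ _ g => ?_) fun {_ _ p} f _ _ q n gs h => ?_
  · exact assoc_eps_right c g (.nil (D := DGCat.unit k) PUnit.unit) (Int.add_zero _)
  · refine (assoc_eps_eps_of_eq f gs (.nil (D := DGCat.unit k) PUnit.unit) h (Int.add_zero n)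
      (add_zero q)).trans ?_
    exact ins_nil_right_eq (E := DGCat.unit k) gs (add_zero q) fun w => eps f w h

end Coherence

end Twisted

namespace Twisted

open DGCat.coh Chain

variable {k : Type u} [CommRing k]

theorem lam_naturality {C C' : DGCat k} {φ : C.Obj → C'.Obj} (F : DGFunctorOver C C' φ) :
    (mapOver (idOver (DGCat.unit k)) F).comp (lam C') = (lam C).comp F :=
  hom_ext_unit fun _ _ _ _ _ => rfl

theorem rho_naturality {C C' : DGCat k} {φ : C.Obj → C'.Obj} (F : DGFunctorOver C C' φ) :
    F.comp (rho C') = (rho C).comp (mapOver F (idOver (DGCat.unit k))) :=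
  DGFunctorOver.ext fun _ => rfl

theorem rho_comp_lam_unit (k : Type u) [CommRing k] :
    (rho (DGCat.unit k)).comp (lam (DGCat.unit k)) = idOver (DGCat.unit k) :=
  DGFunctorOver.ext fun f => DGCat.IsSub.of_unit
    (.equalizer ((rho (DGCat.unit k)).comp (lam (DGCat.unit k))) (idOver (DGCat.unit k))) f

theorem lam_comp_right (C : DGCat k) :
    (lam C).comp (rightOver (C := DGCat.unit k) C PUnit.unit) =
      idOver ((DGCat.unit k).twisted C) :=
  hom_ext_unit fun _ _ _ _ _ => rfl

end Twisted

/-! ### Assembly of the skew monoidal structure, and perfectness. -/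

namespace DGCat

open Twisted

variable (k : Type u) [CommRing k]

/-- The skew monoidal category of small dg categories with the twisted tensor product. -/
def skewMonoidal : SkewMonoidal (DGCat.twistedFunctor k) (DGCat.unit k) where
  α C D E := (Twisted.assoc C D E).toHom
  lam C := (lam C).toHom
  rho C := (rho C).toHom
  α_naturality F G H :=
    congrArg (DGFunctor.mk _) (assoc_naturality F.toOver G.toOver H.toOver)
  lam_naturality F := congrArg (DGFunctor.mk _) (Twisted.lam_naturality F.toOver)
  rho_naturality F := congrArg (DGFunctor.mk _) (Twisted.rho_naturality F.toOver)
  pentagon A C D E := congrArg (DGFunctor.mk _) (Twisted.pentagon A C D E)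
  unit_left C D := congrArg (DGFunctor.mk _) (assoc_comp_lam C D)
  unit_middle C D := congrArg (DGFunctor.mk _) (rho_comp_assoc_comp_lam C D)
  unit_right C D := congrArg (DGFunctor.mk _) (rho_comp_assoc C D)
  unit_unit := congrArg (DGFunctor.mk _) (rho_comp_lam_unit k)

theorem isIso_lam (C : DGCat k) : IsIso ((skewMonoidal k).lam C) :=
  ⟨(rightOver (C := DGCat.unit k) C PUnit.unit).toHom,
    congrArg (DGFunctor.mk _) (lam_comp_right C), rfl⟩

theorem isIso_rho (C : DGCat k) : IsIso ((skewMonoidal k).rho C) :=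
  ⟨(rhoInv C).toHom,
    congrArg (DGFunctor.mk _) (DGFunctorOver.ext fun f => rho_comp_rhoInv C f),
    congrArg (DGFunctor.mk _) (DGFunctorOver.ext fun f => rhoInv_comp_rho C f)⟩

end DGCat

/-- In the middle unit axiom the composite is an identity and the two outer factors are images of
isomorphisms, so the middle factor α_{X,I,Y} is an isomorphism by two-out-of-three. -/
theorem SkewMonoidal.isPerfect_of_isIso {𝒞 : Type*} [Category 𝒞] {T : 𝒞 × 𝒞 ⥤ 𝒞} {I : 𝒞}
    (S : SkewMonoidal T I) (hl : ∀ X : 𝒞, IsIso (S.lam X)) (hr : ∀ X : 𝒞, IsIso (S.rho X)) :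
    S.IsPerfect where
  isIso_α X Y := by
    have h₁ : IsIso (T.map (Prod.mkHom (S.rho X) (𝟙 Y))) := by
      have : IsIso (Prod.mkHom (S.rho X) (𝟙 Y)) :=
        (isIso_prod_iff _ _).2 ⟨hr X, inferInstanceAs (IsIso (𝟙 Y))⟩
      infer_instance
    have h₂ : IsIso (T.map (Prod.mkHom (𝟙 X) (S.lam Y))) := by
      have : IsIso (Prod.mkHom (𝟙 X) (S.lam Y)) :=
        (isIso_prod_iff _ _).2 ⟨inferInstanceAs (IsIso (𝟙 X)), hl Y⟩
      infer_instance
    have h₃ : IsIso (S.α X I Y ≫ T.map (Prod.mkHom (𝟙 X) (S.lam Y))) := by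
      have : IsIso (T.map (Prod.mkHom (S.rho X) (𝟙 Y)) ≫
          S.α X I Y ≫ T.map (Prod.mkHom (𝟙 X) (S.lam Y))) := by
        rw [S.unit_middle]; infer_instance
      exact IsIso.of_isIso_comp_left (T.map (Prod.mkHom (S.rho X) (𝟙 Y))) _
    exact IsIso.of_isIso_comp_right _ (T.map (Prod.mkHom (𝟙 X) (S.lam Y)))
  isIso_lam := hl
  isIso_rho := hr

/-- Small dg categories over a field `k`, with the twisted tensor product, the unit dg category
`k`, the associativity maps `α` and the unit maps `λ` and `ρ`, form a perfect skew monoidal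
category. -/
theorem theorem1p3 (k : Type u) [Field k] :
    ∃ (α : ∀ C D E : DGCat k,
        DGFunctorOver ((C.twisted D).twisted E) (C.twisted (D.twisted E))
          (fun x => Twisted.pt x.1.1 (Twisted.pt x.1.2 x.2)))
      (lam : ∀ C : DGCat k, DGFunctorOver ((DGCat.unit k).twisted C) C (fun x => x.2))
      (rho : ∀ C : DGCat k,
        DGFunctorOver C (C.twisted (DGCat.unit k)) (fun c => Twisted.pt c PUnit.unit)),
      (∀ C D E : DGCat k, Twisted.IsAssociator (α C D E)) ∧
      (∀ (C : DGCat k) {x y : C.Obj} {n : ℤ} (g : C.Hom x y n),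
        (lam C).map (Twisted.right (C := DGCat.unit k) PUnit.unit g) = g) ∧
      (∀ (C : DGCat k) {x y : C.Obj} {n : ℤ} (f : C.Hom x y n),
        (rho C).map f =
          Twisted.eps f (Chain.nil (D := DGCat.unit k) PUnit.unit) (Int.add_zero n)) ∧
      ∃ S : SkewMonoidal (DGCat.twistedFunctor k) (DGCat.unit k),
        (∀ C D E : DGCat k, S.α C D E = (α C D E).toHom) ∧
        (∀ C : DGCat k, S.lam C = (lam C).toHom) ∧
        (∀ C : DGCat k, S.rho C = (rho C).toHom) ∧
        S.IsPerfect :=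
  ⟨fun C D E => Twisted.assoc C D E, fun C => Twisted.lam C, fun C => Twisted.rho C,
    fun C D E => Twisted.isAssociator_assoc C D E, fun _ _ _ _ _ => rfl, fun _ _ _ _ _ => rfl,
    DGCat.skewMonoidal k, fun _ _ _ => rfl, fun _ => rfl, fun _ => rfl,
    SkewMonoidal.isPerfect_of_isIso _ (DGCat.isIso_lam k) (DGCat.isIso_rho k)⟩
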